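/- Let $d\ge 1$ and let $a:\mathbb R^d\to[0,\infty)$ be measurable, not almost everywhere zero, with $a(y)\le C(1+|y|)^{-\alpha}$ for some $C>0$ and $\alpha>2d$; put $a^{(0)}=\int a(y)\,dy$. Let $\Gamma$ be the space of locally finite subsets $\gamma$ of $\mathbb R^d$ with the vague topology and its Borel $\sigma$-algebra, and let $\Theta\subset\Gamma$ be the set of those $\gamma$ for which there is $m\in\mathbb N$ with $|\gamma\cap B(n)|\le m\,\mathrm{vol}(B(n))$ for all integers $n\ge 1$, where $B(R)$ is the closed ball of radius $R$ around $0$. In the free Kawasaki process the particles move independently, each by the jump process $X_t=Y_{Z_t}$, where $Y$ is the Markov chain with transition density $(x,y)\mapsto a(x-y)/a^{(0)}$ and $Z$ is an independent Poisson process of rate $a^{(0)}$; its transition probability $\mathbf P_t(\gamma,\cdot)$ is the law of $\{X^{x}_t : x\in\gamma\}$, where the $X^x$ are independent copies started at $x$. For a probability measure $\mu$ on $\Theta$ let $P^{\mathbf X}_{\mu,t}=\int_\Theta \mathbf P_t(\gamma,\cdot)\,\mu(d\gamma)$ be the one-dimensional distribution at time $t$ of the process started from $\mu$. Suppose that $\mu$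 is a probability measure on $\Theta$ that has a first correlation function $\rho_\mu$ and a second correlation function $k_\mu^{(2)}$ (locally integrable densities of the first and second factorial moment measures), and that the second Ursell function $u^{(2)}_\mu(x,y)=k^{(2)}_\mu(x,y)-\rho_\mu(x)\rho_\mu(y)$ satisfies $$\sup_{x\in\mathbb R^d}\int_{\mathbb R^d}\bigl|u^{(2)}_\mu(x,y)\bigr|\,dy<\infty .$$ Suppose further that the Fourier transform of $\rho_\mu$, in the sense of tempered distributions, is a signed (complex-valued, possibly infinite but tempered) measure. Then $\rho_\mu$ has an arithmetic mean, that is, the limit $$\mathrm{mean}(\rho_\mu)=\lim_{R\to\infty}\frac1{\mathrm{vol}(B(R))}\int_{B(R)}\rho_\mu(x)\,dx$$ exists, and $P^{\mathbf X}_{\mu,t}$ converges weakly, as $t\to\infty$, to the Poisson measure $\pi_{\mathrm{mean}(\rho_\mu)}$ with constant intensity $\mathrm{mean}(\rho_\mu)$, i.e. the probability measure on $\Gamma$ with $\int e^{\langle\varphi,\gamma\rangle}\,\pi_{\mathrm{mean}(\rho_\mu)}(d\gamma)=\exp\bigl(\mathrm{mean}(\rho_\mu)\int(e^{\varphi(x)}-1)\,dx\bigr)$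 for all $\varphi\in C_c^\infty(\mathbb R^d)$. -/

import Mathlib

open MeasureTheory ProbabilityTheory Filter Topology
open scoped NNReal ENNReal ContDiff SchwartzMap FourierTransform CompactlySupported

noncomputable section

namespace FreeKawasaki

/-- The Euclidean space `ℝ^d`. -/
abbrev Space (d : ℕ) : Type := EuclideanSpace ℝ (Fin d)

/-! ### Configuration space -/

/-- Locally finite subsets of `ℝ^d`; this is the configuration space `Γ`. -/
@[ext]
structure Configuration (d : ℕ) where
  carrier : Set (Space d)
  finite_inter : ∀ K : Set (Space d), IsCompact K → (carrier ∩ K).Finite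

namespace Configuration

variable {d : ℕ}

/-- The empty configuration. -/
def empty (d : ℕ) : Configuration d := ⟨∅, fun _ _ => by simp⟩

/-- The pairing `⟨f, γ⟩ = ∑_{x ∈ γ} f x`. It is a finite sum when `f` has compact support. -/
def pairing (f : Space d → ℝ) (γ : Configuration d) : ℝ := ∑' x : γ.carrier, f x

/-- The vague topology: the coarsest topology that makes `γ ↦ ⟨f, γ⟩` continuous for all continuous
compactly supported `f`. -/
instance : TopologicalSpace (Configuration d) :=
  TopologicalSpace.induced (fun (γ : Configuration d) (f : C_c(Space d, ℝ)) => pairing f γ)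
    inferInstance

instance : MeasurableSpace (Configuration d) := borel _

instance : BorelSpace (Configuration d) := ⟨rfl⟩

open scoped Classical in
/-- The configuration `{y i : i}` of a family of points, provided that no two points coincide and
that the family has no accumulation point (each compact set contains `y i` for only finitely many
`i`). Other families are sent to the empty configuration. -/
def ofFamily {ι : Type*} (y : ι → Space d) : Configuration d :=
  if h : Function.Injective y ∧ ∀ K : Set (Space d), IsCompact K → {i | y i ∈ K}.Finite then
    ⟨Set.range y, fun K hK => ((h.2 K hK).image y).subset (by
      rintro _ ⟨⟨i, rfl⟩, hi⟩
      exact ⟨i, hi, rfl⟩)⟩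
  else empty d

end Configuration

/-- The set `Θ` of configurations `γ` for which there is an `m ∈ ℕ` with
`|γ ∩ B(n)| ≤ m vol(B(n))` for all integers `n ≥ 1`, where `B(n)` is the closed ball of radius `n`
around the origin. -/
def Theta (d : ℕ) : Set (Configuration d) :=
  {γ | ∃ m : ℕ, ∀ n : ℕ, 1 ≤ n →
    ((γ.carrier ∩ Metric.closedBall 0 n).ncard : ℝ) ≤
      m * volume.real (Metric.closedBall (0 : Space d) n)}

/-! ### The one-particle jump process -/

/-- A jump rate: a non-negative measurable function `a`, not almost everywhere zero, with
`a y ≤ C / (1 + |y|)^α` for some `α > 2d` and `C > 0`. -/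
structure IsJumpRate {d : ℕ} (a : Space d → ℝ) : Prop where
  measurable : Measurable a
  nonneg : ∀ y, 0 ≤ a y
  bound : ∃ α C : ℝ, 2 * (d : ℝ) < α ∧ 0 < C ∧ ∀ y, a y ≤ C / (1 + ‖y‖) ^ α
  integral_pos : 0 < ∫ y, a y

/-- One step of the embedded Markov chain: the law with density `y ↦ a (x - y) / ∫ a`. -/
def stepLaw {d : ℕ} (a : Space d → ℝ) (x : Space d) : Measure (Space d) :=
  volume.withDensity fun y => ENNReal.ofReal (a (x - y) / ∫ w, a w)

/-- The law of the embedded Markov chain after `n` steps, started in `x`. -/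
def chainLaw {d : ℕ} (a : Space d → ℝ) : ℕ → Space d → Measure (Space d)
  | 0, x => Measure.dirac x
  | n + 1, x => (chainLaw a n x).bind (stepLaw a)

/-- The law at time `t` of the one-particle jump process `X_t = Y_{Z_t}` started in `x`, where `Y`
is the embedded Markov chain and `Z` is an independent Poisson process of rate `∫ a`
(so that `Z_t` is Poisson distributed with parameter `t ∫ a`). -/
def jumpLaw {d : ℕ} (a : Space d → ℝ) (t : ℝ≥0) (x : Space d) : Measure (Space d) :=
  (poissonMeasure (t * (∫ y, a y).toNNReal)).bind fun n => chainLaw a n x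

/-! ### The free Kawasaki process -/

/-- The transition probability `𝐏_t(γ, ·)` of the free Kawasaki process: the law of the
configuration `{X_t^x : x ∈ γ}`, where the `X^x`, `x ∈ γ`, are independent one-particle jump
processes and `X^x` starts in `x`. -/
def transitionLaw {d : ℕ} (a : Space d → ℝ) (t : ℝ≥0) (γ : Configuration d) :
    Measure (Configuration d) :=
  (Measure.infinitePi fun x : γ.carrier => jumpLaw a t x).map Configuration.ofFamily

/-- The one-dimensional distribution at time `t` of the free Kawasaki process with initial
distribution `μ`, that is `∫ 𝐏_t(γ, ·) μ(dγ)`. -/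
def oneDimLaw {d : ℕ} (a : Space d → ℝ) (μ : Measure (Configuration d)) (t : ℝ≥0) :
    Measure (Configuration d) :=
  μ.bind (transitionLaw a t)

/-! ### Poisson measures -/

/-- `π` is the Poisson measure on `Γ` with intensity `z`: the probability measure with Laplace
transform `∫ e^{⟨φ, γ⟩} π(dγ) = exp (∫ (e^{φ x} - 1) z x dx)` for all `φ ∈ C_c^∞(ℝ^d)`. -/
def IsPoisson {d : ℕ} (z : Space d → ℝ) (π : ProbabilityMeasure (Configuration d)) : Prop :=
  ∀ φ : Space d → ℝ, ContDiff ℝ ∞ φ → HasCompactSupport φ →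
    ∫⁻ γ, ENNReal.ofReal (Real.exp (γ.pairing φ)) ∂(π : Measure (Configuration d)) =
      ENNReal.ofReal (Real.exp (∫ x, (Real.exp (φ x) - 1) * z x))

/-! ### Correlation functions -/

/-- `ρ` is the first correlation function of `μ`. -/
structure IsFirstCorrelation {d : ℕ} (μ : Measure (Configuration d)) (ρ : Space d → ℝ≥0) :
    Prop where
  measurable : Measurable ρ
  locallyIntegrable : LocallyIntegrable (fun x => (ρ x : ℝ))
  lintegral_sum : ∀ G : Space d → ℝ≥0∞, Measurable G →
    ∫⁻ γ, ∑' x : γ.carrier, G x ∂μ = ∫⁻ x, G x * ρ x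

/-- `k` is the second correlation function of `μ`, as a function of two points. The sum runs over
ordered pairs of distinct points of `γ`. -/
structure IsSecondCorrelation {d : ℕ} (μ : Measure (Configuration d))
    (k : Space d × Space d → ℝ≥0) : Prop where
  measurable : Measurable k
  locallyIntegrable : LocallyIntegrable (fun p => (k p : ℝ))
  lintegral_sum : ∀ G : Space d × Space d → ℝ≥0∞, Measurable G →
    ∫⁻ γ, ∑' p : {p : γ.carrier × γ.carrier // p.1 ≠ p.2}, G (p.1.1, p.1.2) ∂μ =
      ∫⁻ p, G p * k p

/-- The second Ursell function `u(x, y) = k(x, y) - ρ(x) ρ(y)`. -/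
def ursell {d : ℕ} (ρ : Space d → ℝ≥0) (k : Space d × Space d → ℝ≥0) (x y : Space d) : ℝ :=
  k (x, y) - ρ x * ρ y

/-! ### Fourier transform and arithmetic mean -/

/-- The Fourier transform of `z`, in the sense of tempered distributions, is a (complex-valued)
signed measure. The measure is written in polar form as `h σ` with `σ` its total variation and
`|h| = 1`; it may be infinite, as long as it is a tempered distribution. Finite signed and complex
measures are included. The normalisation of the Fourier transform is irrelevant here. -/
def FourierIsSignedMeasure {d : ℕ} (z : Space d → ℝ) : Prop :=
  (∀ φ : 𝓢(Space d, ℂ), Integrable fun x => (z x : ℂ) * φ x) ∧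
  ∃ (σ : Measure (Space d)) (h : Space d → ℂ),
    σ.HasTemperateGrowth ∧ Measurable h ∧ (∀ ξ, ‖h ξ‖ = 1) ∧
    ∀ φ : 𝓢(Space d, ℂ), ∫ x, (z x : ℂ) * 𝓕 φ x = ∫ ξ, φ ξ * h ξ ∂σ

/-- `z` has arithmetic mean `m`. -/
def HasArithmeticMean {d : ℕ} (z : Space d → ℝ) (m : ℝ) : Prop :=
  LocallyIntegrable z ∧
  Tendsto (fun R : ℝ => (volume.real (Metric.closedBall (0 : Space d) R))⁻¹ *
    ∫ x in Metric.closedBall (0 : Space d) R, z x) atTop (𝓝 m)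

end FreeKawasaki

end

noncomputable section

namespace FreeKawasaki

namespace Configuration

variable {d : ℕ}

/-! ### Sums over configurations -/

/-! Let `ν_t` be the law of one particle's displacement by time `t`. A single jump has a density, so
its characteristic function has real part below one away from the origin, and hence that of `ν_t`
tends to zero at every `ξ ≠ 0` (`tendsto_charFun_jumpLaw`). The large-time behaviour comes from two
consequences for a function `g` smeared by `ν_t` (`average`).

First, the integral of `ρ` against the smeared `g` equals, on the Fourier side, an integral against
the spectral measure of `ρ` in which the characteristic function of `ν_t` is a multiplier. By
dominated convergence only the atom at the origin survives, and the limit is `m ∫ g` with `m =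
atomAtZero σ h` (`tendsto_lintegral_average_mul`). Spatial dilation in place of smearing isolates
the same atom, so `m` is also the arithmetic mean (`hasArithmeticMean`). Second, the smeared `g`
tends to zero uniformly, because Lebesgue measure has no atom at the origin
(`exists_average_bound`).

The integrable Ursell function bounds the variance of the sum of the smeared `g` over a
configuration by the supremum of the smeared `g` times a bounded factor (`lintegral_tsum_sq_le`).
This gives a law of large numbers: the sum converges to `m ∫ g` in `L¹(μ)`
(`tendsto_lintegral_linStat_sub`).

Given the initial configuration, independence makes the characteristic functional at `f` a product
of factors `1 + w_x`, where `w_x` is the mean of `e^{if} - 1` for the particle started at `x`. The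
`w_x` are uniformly small, so the product is close to `exp (∑ w_x)`
(`enorm_integral_transitionLaw_sub_le`), and the law of large numbers sends the exponent to `m ∫
(e^{if} - 1)`, the Poisson value (`tendsto_integral_oneDimLaw`). Since countably many linear
statistics induce the vague topology, this implies weak convergence
(`tendsto_of_tendsto_charFunctional`).

Two foundations are needed as well: the Poisson measure is built by hand, and the transition law
must be a measurable kernel. The latter holds on configurations with finite expected particle
numbers in balls, because void events generate the Borel sets (`eq_generateFrom_voidEvent`) and
their probabilities are explicit products. -/

theorem countable_carrier (γ : Configuration d) : γ.carrier.Countable := by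
  have h : γ.carrier = ⋃ n : ℕ, γ.carrier ∩ Metric.closedBall 0 n := by
    ext x
    simp only [Set.mem_iUnion, Set.mem_inter_iff, exists_and_left, iff_self_and]
    intro _
    obtain ⟨n, hn⟩ := exists_nat_ge ‖x‖
    exact ⟨n, by simpa using hn⟩
  rw [h]
  exact Set.countable_iUnion fun n =>
    (γ.finite_inter _ (isCompact_closedBall _ _)).countable

instance (γ : Configuration d) : Countable γ.carrier := γ.countable_carrier.to_subtype

theorem finite_support {E : Type*} [Zero E] (γ : Configuration d) {f : Space d → E}
    (hf : HasCompactSupport f) : (Function.support fun x : γ.carrier => f x).Finite := by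
  have := γ.finite_inter _ hf
  refine Set.Finite.of_finite_image (f := ((↑) : γ.carrier → Space d)) (this.subset ?_)
    Subtype.val_injective.injOn
  rintro _ ⟨x, hx, rfl⟩
  exact ⟨x.2, subset_tsupport _ hx⟩

theorem summable_pairing {E : Type*} [AddCommMonoid E] [TopologicalSpace E]
    (γ : Configuration d) {f : Space d → E}
    (hf : HasCompactSupport f) : Summable fun x : γ.carrier => f x :=
  summable_of_hasFiniteSupport (γ.finite_support hf)

theorem continuous_pairing (f : C_c(Space d, ℝ)) :
    Continuous (fun γ : Configuration d => pairing f γ) :=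
  (continuous_apply f).comp (continuous_induced_dom
    (f := fun (γ : Configuration d) (f : C_c(Space d, ℝ)) => pairing f γ))

/-- The counting measure `∑_{x ∈ γ} δ_x` of a configuration. -/
def toMeasure (γ : Configuration d) : Measure (Space d) :=
  Measure.sum fun x : γ.carrier => Measure.dirac (x : Space d)

theorem lintegral_toMeasure (γ : Configuration d) {G : Space d → ℝ≥0∞} (hG : Measurable G) :
    ∫⁻ x, G x ∂γ.toMeasure = ∑' x : γ.carrier, G x := by
  rw [toMeasure, lintegral_sum_measure]
  exact tsum_congr fun x => lintegral_dirac' _ hG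

theorem toMeasure_apply (γ : Configuration d) {B : Set (Space d)} (hB : MeasurableSet B) :
    γ.toMeasure B = ∑' x : γ.carrier, B.indicator 1 (x : Space d) := by
  rw [← lintegral_indicator_one hB, lintegral_toMeasure _ (measurable_one.indicator hB)]

theorem toMeasure_eq_encard (γ : Configuration d) {B : Set (Space d)} (hB : MeasurableSet B) :
    γ.toMeasure B = (γ.carrier ∩ B).encard := by
  rw [toMeasure_apply γ hB]
  have h2 : (∑' x : γ.carrier, B.indicator (1 : Space d → ℝ≥0∞) (x : Space d)) =
      ∑' x : Space d, (γ.carrier ∩ B).indicator 1 x := by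
    rw [tsum_subtype γ.carrier (B.indicator (1 : Space d → ℝ≥0∞))]
    congr 1 with x
    rw [Set.indicator_indicator]
  rw [h2, ← tsum_subtype, ← ENNReal.tsum_set_one]
  rfl

theorem toMeasure_eq_zero_iff (γ : Configuration d) {B : Set (Space d)} (hB : MeasurableSet B) :
    γ.toMeasure B = 0 ↔ Disjoint γ.carrier B := by
  rw [toMeasure_eq_encard γ hB, Set.disjoint_iff_inter_eq_empty]
  simp

theorem toMeasure_lt_top (γ : Configuration d) {K : Set (Space d)} (hK : IsCompact K) :
    γ.toMeasure K < ⊤ := by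
  rw [toMeasure_eq_encard γ hK.measurableSet]
  have := (γ.finite_inter K hK).encard_lt_top
  simpa using this

theorem ofReal_pairing (γ : Configuration d) {f : Space d → ℝ} (hf : HasCompactSupport f)
    (h0 : ∀ x, 0 ≤ f x) :
    ENNReal.ofReal (pairing f γ) = ∑' x : γ.carrier, ENNReal.ofReal (f x) :=
  ENNReal.ofReal_tsum_of_nonneg (fun x => h0 x) (γ.summable_pairing hf)

theorem pairing_nonneg (γ : Configuration d) {f : Space d → ℝ} (h0 : ∀ x, 0 ≤ f x) :
    0 ≤ pairing f γ := tsum_nonneg fun x => h0 x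

theorem pairing_sub (γ : Configuration d) {f g : Space d → ℝ} (hf : HasCompactSupport f)
    (hg : HasCompactSupport g) :
    pairing (fun x => f x - g x) γ = pairing f γ - pairing g γ :=
  (γ.summable_pairing hf).tsum_sub (γ.summable_pairing hg)

/-- Reduces measurability of the pairing to that of `toMeasure`. This works for any σ-algebra on
configurations, in particular for the one generated by void events. -/
theorem pairing_eq_sub_toReal (γ : Configuration d) {f : Space d → ℝ} (hm : Measurable f)
    (hf : HasCompactSupport f) :
    pairing f γ = (∫⁻ x, ENNReal.ofReal (f x) ∂γ.toMeasure).toReal -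
      (∫⁻ x, ENNReal.ofReal (-f x) ∂γ.toMeasure).toReal := by
  have hp : HasCompactSupport fun x => max (f x) 0 := hf.comp_left (g := fun y => max y 0) (by simp)
  have hn : HasCompactSupport fun x => max (-f x) 0 :=
    hf.comp_left (g := fun y => max (-y) 0) (by simp)
  have e1 := γ.ofReal_pairing hp (fun x => le_max_right _ _)
  have e2 := γ.ofReal_pairing hn (fun x => le_max_right _ _)
  have hmax : ∀ y : ℝ, ENNReal.ofReal (max y 0) = ENNReal.ofReal y := by
    intro y; rcases le_total y 0 with h | h <;> simp [h]
  simp only [hmax] at e1 e2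
  rw [lintegral_toMeasure _ (by fun_prop), lintegral_toMeasure _ (by fun_prop), ← e1, ← e2,
    ENNReal.toReal_ofReal (pairing_nonneg _ fun x => le_max_right _ _),
    ENNReal.toReal_ofReal (pairing_nonneg _ fun x => le_max_right _ _),
    ← pairing_sub _ hp hn]
  congr 1 with x
  rcases le_total (f x) 0 with h | h <;> simp [h]

/-! ### A countable family of test functions generates the vague topology -/

/-- A continuous bump function equal to `1` on the ball of radius `n`. -/
def ballBump (d : ℕ) (n : ℕ) : ContDiffBump (0 : Space d) :=
  ⟨n + 1, n + 2, by positivity, by linarith⟩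

theorem ballBump_eq_one {n : ℕ} {x : Space d} (hx : ‖x‖ ≤ n + 1) : ballBump d n x = 1 :=
  (ballBump d n).one_of_mem_closedBall (by simpa [ballBump] using hx)

/-- `ballBump` as a compactly supported continuous function. -/
def ballBumpCc (d : ℕ) (n : ℕ) : C_c(Space d, ℝ) :=
  ⟨⟨ballBump d n, (ballBump d n).continuous⟩, (ballBump d n).hasCompactSupport⟩

theorem exists_nat_tsupport_subset {E : Type*} [Zero E] {f : Space d → E}
    (hf : HasCompactSupport f) :
    ∃ n : ℕ, tsupport f ⊆ Metric.closedBall 0 n := by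
  obtain ⟨r, hr⟩ := hf.isCompact.isBounded.subset_closedBall 0
  obtain ⟨n, hn⟩ := exists_nat_ge r
  exact ⟨n, hr.trans (Metric.closedBall_subset_closedBall hn)⟩

/-- Functions supported in a fixed ball form a separable space. Bounding the error by a bump
function that itself lies in `D` lets the error in the pairing be controlled by a member of the
family. -/
theorem exists_countable_dense_Cc (d : ℕ) : ∃ D : Set C_c(Space d, ℝ), D.Countable ∧
    (∀ n, ballBumpCc d n ∈ D) ∧
    ∀ f : C_c(Space d, ℝ), ∃ n : ℕ, ∀ ε > 0, ∃ g ∈ D, ∀ x, |f x - g x| ≤ ε * ballBump d n x := by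
  let S : ℕ → Set C(Space d, ℝ) := fun n => {f | ∀ x ∉ Metric.closedBall (0 : Space d) n, f x = 0}
  have hS : ∀ n, ∃ s : Set (S n), s.Countable ∧ Dense s := fun n =>
    TopologicalSpace.exists_countable_dense (S n)
  choose s hsc hsd using hS
  have hcs : ∀ n (f : S n), HasCompactSupport (f : C(Space d, ℝ)) := fun n f =>
    HasCompactSupport.intro (isCompact_closedBall 0 (n : ℝ)) fun x hx => f.2 x hx
  let ι : ∀ n, S n → C_c(Space d, ℝ) := fun n f => ⟨f.1, hcs n f⟩
  refine ⟨(⋃ n, ι n '' s n) ∪ Set.range (ballBumpCc d),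
    (Set.countable_iUnion fun n => (hsc n).image _).union (Set.countable_range _),
    fun n => Or.inr ⟨n, rfl⟩, fun f => ?_⟩
  obtain ⟨n, hn⟩ := exists_nat_tsupport_subset f.hasCompactSupport
  have hf0 : ∀ x ∉ Metric.closedBall (0 : Space d) n, f x = 0 := fun x hx =>
    image_eq_zero_of_notMem_tsupport fun h => hx (hn h)
  refine ⟨n, fun ε hε => ?_⟩
  let F : S n := ⟨f.toContinuousMap, hf0⟩
  let K : Set (Space d) := Metric.closedBall 0 n
  have : CompactSpace K := isCompact_iff_compactSpace.mp (isCompact_closedBall _ _)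
  -- Density refers to the compact-open topology; restriction to the compact ball makes it a uniform
  -- estimate there, and outside the ball both functions vanish.
  have hopen : IsOpen {g : S n | dist (F.1.restrict K) (g.1.restrict K) < ε} :=
    isOpen_lt (continuous_const.dist ((ContinuousMap.continuous_restrict K).comp
      continuous_subtype_val)) continuous_const
  obtain ⟨g, hgs, hg⟩ := (hsd n).exists_mem_open hopen ⟨F, by simpa using hε⟩
  refine ⟨ι n g, Or.inl (Set.mem_iUnion.mpr ⟨n, g, hgs, rfl⟩), fun x => ?_⟩
  by_cases hx : x ∈ K
  · have h1 := (ContinuousMap.dist_lt_iff hε).mp hg ⟨x, hx⟩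
    rw [ballBump_eq_one (by have : ‖x‖ ≤ n := by simpa [K] using hx
                            linarith), mul_one]
    exact h1.le
  · have h1 : f x = 0 := hf0 x hx
    have h2 : ι n g x = 0 := g.2 x hx
    rw [h1, h2, sub_zero, abs_zero]
    exact mul_nonneg hε.le (ballBump d n).nonneg

theorem abs_pairing_sub_le (γ : Configuration d) {f g h : Space d → ℝ} (hf : HasCompactSupport f)
    (hg : HasCompactSupport g) (hh : HasCompactSupport h) {ε : ℝ}
    (hle : ∀ x, |f x - g x| ≤ ε * h x) :
    |pairing f γ - pairing g γ| ≤ ε * pairing h γ := by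
  rw [← pairing_sub γ hf hg, pairing, pairing, ← tsum_mul_left]
  have hs : Summable fun x : γ.carrier => ε * h x := (γ.summable_pairing hh).mul_left ε
  exact tsum_of_norm_bounded (f := fun x : γ.carrier => f x - g x) hs.hasSum fun x => hle x

/-- In the topology induced by `D`, each pairing is a locally uniform limit of pairings with members
of `D`, because the pairing with a bump function is locally bounded. Hence it is continuous and no
finer topology is needed. -/
theorem exists_countable_induced (d : ℕ) : ∃ D : Set C_c(Space d, ℝ), D.Countable ∧
    IsInducing (fun (γ : Configuration d) (f : D) => pairing f.1 γ) := by
  obtain ⟨D, hD, hb, happ⟩ := exists_countable_dense_Cc d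
  refine ⟨D, hD, ⟨le_antisymm ?_ ?_⟩⟩
  · exact continuous_iff_le_induced.mp (continuous_pi fun f => continuous_pairing f.1)
  · let τ : TopologicalSpace (Configuration d) := TopologicalSpace.induced
      (fun (γ : Configuration d) (f : D) => pairing f.1 γ) inferInstance
    have hc : ∀ f : D, Continuous fun γ : Configuration d => pairing f.1 γ := fun f =>
      (continuous_apply f).comp (continuous_induced_dom
        (f := fun (γ : Configuration d) (f : D) => pairing f.1 γ))
    refine continuous_iff_le_induced.mp (continuous_pi fun f => ?_)
    obtain ⟨n, hn⟩ := happ f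
    refine continuous_of_locally_uniform_approx_of_continuousAt fun γ₀ u hu => ?_
    obtain ⟨ε, hε, hεu⟩ := Metric.mem_uniformity_dist.mp hu
    -- The added one makes `M` positive and makes the set where the bump statistic is below `M` a
    -- neighbourhood of `γ₀`.
    set M : ℝ := pairing (ballBumpCc d n) γ₀ + 1 with hM
    have hMpos : 0 < M := by
      have : 0 ≤ pairing (ballBumpCc d n) γ₀ :=
        pairing_nonneg _ fun x => (ballBump d n).nonneg
      linarith
    obtain ⟨g, hgD, hg⟩ := hn (ε / (2 * M)) (by positivity)
    refine ⟨{γ | pairing (ballBumpCc d n) γ < M},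
      (isOpen_lt (hc ⟨_, hb n⟩) continuous_const).mem_nhds (by simp [hM]),
      fun γ => pairing g γ, (hc ⟨g, hgD⟩).continuousAt, fun γ hγ => hεu ?_⟩
    have h1 := abs_pairing_sub_le γ f.hasCompactSupport g.hasCompactSupport
      (ballBumpCc d n).hasCompactSupport hg
    have hγ' : pairing (ballBumpCc d n) γ < M := hγ
    rw [Real.dist_eq]
    calc |pairing f γ - pairing g γ| ≤ ε / (2 * M) * pairing (ballBumpCc d n) γ := h1
      _ ≤ ε / (2 * M) * M := by gcongr
      _ = ε / 2 := by field_simp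
      _ < ε := by linarith

/-- For countable `D` the Borel and product σ-algebras of `D → ℝ` agree, so measurability can be
tested coordinate by coordinate. -/
theorem measurable_of_pairing {Ω : Type*} [MeasurableSpace Ω] {F : Ω → Configuration d}
    (h : ∀ f : C_c(Space d, ℝ), Measurable fun w => pairing f (F w)) : Measurable F := by
  obtain ⟨D, hD, hi⟩ := exists_countable_induced d
  have := hD.to_subtype
  have e : (inferInstance : MeasurableSpace (Configuration d)) =
      MeasurableSpace.comap (fun (γ : Configuration d) (f : D) => pairing f.1 γ)
        MeasurableSpace.pi := by
    change borel _ = _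
    rw [hi.eq_induced, borel_comap, BorelSpace.measurable_eq (α := D → ℝ)]
  have : @Measurable _ _ _ (inferInstance : MeasurableSpace (Configuration d)) F := by
    rw [e, measurable_comap_iff]
    exact measurable_pi_iff.mpr fun f => h f.1
  exact this

/-- Suited to maps such as `ofFamily`, which are understood only almost surely: on the exceptional
set the value is replaced by the empty configuration. -/
theorem aemeasurable_of_pairing {Ω : Type*} [MeasurableSpace Ω] {P : Measure Ω}
    {F : Ω → Configuration d} (p : C_c(Space d, ℝ) → Ω → ℝ) (hp : ∀ f, Measurable (p f))
    (h : ∀ᵐ w ∂P, ∀ f : C_c(Space d, ℝ), pairing f (F w) = p f w) : AEMeasurable F P := by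
  classical
  obtain ⟨E, hE, hEm, hEp⟩ := h.exists_measurable_mem
  refine ⟨fun w => if w ∈ E then F w else empty d, measurable_of_pairing fun f => ?_, ?_⟩
  · have : (fun w => pairing f (if w ∈ E then F w else empty d)) =
        fun w => if w ∈ E then p f w else pairing f (empty d) := by
      ext w
      split_ifs with hw
      · exact hEp w hw f
      · rfl
    rw [this]
    exact Measurable.ite hEm (hp f) measurable_const
  · filter_upwards [hE] with w hw
    simp [hw]

/-! ### Measurability of counting functionals -/

/-- The count in `K` is a limit of continuous linear statistics of thickened indicators. The compact
1-thickening of `K` has finite count and dominates them all. -/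
theorem measurable_toMeasure_compact {K : Set (Space d)} (hK : IsCompact K) :
    Measurable fun γ : Configuration d => γ.toMeasure K := by
  have hδ : ∀ n : ℕ, (0 : ℝ) < 1 / ((n : ℝ) + 1) := fun n => by positivity
  have hsub : ∀ n : ℕ, Function.support (thickenedIndicator (hδ n) K) ⊆ Metric.cthickening 1 K := by
    intro n x hx
    by_contra hcon
    refine hx (thickenedIndicator_zero (hδ n) K fun h => hcon ?_)
    refine Metric.thickening_subset_cthickening_of_le ?_ K h
    rw [div_le_one (by positivity)]
    have : (0 : ℝ) ≤ n := by positivity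
    linarith
  have hcomp : IsCompact (Metric.cthickening 1 K) := hK.cthickening
  let g : ℕ → C_c(Space d, ℝ) := fun n =>
    ⟨⟨fun x => thickenedIndicator (hδ n) K x, by fun_prop⟩,
      HasCompactSupport.intro hcomp fun x hx => by
        by_contra hcon
        exact hx (hsub n fun h => hcon (congrArg NNReal.toReal h))⟩
  have hg : ∀ n x, g n x = thickenedIndicator (hδ n) K x := fun n x => rfl
  refine measurable_of_tendsto_metrizable
    (f := fun n γ => ENNReal.ofReal (pairing (g n) γ))
    (fun n => (continuous_pairing (g n)).measurable.ennreal_ofReal) ?_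
  rw [tendsto_pi_nhds]
  intro γ
  have h1 : ∀ n, ENNReal.ofReal (pairing (g n) γ) =
      ∫⁻ x, (thickenedIndicator (hδ n) K x : ℝ≥0∞) ∂γ.toMeasure := by
    intro n
    rw [ofReal_pairing γ (g n).hasCompactSupport (fun x => by simp [hg]),
      lintegral_toMeasure _ (by fun_prop)]
    simp [hg]
  simp_rw [h1]
  have h2 : γ.toMeasure K = ∫⁻ x, K.indicator 1 x ∂γ.toMeasure :=
    (lintegral_indicator_one hK.measurableSet).symm
  rw [h2]
  refine tendsto_lintegral_filter_of_dominated_convergence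
    ((Metric.cthickening 1 K).indicator 1) (.of_forall fun n => by fun_prop)
    (.of_forall fun n => .of_forall fun x => ?_) ?_ (.of_forall fun x => ?_)
  · by_cases hx : x ∈ Metric.cthickening 1 K
    · simpa [hx] using thickenedIndicator_le_one (hδ n) K x
    · have : thickenedIndicator (hδ n) K x = 0 := by
        by_contra hcon
        exact hx (hsub n hcon)
      rw [this]
      simp
  · rw [lintegral_indicator_one hcomp.measurableSet]
    exact (γ.toMeasure_lt_top hcomp).ne
  · have := tendsto_pi_nhds.mp (thickenedIndicator_tendsto_indicator_closure hδ
      tendsto_one_div_add_atTop_nhds_zero_nat K) x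
    rw [hK.isClosed.closure_eq] at this
    have h3 := (ENNReal.tendsto_coe.mpr this)
    convert h3 using 2
    by_cases hx : x ∈ K <;> simp [hx]

instance (γ : Configuration d) (n : ℕ) :
    IsFiniteMeasure (γ.toMeasure.restrict (Metric.closedBall 0 n)) :=
  ⟨by simpa using γ.toMeasure_lt_top (isCompact_closedBall _ _)⟩

theorem measure_eq_iSup_closedBall (ν : Measure (Space d)) (s : Set (Space d)) :
    ν s = ⨆ n : ℕ, ν (s ∩ Metric.closedBall 0 n) := by
  have hm : Monotone fun n : ℕ => s ∩ Metric.closedBall (0 : Space d) n := fun a b hab =>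
    Set.inter_subset_inter_right _ (Metric.closedBall_subset_closedBall (by exact_mod_cast hab))
  rw [← hm.measure_iUnion, ← Set.inter_iUnion, Metric.iUnion_closedBall_nat, Set.inter_univ]

@[fun_prop]
theorem measurable_toMeasure : Measurable (toMeasure : Configuration d → Measure (Space d)) := by
  refine Measure.measurable_of_measurable_coe _ fun s hs => ?_
  simp_rw [fun γ : Configuration d => measure_eq_iSup_closedBall γ.toMeasure s]
  refine Measurable.iSup fun n => ?_
  -- The π-λ argument from closed sets to Borel sets needs finite measures, hence the restriction to
  -- balls.
  have : Measurable fun γ : Configuration d => γ.toMeasure.restrict (Metric.closedBall 0 n) := by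
    refine Measurable.measure_of_isPiSystem (S := {s | IsClosed s})
      ((BorelSpace.measurable_eq).trans borel_eq_generateFrom_isClosed) isPiSystem_isClosed
      (fun s hs => ?_) ?_
    · simp_rw [Measure.restrict_apply (IsClosed.measurableSet hs)]
      exact measurable_toMeasure_compact ((isCompact_closedBall _ _).inter_left hs)
    · simp_rw [Measure.restrict_apply MeasurableSet.univ, Set.univ_inter]
      exact measurable_toMeasure_compact (isCompact_closedBall _ _)
  simp_rw [← Measure.restrict_apply hs]
  exact Measure.measurable_measure.mp this s hs

theorem measurable_tsum {G : Space d → ℝ≥0∞} (hG : Measurable G) :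
    Measurable fun γ : Configuration d => ∑' x : γ.carrier, G x := by
  simp_rw [← fun γ : Configuration d => lintegral_toMeasure γ hG]
  exact (Measure.measurable_lintegral hG).comp measurable_toMeasure

/-! ### Void events generate the Borel σ-algebra -/

/-- The event that a configuration has no point in `B`. -/
def voidEvent (B : Set (Space d)) : Set (Configuration d) := {γ | Disjoint γ.carrier B}

theorem measurableSet_voidEvent {B : Set (Space d)} (hB : MeasurableSet B) :
    MeasurableSet (voidEvent B) := by
  have : voidEvent B = {γ | γ.toMeasure B = 0} := by
    ext γ
    exact (toMeasure_eq_zero_iff γ hB).symm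
  rw [this]
  exact (Measure.measurable_measure.mp measurable_toMeasure B hB) (measurableSet_singleton 0)

theorem isPiSystem_voidEvent :
    IsPiSystem {S : Set (Configuration d) | ∃ B, MeasurableSet B ∧ S = voidEvent B} := by
  rintro _ ⟨B, hB, rfl⟩ _ ⟨B', hB', rfl⟩ _
  refine ⟨B ∪ B', hB.union hB', ?_⟩
  ext γ
  simp [voidEvent, Set.disjoint_union_right]

/-- The first `n` digits of an injective measurable coding of `ℝ^d` by binary sequences. -/
def binaryDigits (n : ℕ) (x : Space d) : Fin n → Bool :=
  fun i => MeasurableSpace.mapNatBool (Space d) x i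

theorem measurable_binaryDigits (n : ℕ) : Measurable (binaryDigits (d := d) n) :=
  measurable_pi_iff.mpr fun i =>
    (measurable_pi_apply (i : ℕ)).comp (MeasurableSpace.measurable_mapNatBool (Space d))

theorem eventually_binaryDigits_ne {x y : Space d} (h : x ≠ y) :
    ∀ᶠ n in atTop, binaryDigits n x ≠ binaryDigits n y := by
  have := (MeasurableSpace.injective_mapNatBool (Space d)).ne h
  obtain ⟨i, hi⟩ := Function.ne_iff.mp this
  filter_upwards [eventually_gt_atTop i] with n hn heq
  exact hi (congrFun heq ⟨i, hn⟩)

/-- Sorting the points of `B` by their first `n` digits, the number of occupied cells never exceeds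
the number of points, and any finite set of points is separated for large `n`. Thus counts are
determined by void events. -/
theorem toMeasure_eq_iSup_voidEvent (γ : Configuration d) {B : Set (Space d)}
    (hB : MeasurableSet B) :
    γ.toMeasure B = ⨆ n, ∑ b : Fin n → Bool,
      (voidEvent (B ∩ binaryDigits n ⁻¹' {b}))ᶜ.indicator (1 : Configuration d → ℝ≥0∞) γ := by
  classical
  have hcell : ∀ n (b : Fin n → Bool), MeasurableSet (B ∩ binaryDigits n ⁻¹' {b}) := fun n b =>
    hB.inter (measurable_binaryDigits n (measurableSet_singleton b))
  refine le_antisymm ?_ (iSup_le fun n => ?_)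
  · rw [toMeasure_apply γ hB, ENNReal.tsum_eq_iSup_sum]
    refine iSup_le fun F => ?_
    let F' : Finset γ.carrier := F.filter fun x => (x : Space d) ∈ B
    have hev : ∀ᶠ n in atTop, ∀ x ∈ F', ∀ y ∈ F', x ≠ y →
        binaryDigits n (x : Space d) ≠ binaryDigits n (y : Space d) := by
      refine (Filter.eventually_all_finset F').mpr fun x _ =>
        (Filter.eventually_all_finset F').mpr fun y _ => ?_
      by_cases hxy : x = y
      · simp [hxy]
      · filter_upwards [eventually_binaryDigits_ne fun h => hxy (Subtype.ext h)] with n hn _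
        exact hn
    obtain ⟨n, hn⟩ := hev.exists
    refine le_iSup_of_le n ?_
    have hinj : Set.InjOn (fun x : γ.carrier => binaryDigits n (x : Space d)) F' := by
      intro x hx y hy hxy
      by_contra hne
      exact hn x hx y hy hne hxy
    calc ∑ x ∈ F, B.indicator (1 : Space d → ℝ≥0∞) (x : Space d) = ∑ x ∈ F', 1 := by
          rw [Finset.sum_filter]
          refine Finset.sum_congr rfl fun x _ => ?_
          by_cases hx : (x : Space d) ∈ B <;> simp [hx]
      _ = ∑ b ∈ F'.image (fun x : γ.carrier => binaryDigits n (x : Space d)), 1 := by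
          rw [Finset.sum_image hinj]
      _ ≤ ∑ b ∈ F'.image (fun x : γ.carrier => binaryDigits n (x : Space d)),
          (voidEvent (B ∩ binaryDigits n ⁻¹' {b}))ᶜ.indicator (1 : Configuration d → ℝ≥0∞) γ := by
          refine Finset.sum_le_sum fun b hb => ?_
          obtain ⟨x, hx, rfl⟩ := Finset.mem_image.mp hb
          rw [Set.indicator_of_mem]
          · simp
          · intro hd
            exact Set.disjoint_left.mp hd x.2 ⟨(Finset.mem_filter.mp hx).2, rfl⟩
      _ ≤ _ := Finset.sum_le_sum_of_subset (Finset.subset_univ _)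
  · have h1 : ∀ b : Fin n → Bool,
        (voidEvent (B ∩ binaryDigits n ⁻¹' {b}))ᶜ.indicator (1 : Configuration d → ℝ≥0∞) γ ≤
          γ.toMeasure (B ∩ binaryDigits n ⁻¹' {b}) := by
      intro b
      by_cases hb : γ ∈ voidEvent (B ∩ binaryDigits n ⁻¹' {b})
      · simp [hb]
      · rw [Set.indicator_of_mem (by exact hb), toMeasure_eq_encard γ (hcell n b)]
        have : (γ.carrier ∩ (B ∩ binaryDigits n ⁻¹' {b})).encard ≠ 0 := by
          rw [Set.encard_ne_zero, Set.nonempty_iff_ne_empty]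
          exact fun h => hb (Set.disjoint_iff_inter_eq_empty.mpr h)
        have h2 := Order.one_le_iff_ne_zero.mpr this
        rw [Pi.one_apply]
        exact_mod_cast h2
    refine (Finset.sum_le_sum fun b _ => h1 b).trans (le_of_eq ?_)
    have h3 := sum_measure_preimage_singleton (μ := γ.toMeasure.restrict B)
      (f := binaryDigits (d := d) n) Finset.univ
      fun b _ => measurable_binaryDigits n (measurableSet_singleton b)
    simp only [Finset.coe_univ, Set.preimage_univ, Measure.restrict_apply_univ] at h3
    rw [← h3]
    refine Finset.sum_congr rfl fun b _ => ?_
    rw [Measure.restrict_apply (measurable_binaryDigits n (measurableSet_singleton b)),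
      Set.inter_comm]

/-- Void events determine the counting measure, which determines all pairings and so the Borel sets.
They are the convenient test events for kernels, since independence turns their probabilities into
products. -/
theorem eq_generateFrom_voidEvent : (inferInstance : MeasurableSpace (Configuration d)) =
    MeasurableSpace.generateFrom {S | ∃ B, MeasurableSet B ∧ S = voidEvent B} := by
  refine le_antisymm ?_ (MeasurableSpace.generateFrom_le ?_)
  · have key : @Measurable (Configuration d) (Configuration d) (MeasurableSpace.generateFrom
        {S | ∃ B, MeasurableSet B ∧ S = voidEvent B}) _ id := by
      let m₀ : MeasurableSpace (Configuration d) := MeasurableSpace.generateFrom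
        {S | ∃ B, MeasurableSet B ∧ S = voidEvent B}
      have hM : Measurable[m₀] (toMeasure : Configuration d → Measure (Space d)) := by
        refine @Measure.measurable_of_measurable_coe _ _ _ m₀ _ fun B hB => ?_
        simp_rw [fun γ : Configuration d => toMeasure_eq_iSup_voidEvent γ hB]
        refine Measurable.iSup fun n => ?_
        refine Finset.measurable_fun_sum _ fun C _ => ?_
        refine Measurable.indicator measurable_one ?_
        refine @MeasurableSet.compl _ _ m₀ (MeasurableSpace.measurableSet_generateFrom
          ⟨_, hB.inter (measurable_binaryDigits n (measurableSet_singleton C)), rfl⟩)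
      refine @measurable_of_pairing d _ m₀ _ fun f => ?_
      have hpair : (fun γ : Configuration d => pairing f (id γ)) = fun γ : Configuration d =>
          (∫⁻ x, ENNReal.ofReal (f x) ∂γ.toMeasure).toReal -
            (∫⁻ x, ENNReal.ofReal (-f x) ∂γ.toMeasure).toReal := funext fun γ =>
        pairing_eq_sub_toReal γ f.continuous.measurable f.hasCompactSupport
      rw [hpair]
      have h1 : ∀ G : Space d → ℝ≥0∞, Measurable G →
          Measurable[m₀] fun γ : Configuration d => ∫⁻ x, G x ∂γ.toMeasure := fun G hG =>
        (Measure.measurable_lintegral hG).comp hM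
      refine Measurable.sub ?_ ?_
      · exact ENNReal.measurable_toReal.comp
          (h1 (fun x => ENNReal.ofReal (f x)) f.continuous.measurable.ennreal_ofReal)
      · exact ENNReal.measurable_toReal.comp
          (h1 (fun x => ENNReal.ofReal (-f x)) f.continuous.measurable.neg.ennreal_ofReal)
    intro s hs
    exact key hs
  · rintro _ ⟨B, hB, rfl⟩
    exact measurableSet_voidEvent hB

end Configuration

namespace Configuration

variable {d : ℕ}

/-! ### Configurations given by families of points -/

/-- A family of points without coincidences and without accumulation points. -/
def IsGoodFamily {ι : Type*} (y : ι → Space d) : Prop :=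
  Function.Injective y ∧ ∀ K : Set (Space d), IsCompact K → {i | y i ∈ K}.Finite

theorem IsGoodFamily.carrier_ofFamily {ι : Type*} {y : ι → Space d} (h : IsGoodFamily y) :
    (ofFamily y).carrier = Set.range y := by
  have h' : Function.Injective y ∧ ∀ K : Set (Space d), IsCompact K → {i | y i ∈ K}.Finite := h
  rw [ofFamily, dif_pos h']

theorem IsGoodFamily.tsum_ofFamily {ι : Type*} {y : ι → Space d} (h : IsGoodFamily y)
    {E : Type*} [AddCommMonoid E] [TopologicalSpace E] (f : Space d → E) :
    ∑' x : (ofFamily y).carrier, f x = ∑' i, f (y i) := by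
  rw [h.carrier_ofFamily]
  exact tsum_range f h.1

theorem IsGoodFamily.finite_support {ι : Type*} {y : ι → Space d} (h : IsGoodFamily y)
    {E : Type*} [Zero E] {f : Space d → E} (hf : HasCompactSupport f) :
    (Function.support fun i => f (y i)).Finite :=
  (h.2 _ hf).subset fun _ hi => subset_tsupport f hi

theorem IsGoodFamily.hasSum_pairing {ι : Type*} {y : ι → Space d} (h : IsGoodFamily y)
    {f : Space d → ℝ} (hf : HasCompactSupport f) :
    HasSum (fun i => f (y i)) (pairing f (ofFamily y)) := by
  rw [pairing, h.tsum_ofFamily]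
  exact (summable_of_hasFiniteSupport (h.finite_support hf)).hasSum

theorem hasSum_eq_sub_toReal {ι : Type*} {g : ι → ℝ} {s : ℝ} (h : HasSum g s) :
    s = (∑' i, ENNReal.ofReal (g i)).toReal - (∑' i, ENNReal.ofReal (-g i)).toReal := by
  have hs : Summable fun i => |g i| := h.summable.abs
  have hp : Summable fun i => max (g i) 0 :=
    Summable.of_nonneg_of_le (fun i => le_max_right _ _)
      (fun i => max_le (le_abs_self _) (abs_nonneg _)) hs
  have hn : Summable fun i => max (-g i) 0 :=
    Summable.of_nonneg_of_le (fun i => le_max_right _ _)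
      (fun i => max_le (neg_le_abs _) (abs_nonneg _)) hs
  have e1 := ENNReal.ofReal_tsum_of_nonneg (fun i => le_max_right (g i) 0) hp
  have e2 := ENNReal.ofReal_tsum_of_nonneg (fun i => le_max_right (-g i) 0) hn
  have hmax : ∀ y : ℝ, ENNReal.ofReal (max y 0) = ENNReal.ofReal y := by
    intro y; rcases le_total y 0 with h | h <;> simp [h]
  simp only [hmax] at e1 e2
  rw [← e1, ← e2, ENNReal.toReal_ofReal (tsum_nonneg fun i => le_max_right _ _),
    ENNReal.toReal_ofReal (tsum_nonneg fun i => le_max_right _ _), ← hp.tsum_sub hn, ← h.tsum_eq]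
  congr 1 with i
  rcases le_total (g i) 0 with h | h <;> simp [h]

/-- The events `s i` allow a random selection from a fixed countable index set, as in the Poisson
construction; for the moved particles they are the whole space. -/
theorem aemeasurable_of_hasSum_pairing {Ω ι : Type*} [MeasurableSpace Ω] [Countable ι]
    {P : Measure Ω} {F : Ω → Configuration d} {y : ι → Ω → Space d} {s : ι → Set Ω}
    (hy : ∀ i, Measurable (y i)) (hs : ∀ i, MeasurableSet (s i))
    (h : ∀ᵐ w ∂P, ∀ f : C_c(Space d, ℝ),
      HasSum (fun i => (s i).indicator (fun w => f (y i w)) w) (pairing f (F w))) :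
    AEMeasurable F P := by
  refine aemeasurable_of_pairing
    (fun f w => (∑' i, ENNReal.ofReal ((s i).indicator (fun w => f (y i w)) w)).toReal -
      (∑' i, ENNReal.ofReal (-(s i).indicator (fun w => f (y i w)) w)).toReal) (fun f => ?_) ?_
  · have hm : ∀ i, Measurable ((s i).indicator fun w => f (y i w)) := fun i =>
      (f.continuous.measurable.comp (hy i)).indicator (hs i)
    exact (Measurable.tsum fun i => (hm i).ennreal_ofReal).ennreal_toReal.sub
      (Measurable.tsum fun i => (hm i).neg.ennreal_ofReal).ennreal_toReal
  · filter_upwards [h] with w hw f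
    exact hasSum_eq_sub_toReal (hw f)

end Configuration

/-! ### Independent families of points -/

section InfinitePi

variable {ι : Type*}

theorem integral_infinitePi_prod {X : ι → Type*} [∀ i, MeasurableSpace (X i)]
    (P : ∀ i, Measure (X i)) [∀ i, IsProbabilityMeasure (P i)] (F : Finset ι)
    {f : ∀ i, X i → ℂ} (hf : ∀ i, Measurable (f i)) :
    ∫ y, ∏ i ∈ F, f i (y i) ∂Measure.infinitePi P = ∏ i ∈ F, ∫ x, f i x ∂P i := by
  have hm : Measurable fun y : ∀ i : F, X i => ∏ i : F, f i (y i) :=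
    Finset.measurable_fun_prod _ fun (i : F) _ => (hf i).comp (measurable_pi_apply i)
  have h := integral_restrict_infinitePi (μ := P) (s := F) hm.aestronglyMeasurable
  rw [integral_fintype_prod_eq_prod (fun (i : F) x => f i x)] at h
  rw [← Finset.prod_coe_sort F fun i => ∫ x, f i x ∂P i, ← h]
  congr 1 with y
  exact (Finset.prod_coe_sort F fun i => f i (y i)).symm

theorem lintegral_infinitePi_prod {X : ι → Type*} [∀ i, MeasurableSpace (X i)]
    (P : ∀ i, Measure (X i)) [∀ i, IsProbabilityMeasure (P i)] (F : Finset ι)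
    {f : ∀ i, X i → ℝ≥0∞} (hf : ∀ i, Measurable (f i)) :
    ∫⁻ y, ∏ i ∈ F, f i (y i) ∂Measure.infinitePi P = ∏ i ∈ F, ∫⁻ x, f i x ∂P i := by
  have hind : iIndepFun (fun i (y : ∀ i, X i) => f i (y i)) (Measure.infinitePi P) :=
    iIndepFun_infinitePi hf
  have h := lintegral_prod_eq_prod_lintegral_of_indepFun F _ hind fun i =>
    (hf i).comp (measurable_pi_apply i)
  rw [h]
  refine Finset.prod_congr rfl fun i _ => ?_
  rw [← Measure.infinitePi_map_eval P i, lintegral_map (hf i) (measurable_pi_apply i)]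

variable [Countable ι] {d : ℕ}

theorem ae_injective_infinitePi {X : Type*} [MeasurableSpace X] [MeasurableEq X]
    (P : ι → Measure X) [∀ i, IsProbabilityMeasure (P i)]
    (h : ∀ i j, i ≠ j → (P i).prod (P j) (Set.diagonal X) = 0) :
    ∀ᵐ y ∂Measure.infinitePi P, Function.Injective y := by
  have : ∀ i j, i ≠ j → ∀ᵐ y ∂Measure.infinitePi P, y i ≠ y j := by
    intro i j hij
    have h1 := h i j hij
    rw [← Measure.infinitePi_map_eval_prod hij, Measure.map_apply (by fun_prop)
      measurableSet_diagonal] at h1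
    rw [ae_iff]
    simpa [Set.diagonal] using h1
  have h2 : ∀ᵐ y ∂Measure.infinitePi P, ∀ i j, i ≠ j → y i ≠ y j := by
    rw [ae_all_iff]; intro i; rw [ae_all_iff]; intro j; rw [ae_all_iff]; exact this i j
  filter_upwards [h2] with y hy i j hij
  by_contra hne
  exact hy i j hne hij

/-- The first Borel–Cantelli lemma, applied to each ball of integer radius. -/
theorem ae_finite_infinitePi (P : ι → Measure (Space d)) [∀ i, IsProbabilityMeasure (P i)]
    (h : ∀ n : ℕ, ∑' i, P i (Metric.closedBall 0 n) ≠ ⊤) :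
    ∀ᵐ y ∂Measure.infinitePi P, ∀ K : Set (Space d), IsCompact K → {i | y i ∈ K}.Finite := by
  have h1 : ∀ᵐ y ∂Measure.infinitePi P, ∀ n : ℕ, {i | y i ∈ Metric.closedBall 0 (n : ℝ)}.Finite := by
    rw [ae_all_iff]
    intro n
    refine ae_finite_setOfPred_mem
      (s := fun i => {y : ι → Space d | y i ∈ Metric.closedBall 0 (n : ℝ)}) ?_
    have e : ∀ i, Measure.infinitePi P {y | y i ∈ Metric.closedBall 0 (n : ℝ)} =
        P i (Metric.closedBall 0 n) := fun i => by
      conv_rhs => rw [← Measure.infinitePi_map_eval P i]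
      rw [Measure.map_apply (by fun_prop) measurableSet_closedBall]
      rfl
    simpa only [e] using h n
  filter_upwards [h1] with y hy K hK
  obtain ⟨r, hr⟩ := hK.isBounded.subset_closedBall (0 : Space d)
  obtain ⟨n, hn⟩ := exists_nat_ge r
  refine (hy n).subset fun i hi => ?_
  exact Metric.closedBall_subset_closedBall hn (hr hi)

end InfinitePi

/-! ### Construction of the homogeneous Poisson measure -/

section Poisson

theorem integral_pow_poissonMeasure (r : ℝ≥0) (c : ℂ) :
    ∫ n, c ^ n ∂poissonMeasure r = Complex.exp (r * (c - 1)) := by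
  rw [integral_poissonMeasure]
  have h := NormedSpace.expSeries_div_hasSum_exp (𝔸 := ℂ) (r * c)
  rw [← Complex.exp_eq_exp_ℂ] at h
  have h2 := (h.mul_left (Complex.exp (-r))).tsum_eq
  rw [← Complex.exp_add] at h2
  rw [show (r : ℂ) * (c - 1) = -r + r * c by ring, ← h2]
  refine tsum_congr fun n => ?_
  rw [Complex.real_smul]
  push_cast
  ring

theorem lintegral_pow_poissonMeasure (r : ℝ≥0) {c : ℝ} (hc : 0 ≤ c) :
    ∫⁻ n, ENNReal.ofReal c ^ n ∂poissonMeasure r = ENNReal.ofReal (Real.exp (r * (c - 1))) := by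
  have h := NormedSpace.expSeries_div_hasSum_exp (𝔸 := ℝ) (r * c)
  rw [← Real.exp_eq_exp_ℝ] at h
  have h2 := h.mul_left (Real.exp (-r))
  rw [← Real.exp_add] at h2
  have e : (fun n : ℕ => Real.exp (-r) * ((r * c) ^ n / n.factorial)) =
      fun n : ℕ => (Real.exp (-r) * r ^ n / n.factorial) • c ^ n := by
    ext n
    rw [smul_eq_mul]
    ring
  rw [e] at h2
  have hi : Integrable (fun n : ℕ => c ^ n) (poissonMeasure r) := by
    rw [integrable_poissonMeasure_iff]
    refine h2.summable.congr fun n => ?_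
    rw [Real.norm_of_nonneg (by positivity), smul_eq_mul]
  simp_rw [← ENNReal.ofReal_pow hc]
  rw [← ofReal_integral_eq_lintegral_ofReal hi (.of_forall fun n => by positivity),
    integral_poissonMeasure, h2.tsum_eq]
  congr 2
  ring

variable (d : ℕ)

/-- The spherical shell `n ≤ |x| < n + 1`. -/
def shell (n : ℕ) : Set (Space d) := {x | (n : ℝ) ≤ ‖x‖ ∧ ‖x‖ < n + 1}

theorem measurableSet_shell (n : ℕ) : MeasurableSet (shell d n) :=
  (measurableSet_le measurable_const measurable_norm).inter
    (measurableSet_lt measurable_norm measurable_const)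

theorem pairwise_disjoint_shell : Pairwise (Function.onFun Disjoint (shell d)) := by
  intro i j hij
  rw [Function.onFun, Set.disjoint_left]
  rintro x ⟨h1, h2⟩ ⟨h3, h4⟩
  apply hij
  have a1 : (i : ℝ) < j + 1 := by linarith
  have a2 : (j : ℝ) < i + 1 := by linarith
  have b1 : i < j + 1 := by exact_mod_cast a1
  have b2 : j < i + 1 := by exact_mod_cast a2
  omega

theorem mem_shell_floor (x : Space d) : x ∈ shell d ⌊‖x‖⌋₊ :=
  ⟨Nat.floor_le (norm_nonneg x), Nat.lt_floor_add_one _⟩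

theorem volume_shell_ne_top (n : ℕ) : volume (shell d n) ≠ ⊤ := by
  refine ((measure_mono ?_).trans_lt
    (measure_ball_lt_top (μ := volume) (x := (0 : Space d)) (r := n + 1))).ne
  rintro x ⟨_, h⟩
  simpa using h

theorem volume_shell_ne_zero [NeZero d] (n : ℕ) : volume (shell d n) ≠ 0 := by
  have ho : IsOpen {x : Space d | (n : ℝ) < ‖x‖ ∧ ‖x‖ < n + 1} :=
    (isOpen_lt continuous_const continuous_norm).inter (isOpen_lt continuous_norm continuous_const)
  -- A point in the middle of the shell; such a point requires positive dimension.
  obtain ⟨x, hx⟩ := exists_norm_eq (Space d) (c := n + 1 / 2) (by positivity)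
  have hne : {x : Space d | (n : ℝ) < ‖x‖ ∧ ‖x‖ < n + 1}.Nonempty := by
    refine ⟨x, ?_⟩
    change (n : ℝ) < ‖x‖ ∧ ‖x‖ < n + 1
    rw [hx]
    constructor <;> linarith
  have hpos := ho.measure_pos volume hne
  refine (hpos.trans_le (measure_mono ?_)).ne'
  rintro y ⟨h1, h2⟩
  exact ⟨h1.le, h2⟩

/-- The uniform distribution on a shell. -/
def shellLaw (n : ℕ) : Measure (Space d) := cond volume (shell d n)

instance [NeZero d] (n : ℕ) : IsProbabilityMeasure (shellLaw d n) :=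
  cond_isProbabilityMeasure_of_finite (volume_shell_ne_zero d n) (volume_shell_ne_top d n)

variable {d}

theorem volume_smul_integral_shellLaw {E : Type*} [NormedAddCommGroup E] [NormedSpace ℝ E]
    [NeZero d] (n : ℕ) (f : Space d → E) :
    volume.real (shell d n) • ∫ x, f x ∂shellLaw d n = ∫ x in shell d n, f x := by
  have h : volume.real (shell d n) ≠ 0 :=
    ENNReal.toReal_ne_zero.mpr ⟨volume_shell_ne_zero d n, volume_shell_ne_top d n⟩
  rw [shellLaw, ProbabilityTheory.cond, integral_smul_measure, smul_smul, ENNReal.toReal_inv,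
    ← measureReal_def, mul_inv_cancel₀ h, one_smul]

theorem sum_volume_smul_integral_shellLaw {E : Type*} [NormedAddCommGroup E] [NormedSpace ℝ E]
    [NeZero d] {M : ℕ} {f : Space d → E} (hf : Integrable f) (h0 : ∀ x, (M : ℝ) ≤ ‖x‖ → f x = 0) :
    ∑ n ∈ Finset.range M, volume.real (shell d n) • ∫ x, f x ∂shellLaw d n = ∫ x, f x := by
  simp_rw [volume_smul_integral_shellLaw]
  rw [← integral_biUnion_finset _ (fun n _ => measurableSet_shell d n)
    (fun i _ j _ hij => pairwise_disjoint_shell d hij) fun n _ => hf.integrableOn]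
  refine setIntegral_eq_integral_of_forall_compl_eq_zero fun x hx => h0 x ?_
  by_contra hlt
  refine hx (Set.mem_biUnion (x := ⌊‖x‖⌋₊) ?_ (mem_shell_floor d x))
  simp only [Finset.coe_range, Set.mem_Iio]
  exact (Nat.floor_lt (norm_nonneg x)).mpr (not_le.mp hlt)

variable (d) in
/-- The joint law of independent Poisson numbers and uniform points in all shells. -/
def poissonFamilyLaw (m : ℝ≥0) : Measure ((ℕ → ℕ) × ((Σ _ : ℕ, ℕ) → Space d)) :=
  (Measure.infinitePi fun n => poissonMeasure (m * (volume (shell d n)).toNNReal)).prod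
    (Measure.infinitePi fun p : (Σ _ : ℕ, ℕ) => shellLaw d p.1)

/-- The configuration made of the first `N n` points in the `n`-th shell, for each `n`. -/
def shellConfiguration (w : (ℕ → ℕ) × ((Σ _ : ℕ, ℕ) → Space d)) : Configuration d :=
  Configuration.ofFamily fun p : {p : Σ _ : ℕ, ℕ | p.2 < w.1 p.1} => w.2 p

theorem ae_mem_shell [NeZero d] (m : ℝ≥0) : ∀ᵐ w ∂poissonFamilyLaw d m,
    Function.Injective w.2 ∧ ∀ p, w.2 p ∈ shell d p.1 := by
  have h1 : ∀ᵐ U ∂Measure.infinitePi fun p : (Σ _ : ℕ, ℕ) => shellLaw d p.1,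
      Function.Injective U := by
    refine ae_injective_infinitePi _ fun p q _ => ?_
    rw [Measure.prod_apply measurableSet_diagonal]
    have : ∀ x : Space d, shellLaw d q.1 (Prod.mk x ⁻¹' Set.diagonal (Space d)) = 0 := by
      intro x
      have : Prod.mk x ⁻¹' Set.diagonal (Space d) = {x} := by ext y; simp [eq_comm]
      rw [this]
      exact cond_absolutelyContinuous (measure_singleton x)
    simp [this]
  have h2 : ∀ᵐ U ∂Measure.infinitePi fun p : (Σ _ : ℕ, ℕ) => shellLaw d p.1,
      ∀ p, U p ∈ shell d p.1 := by
    rw [ae_all_iff]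
    intro p
    have h3 : ∀ᵐ x ∂shellLaw d p.1, x ∈ shell d p.1 := ae_cond_mem (measurableSet_shell d p.1)
    exact (measurePreserving_eval_infinitePi (fun p : (Σ _ : ℕ, ℕ) => shellLaw d p.1)
      p).quasiMeasurePreserving.ae h3
  exact Measure.quasiMeasurePreserving_snd.ae (h1.and h2)

theorem ae_isGoodFamily_shell [NeZero d] (m : ℝ≥0) : ∀ᵐ w ∂poissonFamilyLaw d m,
    Configuration.IsGoodFamily fun p : {p : Σ _ : ℕ, ℕ | p.2 < w.1 p.1} => w.2 p := by
  filter_upwards [ae_mem_shell m] with w hw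
  refine ⟨fun p q hpq => Subtype.ext (hw.1 hpq), fun K hK => ?_⟩
  obtain ⟨r, hr⟩ := hK.isBounded.subset_closedBall (0 : Space d)
  obtain ⟨n, hn⟩ := exists_nat_ge r
  refine Set.Finite.of_finite_image (f := Subtype.val) ?_ Subtype.val_injective.injOn
  refine ((Finset.range (n + 1)).sigma fun k => Finset.range (w.1 k)).finite_toSet.subset ?_
  rintro _ ⟨p, hp, rfl⟩
  have hp' : w.2 p ∈ K := hp
  have h4 : ‖w.2 p‖ ≤ r := by simpa using hr hp'
  have h5 := (hw.2 p).1
  have h6 : (p.1.1 : ℝ) ≤ n := by linarith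
  have h7 : p.1.1 ≤ n := by exact_mod_cast h6
  simp only [Finset.mem_coe, Finset.mem_sigma, Finset.mem_range]
  exact ⟨by omega, p.2⟩

theorem hasSum_pairing_shellConfiguration [NeZero d] (m : ℝ≥0) : ∀ᵐ w ∂poissonFamilyLaw d m,
    ∀ f : Space d → ℝ, HasCompactSupport f →
      HasSum (fun p : (Σ _ : ℕ, ℕ) => {w : (ℕ → ℕ) × ((Σ _ : ℕ, ℕ) → Space d) |
        p.2 < w.1 p.1}.indicator (fun w => f (w.2 p)) w)
        (Configuration.pairing f (shellConfiguration w)) := by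
  filter_upwards [ae_isGoodFamily_shell m] with w hw f hf
  have h := hw.hasSum_pairing hf
  change HasSum ((fun p => f (w.2 p)) ∘ ((↑) : {p : Σ _ : ℕ, ℕ | p.2 < w.1 p.1} → _)) _ at h
  rw [hasSum_subtype_iff_indicator] at h
  exact h

theorem aemeasurable_shellConfiguration [NeZero d] (m : ℝ≥0) :
    AEMeasurable (shellConfiguration (d := d)) (poissonFamilyLaw d m) := by
  refine Configuration.aemeasurable_of_hasSum_pairing (ι := Σ _ : ℕ, ℕ) (y := fun p w => w.2 p)
    (s := fun p => {w | p.2 < w.1 p.1})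
    (fun p => (measurable_pi_apply p).comp measurable_snd)
    (fun p => measurableSet_lt measurable_const ((measurable_pi_apply p.1).comp measurable_fst)) ?_
  filter_upwards [hasSum_pairing_shellConfiguration m] with w hw f
  exact hw f f.hasCompactSupport

theorem ae_pairing_shellConfiguration [NeZero d] (m : ℝ≥0) {f : Space d → ℝ}
    (hf : HasCompactSupport f) {M : ℕ} (h0 : ∀ x, (M : ℝ) ≤ ‖x‖ → f x = 0) :
    ∀ᵐ w ∂poissonFamilyLaw d m, Configuration.pairing f (shellConfiguration w) =
      ∑ p ∈ (Finset.range M).sigma fun n => Finset.range (w.1 n), f (w.2 p) := by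
  filter_upwards [hasSum_pairing_shellConfiguration m, ae_mem_shell m] with w hw hw2
  rw [← (hw f hf).tsum_eq, tsum_eq_sum (s := (Finset.range M).sigma fun n => Finset.range (w.1 n))]
  · refine Finset.sum_congr rfl fun p hp => Set.indicator_of_mem ?_ _
    exact Finset.mem_range.mp (Finset.mem_sigma.mp hp).2
  · intro p hp
    rw [Set.indicator_apply]
    split_ifs with h
    · refine h0 _ ?_
      have h1 : ¬ p.1 < M := fun hM => hp (Finset.mem_sigma.mpr
        ⟨Finset.mem_range.mpr hM, Finset.mem_range.mpr h⟩)
      have h2 : (M : ℝ) ≤ p.1 := by exact_mod_cast not_lt.mp h1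
      exact h2.trans (hw2.2 p).1
    · rfl

theorem exists_nat_le_norm_eq_zero {E : Type*} [Zero E] {f : Space d → E}
    (hf : HasCompactSupport f) : ∃ M : ℕ, ∀ x, (M : ℝ) ≤ ‖x‖ → f x = 0 := by
  obtain ⟨n, hn⟩ := Configuration.exists_nat_tsupport_subset hf
  refine ⟨n + 1, fun x hx => image_eq_zero_of_notMem_tsupport fun h => ?_⟩
  have h1 : ‖x‖ ≤ n := by simpa using hn h
  push_cast at hx
  linarith

theorem coe_mul_toNNReal_volume (m : ℝ≥0) (n : ℕ) :
    ((m * (volume (shell d n)).toNNReal : ℝ≥0) : ℝ) = m * volume.real (shell d n) := rfl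

theorem integrable_shellLaw_of_continuous [NeZero d] {E : Type*} [NormedAddCommGroup E]
    [SecondCountableTopology E] [MeasurableSpace E] [BorelSpace E]
    {f : Space d → E} (hc : Continuous f) {C : ℝ} (hC : ∀ x, ‖f x‖ ≤ C) (n : ℕ) :
    Integrable f (shellLaw d n) :=
  Integrable.of_bound hc.aestronglyMeasurable C (.of_forall hC)

/-- Conditionally on the numbers of points the expectation is a product over uniform points. The
Poisson generating function then gives one exponential per shell, and the exponents add up to the
integral over the support. -/
theorem lintegral_exp_pairing_shellConfiguration [NeZero d] (m : ℝ≥0) {f : Space d → ℝ}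
    (hc : Continuous f) (hf : HasCompactSupport f) :
    ∫⁻ w, ENNReal.ofReal (Real.exp (Configuration.pairing f (shellConfiguration w)))
      ∂poissonFamilyLaw d m = ENNReal.ofReal (Real.exp (∫ x, (Real.exp (f x) - 1) * m)) := by
  obtain ⟨M, hM⟩ := exists_nat_le_norm_eq_zero hf
  have hae := ae_pairing_shellConfiguration m hf hM
  have hmeas : AEMeasurable (fun w => ENNReal.ofReal
      (Real.exp (Configuration.pairing f (shellConfiguration w)))) (poissonFamilyLaw d m) := by
    have h := (Configuration.continuous_pairing ⟨⟨f, hc⟩, hf⟩).measurable.comp_aemeasurable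
      (aemeasurable_shellConfiguration (d := d) m)
    exact (Real.measurable_exp.comp_aemeasurable h).ennreal_ofReal
  obtain ⟨B, hB⟩ := hf.exists_bound_of_continuous hc
  have hint : ∀ n, Integrable (fun x => Real.exp (f x)) (shellLaw d n) := fun n =>
    integrable_shellLaw_of_continuous (C := Real.exp B) (by fun_prop) (fun x => by
      rw [Real.norm_of_nonneg (Real.exp_pos _).le, Real.exp_le_exp]
      exact (le_abs_self _).trans (hB x)) n
  rw [poissonFamilyLaw] at hmeas hae ⊢
  rw [lintegral_prod _ hmeas]
  set c : ℕ → ℝ := fun n => ∫ x, Real.exp (f x) ∂shellLaw d n with hcdef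
  have hc0 : ∀ n, 0 ≤ c n := fun n => integral_nonneg fun x => (Real.exp_pos _).le
  have h1 : ∀ᵐ N ∂Measure.infinitePi fun n =>
        poissonMeasure (m * (volume (shell d n)).toNNReal),
      (∫⁻ U, ENNReal.ofReal (Real.exp (Configuration.pairing f (shellConfiguration (N, U))))
        ∂Measure.infinitePi fun p : (Σ _ : ℕ, ℕ) => shellLaw d p.1) =
      ∏ n ∈ Finset.range M, ENNReal.ofReal (c n) ^ N n := by
    filter_upwards [Measure.ae_ae_of_ae_prod hae] with N hN
    have h2 : ∀ᵐ U ∂Measure.infinitePi fun p : (Σ _ : ℕ, ℕ) => shellLaw d p.1,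
        ENNReal.ofReal (Real.exp (Configuration.pairing f (shellConfiguration (N, U)))) =
        ∏ p ∈ (Finset.range M).sigma fun n => Finset.range (N n),
          ENNReal.ofReal (Real.exp (f (U p))) := by
      filter_upwards [hN] with U hU
      rw [hU, Real.exp_sum, ENNReal.ofReal_prod_of_nonneg fun p _ => (Real.exp_pos _).le]
    rw [lintegral_congr_ae h2, lintegral_infinitePi_prod _ _
      (f := fun _ x => ENNReal.ofReal (Real.exp (f x))) fun _ => by fun_prop, Finset.prod_sigma]
    refine Finset.prod_congr rfl fun n _ => ?_
    dsimp only
    rw [Finset.prod_const, Finset.card_range,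
      ← ofReal_integral_eq_lintegral_ofReal (hint n) (.of_forall fun x => (Real.exp_pos _).le)]
  rw [lintegral_congr_ae h1, lintegral_infinitePi_prod _ _
    (f := fun n k => ENNReal.ofReal (c n) ^ k) fun _ => measurable_from_top]
  simp_rw [lintegral_pow_poissonMeasure _ (hc0 _)]
  rw [← ENNReal.ofReal_prod_of_nonneg fun p _ => (Real.exp_pos _).le, ← Real.exp_sum]
  congr 2
  have hsupp : HasCompactSupport fun x => (Real.exp (f x) - 1) * (m : ℝ) :=
    hf.comp_left (g := fun y => (Real.exp y - 1) * (m : ℝ)) (by simp)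
  have hi : Integrable fun x => (Real.exp (f x) - 1) * (m : ℝ) :=
    Continuous.integrable_of_hasCompactSupport (by fun_prop) hsupp
  rw [← sum_volume_smul_integral_shellLaw (M := M) hi fun x hx => by simp [hM x hx]]
  refine Finset.sum_congr rfl fun n _ => ?_
  rw [integral_mul_const, integral_sub (hint n) (integrable_const _), coe_mul_toNNReal_volume]
  simp only [integral_const, probReal_univ, smul_eq_mul, one_mul, hcdef]
  ring

/-- The same computation with an imaginary exponent. The Laplace form identifies the measure as
Poisson; this form identifies the limit of the characteristic functionals. -/
theorem integral_cexp_pairing_shellConfiguration [NeZero d] (m : ℝ≥0) {f : Space d → ℝ}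
    (hc : Continuous f) (hf : HasCompactSupport f) :
    ∫ w, Complex.exp (Configuration.pairing f (shellConfiguration w) * Complex.I)
      ∂poissonFamilyLaw d m = Complex.exp (∫ x, (Complex.exp (f x * Complex.I) - 1) * m) := by
  obtain ⟨M, hM⟩ := exists_nat_le_norm_eq_zero hf
  have hae := ae_pairing_shellConfiguration m hf hM
  have hmeas : Integrable (fun w => 
      (Complex.exp (Configuration.pairing f (shellConfiguration w) * Complex.I)))
      (poissonFamilyLaw d m) := by
    have h := (Configuration.continuous_pairing ⟨⟨f, hc⟩, hf⟩).measurable.comp_aemeasurable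
      (aemeasurable_shellConfiguration (d := d) m)
    have : IsProbabilityMeasure (poissonFamilyLaw d m) := by
      rw [poissonFamilyLaw]; infer_instance
    refine Integrable.of_bound (C := 1) ?_ (.of_forall fun w => ?_)
    · exact (Complex.measurable_exp.comp_aemeasurable ((Complex.measurable_ofReal.comp_aemeasurable
        h).mul_const Complex.I)).aestronglyMeasurable
    · rw [Complex.norm_exp_ofReal_mul_I]
  have hint : ∀ n, Integrable (fun x => Complex.exp (f x * Complex.I)) (shellLaw d n) := fun n =>
    integrable_shellLaw_of_continuous (C := 1) (by fun_prop) (fun x => by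
      rw [Complex.norm_exp_ofReal_mul_I]) n
  rw [poissonFamilyLaw] at hmeas hae ⊢
  rw [integral_prod _ hmeas]
  set c : ℕ → ℂ := fun n => ∫ x, Complex.exp (f x * Complex.I) ∂shellLaw d n with hcdef
  have h1 : ∀ᵐ N ∂Measure.infinitePi fun n =>
        poissonMeasure (m * (volume (shell d n)).toNNReal),
      (∫ U, Complex.exp (Configuration.pairing f (shellConfiguration (N, U)) * Complex.I)
        ∂Measure.infinitePi fun p : (Σ _ : ℕ, ℕ) => shellLaw d p.1) =
      ∏ n ∈ Finset.range M, c n ^ N n := by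
    filter_upwards [Measure.ae_ae_of_ae_prod hae] with N hN
    have h2 : ∀ᵐ U ∂Measure.infinitePi fun p : (Σ _ : ℕ, ℕ) => shellLaw d p.1,
        Complex.exp (Configuration.pairing f (shellConfiguration (N, U)) * Complex.I) =
        ∏ p ∈ (Finset.range M).sigma fun n => Finset.range (N n),
          Complex.exp (f (U p) * Complex.I) := by
      filter_upwards [hN] with U hU
      rw [hU, ← Complex.exp_sum, Complex.ofReal_sum, Finset.sum_mul]
    rw [integral_congr_ae h2, integral_infinitePi_prod _ _
      (f := fun _ x => Complex.exp (f x * Complex.I)) fun _ => by fun_prop, Finset.prod_sigma]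
    refine Finset.prod_congr rfl fun n _ => ?_
    dsimp only
    rw [Finset.prod_const, Finset.card_range]
  rw [integral_congr_ae h1, integral_infinitePi_prod _ _
    (f := fun n k => c n ^ k) fun _ => measurable_from_top]
  simp_rw [integral_pow_poissonMeasure]
  rw [← Complex.exp_sum]
  congr 1
  have hsupp : HasCompactSupport fun x => (Complex.exp (f x * Complex.I) - 1) * (m : ℂ) :=
    hf.comp_left (g := fun y : ℝ => (Complex.exp (y * Complex.I) - 1) * (m : ℂ)) (by simp)
  have hi : Integrable fun x => (Complex.exp (f x * Complex.I) - 1) * (m : ℂ) :=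
    Continuous.integrable_of_hasCompactSupport (by fun_prop) hsupp
  rw [← sum_volume_smul_integral_shellLaw (M := M) hi fun x hx => by simp [hM x hx]]
  refine Finset.sum_congr rfl fun n _ => ?_
  rw [integral_mul_const, integral_sub (hint n) (integrable_const _)]
  simp only [integral_const, probReal_univ, Complex.real_smul, hcdef, one_smul]
  have := coe_mul_toNNReal_volume (d := d) m n
  have h3 : (((m * (volume (shell d n)).toNNReal : ℝ≥0) : ℝ) : ℂ) =
      m * volume.real (shell d n) := by
    rw [this]; push_cast; rfl
  rw [show (((m * (volume (shell d n)).toNNReal : ℝ≥0) : ℂ)) = _ from h3]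
  ring

/-- There is a Poisson measure with constant intensity `m`; its characteristic functional is given
by the usual formula. -/
theorem exists_isPoisson [NeZero d] (m : ℝ≥0) : ∃ π : ProbabilityMeasure (Configuration d),
    IsPoisson (fun _ => (m : ℝ)) π ∧ ∀ f : C_c(Space d, ℝ),
      ∫ γ, Complex.exp (Configuration.pairing f γ * Complex.I) ∂(π : Measure (Configuration d)) =
        Complex.exp (m * ∫ x, (Complex.exp (f x * Complex.I) - 1)) := by
  have hm := aemeasurable_shellConfiguration (d := d) m
  have : IsProbabilityMeasure (poissonFamilyLaw d m) := by
    rw [poissonFamilyLaw]; infer_instance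
  refine ⟨⟨(poissonFamilyLaw d m).map shellConfiguration, Measure.isProbabilityMeasure_map hm⟩,
    fun φ hφ hφc => ?_, fun f => ?_⟩
  · have hcp := Configuration.continuous_pairing ⟨⟨φ, hφ.continuous⟩, hφc⟩
    rw [ProbabilityMeasure.coe_mk, lintegral_map' _ hm,
      lintegral_exp_pairing_shellConfiguration m hφ.continuous hφc]
    exact (Real.measurable_exp.comp hcp.measurable).ennreal_ofReal.aemeasurable
  · rw [ProbabilityMeasure.coe_mk, integral_map hm]
    · refine (integral_cexp_pairing_shellConfiguration m (f := f) f.continuous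
        f.hasCompactSupport).trans ?_
      rw [integral_mul_const, mul_comm]
    exact (Complex.measurable_exp.comp ((Complex.measurable_ofReal.comp
      (Configuration.continuous_pairing f).measurable).mul_const _)).aestronglyMeasurable

end Poisson

/-! ### The one-particle jump process -/

theorem integral_bind_of_norm_le {α β E : Type*} [MeasurableSpace α] [MeasurableSpace β]
    [NormedAddCommGroup E] [NormedSpace ℝ E]
    {m : Measure α} [IsProbabilityMeasure m] {κ : α → Measure β} (hκ : Measurable κ)
    (hp : ∀ a, IsProbabilityMeasure (κ a)) {f : β → E} (hf : StronglyMeasurable f) {C : ℝ}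
    (hC : ∀ x, ‖f x‖ ≤ C) :
    ∫ x, f x ∂m.bind κ = ∫ a, ∫ x, f x ∂κ a ∂m := by
  let K : Kernel α β := ⟨κ, hκ⟩
  have : IsMarkovKernel K := ⟨fun a => inferInstanceAs (IsProbabilityMeasure (κ a))⟩
  have hp : IsProbabilityMeasure (m.bind κ) :=
    isProbabilityMeasure_bind hκ.aemeasurable (.of_forall inferInstance)
  have e : (K ∘ₖ Kernel.const Unit m) () = m.bind κ := by
    rw [Kernel.comp_apply]
    simp [K]
  have h := Kernel.integral_comp (κ := Kernel.const Unit m) (η := K) (a := ()) (f := f) (by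
    rw [e]
    exact Integrable.of_bound hf.aestronglyMeasurable C (.of_forall hC))
  rw [e] at h
  simpa [K] using h

namespace IsJumpRate

variable {d : ℕ} {a : Space d → ℝ}

theorem integrable (ha : IsJumpRate a) : Integrable a :=
  not_imp_comm.1 integral_undef ha.integral_pos.ne'

theorem isProbabilityMeasure_stepLaw (ha : IsJumpRate a) (x : Space d) :
    IsProbabilityMeasure (stepLaw a x) := by
  refine ⟨?_⟩
  have hA := ha.integral_pos
  rw [stepLaw, withDensity_apply _ MeasurableSet.univ, Measure.restrict_univ]
  rw [lintegral_sub_left_eq_self (fun w => ENNReal.ofReal (a w / ∫ w, a w)) x,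
    ← ofReal_integral_eq_lintegral_ofReal (ha.integrable.div_const _)
    (.of_forall fun w => div_nonneg (ha.nonneg w) hA.le), integral_div, div_self hA.ne',
    ENNReal.ofReal_one]

theorem measurable_stepLaw (ha : IsJumpRate a) : Measurable (stepLaw a) := by
  refine Measure.measurable_of_measurable_coe _ fun s hs => ?_
  simp_rw [stepLaw, withDensity_apply _ hs]
  have hm : Measurable fun p : Space d × Space d =>
      ENNReal.ofReal (a (p.1 - p.2) / ∫ w, a w) :=
    ((ha.measurable.comp (measurable_fst.sub measurable_snd)).div_const _).ennreal_ofReal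
  exact hm.lintegral_prod_right'

theorem stepLaw_absolutelyContinuous (x : Space d) : stepLaw a x ≪ volume :=
  withDensity_absolutelyContinuous _ _

theorem isProbabilityMeasure_chainLaw (ha : IsJumpRate a) (n : ℕ) (x : Space d) :
    IsProbabilityMeasure (chainLaw a n x) := by
  induction n with
  | zero => exact Measure.dirac.isProbabilityMeasure
  | succ n ih =>
    exact isProbabilityMeasure_bind ha.measurable_stepLaw.aemeasurable
      (.of_forall ha.isProbabilityMeasure_stepLaw)

theorem isProbabilityMeasure_jumpLaw (ha : IsJumpRate a) (t : ℝ≥0) (x : Space d) :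
    IsProbabilityMeasure (jumpLaw a t x) :=
  isProbabilityMeasure_bind measurable_from_top.aemeasurable
    (.of_forall fun n => ha.isProbabilityMeasure_chainLaw n x)

theorem stepLaw_eq_map (a : Space d → ℝ) (x : Space d) :
    stepLaw a x = (stepLaw a 0).map (x + ·) := by
  ext s hs
  rw [Measure.map_apply (by fun_prop) hs, stepLaw, stepLaw, withDensity_apply _ hs,
    withDensity_apply _ (hs.preimage (by fun_prop)),
    ← lintegral_indicator hs, ← lintegral_indicator (hs.preimage (by fun_prop))]
  refine (lintegral_add_left_eq_self _ x).symm.trans (lintegral_congr fun y => ?_)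
  by_cases hy : x + y ∈ s
  · rw [Set.indicator_of_mem hy, Set.indicator_of_mem (by exact hy)]
    simp
  · rw [Set.indicator_of_notMem hy, Set.indicator_of_notMem (by exact hy)]

theorem charFun_stepLaw (a : Space d → ℝ) (x ξ : Space d) :
    charFun (stepLaw a x) ξ = charFun (stepLaw a 0) ξ * Complex.exp (inner ℝ x ξ * Complex.I) := by
  rw [stepLaw_eq_map a x, charFun_map_const_add]

theorem charFun_chainLaw (ha : IsJumpRate a) (n : ℕ) (x ξ : Space d) :
    charFun (chainLaw a n x) ξ =
      charFun (stepLaw a 0) ξ ^ n * Complex.exp (inner ℝ x ξ * Complex.I) := by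
  induction n with
  | zero => rw [chainLaw, charFun_dirac, pow_zero, one_mul]
  | succ n ih =>
    have := ha.isProbabilityMeasure_chainLaw n x
    rw [chainLaw, charFun_apply, integral_bind_of_norm_le (C := 1) ha.measurable_stepLaw
      ha.isProbabilityMeasure_stepLaw]
    · have e : ∀ y, ∫ z, Complex.exp (inner ℝ z ξ * Complex.I) ∂stepLaw a y =
          charFun (stepLaw a 0) ξ * Complex.exp (inner ℝ y ξ * Complex.I) := fun y =>
        charFun_stepLaw a y ξ
      simp_rw [e]
      rw [integral_const_mul, ← charFun_apply, ih]
      ring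
    · exact Measurable.stronglyMeasurable (by fun_prop)
    · intro y
      rw [Complex.norm_exp_ofReal_mul_I]

theorem charFun_jumpLaw (ha : IsJumpRate a) (t : ℝ≥0) (x ξ : Space d) :
    charFun (jumpLaw a t x) ξ =
      Complex.exp (t * (∫ y, a y) * (charFun (stepLaw a 0) ξ - 1)) *
        Complex.exp (inner ℝ x ξ * Complex.I) := by
  rw [jumpLaw, charFun_apply, integral_bind_of_norm_le (C := 1) measurable_from_top
    fun n => ha.isProbabilityMeasure_chainLaw n x]
  · simp_rw [← charFun_apply, fun n => ha.charFun_chainLaw n x ξ]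
    rw [integral_mul_const, integral_pow_poissonMeasure]
    congr 3
    push_cast
    rw [Real.coe_toNNReal _ ha.integral_pos.le]
  · exact Measurable.stronglyMeasurable (by fun_prop)
  · intro y
    rw [Complex.norm_exp_ofReal_mul_I]

/-- The starting point enters the characteristic function only through a phase, which is the effect
of a translation. -/
theorem jumpLaw_eq_map (ha : IsJumpRate a) (t : ℝ≥0) (x : Space d) :
    jumpLaw a t x = (jumpLaw a t 0).map (x + ·) := by
  have h1 := ha.isProbabilityMeasure_jumpLaw t x
  have h2 := ha.isProbabilityMeasure_jumpLaw t 0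
  have h3 : IsProbabilityMeasure ((jumpLaw a t 0).map (x + ·)) :=
    Measure.isProbabilityMeasure_map (by fun_prop)
  refine Measure.ext_of_charFun (funext fun ξ => ?_)
  rw [charFun_map_const_add, ha.charFun_jumpLaw, ha.charFun_jumpLaw]
  simp

theorem chainLaw_singleton [NeZero d] (ha : IsJumpRate a) (n : ℕ) {x z : Space d} (h : z ≠ x) :
    chainLaw a n x {z} = 0 := by
  cases n with
  | zero => simp [chainLaw, h.symm]
  | succ n =>
    rw [chainLaw, Measure.bind_apply (measurableSet_singleton z) ha.measurable_stepLaw.aemeasurable]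
    simp [stepLaw_absolutelyContinuous _ (measure_singleton z)]

theorem jumpLaw_singleton [NeZero d] (ha : IsJumpRate a) (t : ℝ≥0) {x z : Space d} (h : z ≠ x) :
    jumpLaw a t x {z} = 0 := by
  rw [jumpLaw, Measure.bind_apply (measurableSet_singleton z) measurable_from_top.aemeasurable]
  simp [ha.chainLaw_singleton _ h]

/-- The only possible atom of a jump law is its starting point. The first particle almost surely
avoids `y`, and the second charges no single point other than `y`. -/
theorem jumpLaw_prod_diagonal [NeZero d] (ha : IsJumpRate a) (t : ℝ≥0) {x y : Space d}
    (h : x ≠ y) : (jumpLaw a t x).prod (jumpLaw a t y) (Set.diagonal (Space d)) = 0 := by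
  have := ha.isProbabilityMeasure_jumpLaw t y
  rw [Measure.prod_apply measurableSet_diagonal, lintegral_eq_zero_iff
    (measurable_measure_prodMk_left measurableSet_diagonal)]
  have h1 : ∀ᵐ z ∂jumpLaw a t x, z ≠ y := by
    rw [ae_iff]
    simpa using ha.jumpLaw_singleton t h.symm
  filter_upwards [h1] with z hz
  have : Prod.mk z ⁻¹' Set.diagonal (Space d) = {z} := by ext w; simp [eq_comm]
  rw [this]
  exact ha.jumpLaw_singleton t hz

theorem volume_inner_eq_zero {ξ : Space d} (hξ : ξ ≠ 0) (c : ℝ) :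
    volume {y : Space d | inner ℝ y ξ = c} = 0 := by
  let f : Space d →ₗ[ℝ] ℝ := (innerSL ℝ ξ).toLinearMap
  have hf : ∀ y, f y = inner ℝ y ξ := fun y => by simp [f, real_inner_comm]
  by_cases hne : ∃ p, f p = c
  · obtain ⟨p, hp⟩ := hne
    have hset : {y : Space d | inner ℝ y ξ = c} = AffineSubspace.mk' p (LinearMap.ker f) := by
      ext y
      simp [AffineSubspace.mem_mk', ← hf, hp, sub_eq_zero]
    rw [hset]
    refine Measure.addHaar_affineSubspace _ _ fun htop => hξ ?_
    have hd := AffineSubspace.direction_mk' p (LinearMap.ker f)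
    rw [htop, AffineSubspace.direction_top] at hd
    have : f ξ = 0 := LinearMap.mem_ker.mp (hd ▸ Submodule.mem_top)
    rw [hf] at this
    exact inner_self_eq_zero.mp this
  · have : {y : Space d | inner ℝ y ξ = c} = ∅ := by
      ext y
      simp only [Set.mem_ofPred_eq, Set.mem_empty_iff_false, iff_false]
      exact fun h => hne ⟨y, (hf y).trans h⟩
    rw [this, measure_empty]

/-- Equality would force `cos ⟨y, ξ⟩ = 1` almost surely, which confines the step to countably many
parallel hyperplanes. These are null for a law with a density. -/
theorem re_charFun_stepLaw_lt_one (ha : IsJumpRate a) {ξ : Space d} (hξ : ξ ≠ 0) :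
    (charFun (stepLaw a 0) ξ).re < 1 := by
  have := ha.isProbabilityMeasure_stepLaw 0
  have hint : Integrable (fun y => Complex.exp (inner ℝ y ξ * Complex.I)) (stepLaw a 0) :=
    Integrable.of_bound (C := 1) (by fun_prop) (.of_forall fun y => by
      rw [Complex.norm_exp_ofReal_mul_I])
  have hre : (charFun (stepLaw a 0) ξ).re = ∫ y, Real.cos (inner ℝ y ξ) ∂stepLaw a 0 := by
    rw [charFun_apply, ← Complex.reCLM_apply, ← ContinuousLinearMap.integral_comp_comm _ hint]
    simp [Complex.exp_ofReal_mul_I_re]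
  have hcos : Integrable (fun y => Real.cos (inner ℝ y ξ)) (stepLaw a 0) :=
    Integrable.of_bound (C := 1) (by fun_prop) (.of_forall fun y => Real.abs_cos_le_one _)
  have hpos : 0 < ∫ y, (1 - Real.cos (inner ℝ y ξ)) ∂stepLaw a 0 := by
    rw [integral_pos_iff_support_of_nonneg (fun y => sub_nonneg.mpr (Real.cos_le_one _))
      ((integrable_const _).sub hcos), pos_iff_ne_zero]
    intro h0
    have hnull : stepLaw a 0 {y | Real.cos (inner ℝ y ξ) = 1} = 0 := by
      refine stepLaw_absolutelyContinuous 0 ?_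
      have hsub : {y : Space d | Real.cos (inner ℝ y ξ) = 1} ⊆
          ⋃ n : ℤ, {y | inner ℝ y ξ = (n : ℝ) * (2 * Real.pi)} := by
        intro y hy
        obtain ⟨n, hn⟩ := (Real.cos_eq_one_iff _).mp hy
        exact Set.mem_iUnion.mpr ⟨n, hn.symm⟩
      exact measure_mono_null hsub (measure_iUnion_null fun n => volume_inner_eq_zero hξ _)
    have huniv : (Set.univ : Set (Space d)) ⊆
        (Function.support fun y => 1 - Real.cos (inner ℝ y ξ)) ∪
          {y | Real.cos (inner ℝ y ξ) = 1} := by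
      intro y _
      by_cases hy : Real.cos (inner ℝ y ξ) = 1
      · exact Or.inr hy
      · exact Or.inl (sub_ne_zero.mpr (Ne.symm hy))
    have := measure_mono_null huniv (measure_union_null h0 hnull)
    simp at this
  rw [integral_sub (integrable_const _) hcos] at hpos
  simp only [integral_const, probReal_univ, smul_eq_mul, mul_one] at hpos
  rw [hre]
  linarith

theorem tendsto_charFun_jumpLaw (ha : IsJumpRate a) {ξ : Space d} (hξ : ξ ≠ 0) :
    Tendsto (fun t : ℝ≥0 => charFun (jumpLaw a t 0) ξ) atTop (𝓝 0) := by
  rw [tendsto_zero_iff_norm_tendsto_zero]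
  simp_rw [ha.charFun_jumpLaw _ 0 ξ, norm_mul, Complex.norm_exp_ofReal_mul_I, mul_one,
    Complex.norm_exp]
  have hre : ∀ t : ℝ≥0, ((t : ℂ) * (∫ y, a y : ℝ) * (charFun (stepLaw a 0) ξ - 1)).re =
      t * ((∫ y, a y) * ((charFun (stepLaw a 0) ξ).re - 1)) := by
    intro t
    have : ((t : ℂ) * (∫ y, a y : ℝ)) = ((t * ∫ y, a y : ℝ) : ℂ) := by push_cast; rfl
    rw [this, Complex.re_ofReal_mul]
    simp [mul_assoc]
  have hneg : (∫ y, a y) * ((charFun (stepLaw a 0) ξ).re - 1) < 0 :=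
    mul_neg_of_pos_of_neg ha.integral_pos (by linarith [ha.re_charFun_stepLaw_lt_one hξ])
  simp_rw [hre]
  exact Real.tendsto_exp_atBot.comp
    ((NNReal.tendsto_coe_atTop.mpr tendsto_id).atTop_mul_const_of_neg hneg)

end IsJumpRate

/-! ### Smooth test functions and their Fourier transforms -/

section Fourier

variable {d : ℕ}

/-- Smooth compactly supported functions. -/
structure IsTest (g : Space d → ℝ) : Prop where
  contDiff : ContDiff ℝ ∞ g
  hasCompactSupport : HasCompactSupport g

namespace IsTest

variable {g : Space d → ℝ}

theorem ballBump (d n : ℕ) : IsTest (Configuration.ballBump d n) :=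
  ⟨(Configuration.ballBump d n).contDiff, (Configuration.ballBump d n).hasCompactSupport⟩

theorem comp_add_right (hg : IsTest g) (s : Space d) : IsTest fun x => g (x + s) :=
  ⟨hg.contDiff.comp (contDiff_id.add contDiff_const),
    hg.hasCompactSupport.comp_homeomorph (Homeomorph.addRight s)⟩

theorem comp_smul (hg : IsTest g) {r : ℝ} (hr : r ≠ 0) : IsTest fun x => g (r • x) :=
  ⟨hg.contDiff.comp (contDiff_const_smul r),
    hg.hasCompactSupport.comp_homeomorph (Homeomorph.smulOfNeZero r hr)⟩

/-- A smooth compactly supported function as a complex Schwartz function. -/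
def toSchwartz (hg : IsTest g) : 𝓢(Space d, ℂ) :=
  (hg.hasCompactSupport.comp_left Complex.ofReal_zero :
    HasCompactSupport fun x => (g x : ℂ)).toSchwartzMap
    (Complex.ofRealCLM.contDiff.comp hg.contDiff)

@[simp] theorem toSchwartz_apply (hg : IsTest g) (x : Space d) : hg.toSchwartz x = g x := rfl

/-- The inverse Fourier transform of a test function. -/
def transform (hg : IsTest g) : 𝓢(Space d, ℂ) := 𝓕⁻ hg.toSchwartz

theorem transform_apply (hg : IsTest g) (ξ : Space d) :
    hg.transform ξ = ∫ v, Complex.exp ((2 * Real.pi * inner ℝ v ξ : ℝ) * Complex.I) * g v := by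
  rw [transform, SchwartzMap.fourierInv_coe, Real.fourierInv_eq']
  rfl

theorem transform_zero (hg : IsTest g) : hg.transform 0 = (∫ v, g v : ℝ) := by
  rw [transform_apply, ← integral_complex_ofReal]
  simp

/-- The phase is arranged so that integration over `s` produces `charFun` at `-2πξ`; the factor
reconciles the two Fourier normalisations. -/
theorem transform_comp_add_right (hg : IsTest g) (s ξ : Space d) :
    (hg.comp_add_right s).transform ξ =
      Complex.exp (inner ℝ s ((-(2 * Real.pi)) • ξ) * Complex.I) * hg.transform ξ := by
  rw [transform_apply, transform_apply, ← integral_const_mul,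
    ← integral_sub_right_eq_self _ s]
  refine integral_congr_ae (.of_forall fun v => ?_)
  simp only [sub_add_cancel]
  rw [← mul_assoc, ← Complex.exp_add]
  congr 2
  rw [inner_sub_left, real_inner_smul_right]
  push_cast
  ring

theorem transform_comp_smul (hg : IsTest g) {R : ℝ} (hR : 0 < R) (ξ : Space d) :
    (hg.comp_smul (inv_ne_zero hR.ne')).transform ξ = (R ^ d : ℝ) * hg.transform (R • ξ) := by
  rw [transform_apply, transform_apply]
  have h := Measure.integral_comp_inv_smul (volume : Measure (Space d))
    (fun v => Complex.exp ((2 * Real.pi * inner ℝ v (R • ξ) : ℝ) * Complex.I) * g v) R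
  rw [finrank_euclideanSpace_fin, abs_of_pos (by positivity), Complex.real_smul] at h
  rw [← h]
  refine integral_congr_ae (.of_forall fun v => ?_)
  simp only
  rw [inner_smul_left, inner_smul_right]
  simp only [conj_trivial]
  rw [← mul_assoc R⁻¹, inv_mul_cancel₀ hR.ne', one_mul]

theorem exists_transform_bound (hg : IsTest g) (n : ℕ) : ∃ C : ℝ, 0 ≤ C ∧
    ∀ ξ, ‖hg.transform ξ‖ ≤ C * (1 + ‖ξ‖) ^ (-(n : ℝ)) := by
  refine ⟨2 ^ n * (Finset.Iic (n, 0)).sup (fun m => SchwartzMap.seminorm ℝ m.1 m.2) hg.transform,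
    by positivity, fun ξ => ?_⟩
  have h := SchwartzMap.one_add_le_sup_seminorm_apply (𝕜 := ℝ) (m := (n, 0)) (k := n) (n := 0)
    le_rfl le_rfl hg.transform ξ
  rw [norm_iteratedFDeriv_zero] at h
  rw [Real.rpow_neg (by positivity), Real.rpow_natCast, ← div_eq_mul_inv,
    le_div_iff₀ (by positivity), mul_comm]
  exact h

end IsTest

/-- The bump is fixed before `ε`, so the error is `ε` times a fixed function. Approximation from
above suits the monotone functionals to which it is applied. -/
theorem exists_isTest_approx {f : Space d → ℝ} (hc : Continuous f) (hf : HasCompactSupport f) :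
    ∃ n : ℕ, ∀ ε > 0, ∃ q : Space d → ℝ, IsTest q ∧ ∀ x, f x ≤ q x ∧
      q x ≤ f x + ε * Configuration.ballBump d n x := by
  obtain ⟨n, hn⟩ := Configuration.exists_nat_tsupport_subset hf
  refine ⟨n, fun ε hε => ?_⟩
  have huc : UniformContinuous f := hf.uniformContinuous_of_continuous hc
  obtain ⟨g, hg, hgf⟩ := huc.exists_contDiff_dist_le (half_pos hε)
  have hb := IsTest.ballBump d n
  have hfb : ∀ x, f x * Configuration.ballBump d n x = f x := by
    intro x
    by_cases hx : x ∈ tsupport f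
    · have : ‖x‖ ≤ n := by simpa using hn hx
      rw [Configuration.ballBump_eq_one (by linarith), mul_one]
    · rw [image_eq_zero_of_notMem_tsupport hx, zero_mul]
  -- Raising a smooth `ε/2`-approximation by `ε/2` puts it above `f`; the bump, equal to one on the
  -- support of `f`, cuts it off.
  refine ⟨fun x => (g x + ε / 2) * Configuration.ballBump d n x,
    ⟨(hg.add contDiff_const).mul hb.contDiff, hb.hasCompactSupport.mul_left⟩, fun x => ?_⟩
  have h1 := hgf x
  rw [Real.dist_eq, abs_lt] at h1
  have h0 : 0 ≤ Configuration.ballBump d n x := (Configuration.ballBump d n).nonneg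
  constructor
  · calc f x = f x * Configuration.ballBump d n x := (hfb x).symm
      _ ≤ _ := mul_le_mul_of_nonneg_right (by linarith) h0
  · calc (g x + ε / 2) * Configuration.ballBump d n x
        ≤ (f x + ε) * Configuration.ballBump d n x := mul_le_mul_of_nonneg_right (by linarith) h0
      _ = f x + ε * Configuration.ballBump d n x := by rw [add_mul, hfb]

/-! ### Measures of temperate growth -/

/-- The integrable weight is bounded below on compact sets. The resulting σ-finiteness is what
Fubini needs for the spectral measure. -/
theorem isFiniteMeasureOnCompacts_of_hasTemperateGrowth (σ : Measure (Space d))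
    [σ.HasTemperateGrowth] : IsFiniteMeasureOnCompacts σ := by
  refine ⟨fun K hK => ?_⟩
  obtain ⟨n, hn⟩ := Measure.HasTemperateGrowth.exists_integrable (μ := σ)
  obtain ⟨r, hr⟩ := hK.isBounded.subset_closedBall (0 : Space d)
  have hpos : 0 < (1 + max r 0) ^ (-(n : ℝ)) := by positivity
  have hfin := hn.measure_norm_ge_lt_top hpos
  refine (measure_mono fun x hx => ?_).trans_lt hfin
  have hx' : ‖x‖ ≤ r := by simpa using hr hx
  change _ ≤ ‖_‖
  rw [Real.norm_of_nonneg (by positivity), Real.rpow_neg (by positivity),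
    Real.rpow_neg (by positivity)]
  gcongr
  exact hx'.trans (le_max_left _ _)

/-! ### Functions whose Fourier transform is a measure -/

/-- The Fourier transform of `z` is the measure with polar decomposition `h σ`. -/
structure HasFourierMeasure (z : Space d → ℝ) (σ : Measure (Space d)) (h : Space d → ℂ) :
    Prop where
  temperate : σ.HasTemperateGrowth
  measurable : Measurable h
  norm_eq_one : ∀ ξ, ‖h ξ‖ = 1
  integral_fourier : ∀ φ : 𝓢(Space d, ℂ), ∫ x, (z x : ℂ) * 𝓕 φ x = ∫ ξ, φ ξ * h ξ ∂σ

/-- The mass of the spectral measure at the origin. -/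
def atomAtZero (σ : Measure (Space d)) (h : Space d → ℂ) : ℝ := (σ.real {0} * h 0).re

namespace HasFourierMeasure

variable {z : Space d → ℝ} {σ : Measure (Space d)} {h : Space d → ℂ} {g : Space d → ℝ}

theorem integral_mul_test (H : HasFourierMeasure z σ h) (hg : IsTest g) :
    ∫ x, (z x : ℂ) * g x = ∫ ξ, hg.transform ξ * h ξ ∂σ := by
  rw [← H.integral_fourier, IsTest.transform, FourierTransform.fourier_fourierInv_eq]
  rfl

theorem sigmaFinite (H : HasFourierMeasure z σ h) : SigmaFinite σ := by
  have := H.temperate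
  have := isFiniteMeasureOnCompacts_of_hasTemperateGrowth σ
  infer_instance

theorem integrable_transform (H : HasFourierMeasure z σ h) (hg : IsTest g) :
    Integrable (fun ξ => ‖hg.transform ξ‖) σ := by
  have := H.temperate
  exact (hg.transform.integrable).norm

theorem integral_mul_shift (H : HasFourierMeasure z σ h) (hg : IsTest g) (s : Space d) :
    ∫ x, (z x : ℂ) * g (x + s) =
      ∫ ξ, Complex.exp (inner ℝ s ((-(2 * Real.pi)) • ξ) * Complex.I) *
        (hg.transform ξ * h ξ) ∂σ := by
  rw [H.integral_mul_test (hg.comp_add_right s)]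
  refine integral_congr_ae (.of_forall fun ξ => ?_)
  simp only [hg.transform_comp_add_right s ξ, mul_assoc]

/-- A shift only changes phases in the spectral integral. The bound, uniform in `s`, takes the place
of boundedness of `z`. -/
theorem abs_integral_mul_shift_le (H : HasFourierMeasure z σ h) (hg : IsTest g) (s : Space d) :
    |∫ x, z x * g (x + s)| ≤ ∫ ξ, ‖hg.transform ξ‖ ∂σ := by
  have e : ((∫ x, z x * g (x + s) : ℝ) : ℂ) = ∫ x, (z x : ℂ) * g (x + s) := by
    rw [← integral_complex_ofReal]
    simp
  rw [← Real.norm_eq_abs, ← Complex.norm_real, e, H.integral_mul_shift hg s]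
  refine (norm_integral_le_integral_norm _).trans (le_of_eq ?_)
  refine integral_congr_ae (.of_forall fun ξ => ?_)
  simp only [norm_mul, Complex.norm_exp_ofReal_mul_I, H.norm_eq_one, one_mul, mul_one]

theorem integral_integral_mul_shift (H : HasFourierMeasure z σ h) (hg : IsTest g)
    (ν : Measure (Space d)) [IsProbabilityMeasure ν] :
    ∫ s, (∫ x, (z x : ℂ) * g (x + s)) ∂ν =
      ∫ ξ, charFun ν ((-(2 * Real.pi)) • ξ) * (hg.transform ξ * h ξ) ∂σ := by
  have := H.sigmaFinite
  simp_rw [H.integral_mul_shift hg]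
  rw [integral_integral_swap]
  · refine integral_congr_ae (.of_forall fun ξ => ?_)
    simp only [charFun_apply]
    rw [integral_mul_const]
  · have h1 : Integrable (fun p : Space d × Space d => ‖hg.transform p.2‖) (ν.prod σ) :=
      (H.integrable_transform hg).comp_snd ν
    refine h1.mono' ?_ (.of_forall fun p => ?_)
    · have hm := H.measurable
      have hm2 : Measurable fun ξ => hg.transform ξ := hg.transform.continuous.measurable
      refine Measurable.aestronglyMeasurable ?_
      simp only [Function.uncurry_def]
      exact Measurable.mul (by fun_prop) ((hm2.comp measurable_snd).mul (hm.comp measurable_snd))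
    · simp only [Function.uncurry_def, norm_mul, Complex.norm_exp_ofReal_mul_I, H.norm_eq_one,
        one_mul, mul_one, le_refl]

theorem integral_indicator_zero (σ : Measure (Space d)) (h : Space d → ℂ) (c : ℂ) :
    ∫ ξ, ({0} : Set (Space d)).indicator (fun ξ => c * h ξ) ξ ∂σ = c * (σ.real {0} * h 0) := by
  rw [integral_indicator (measurableSet_singleton 0), integral_singleton, Complex.real_smul]
  ring

/-- The multipliers converge, with domination, to `c` times the indicator of the origin. Smearing by
`ν` and spatial dilation are both instances, which is why they yield the same constant. -/
theorem tendsto_integral_mul_transform {ι : Type*} {l : Filter ι} [l.IsCountablyGenerated]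
    (H : HasFourierMeasure z σ h) {F : ι → Space d → ℂ} (hF : ∀ i, Measurable (F i))
    {b : Space d → ℝ} (hb : Integrable b σ) {c : ℂ} (hle : ∀ᶠ i in l, ∀ ξ, ‖F i ξ‖ ≤ b ξ)
    (h0 : ∀ i, F i 0 = c) (hlim : ∀ ξ, ξ ≠ 0 → Tendsto (fun i => F i ξ) l (𝓝 0)) :
    Tendsto (fun i => ∫ ξ, F i ξ * h ξ ∂σ) l (𝓝 (c * (σ.real {0} * h 0))) := by
  rw [← integral_indicator_zero σ h]
  have hm := H.measurable
  refine tendsto_integral_filter_of_dominated_convergence b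
    (.of_forall fun i => ((hF i).mul hm).aestronglyMeasurable) ?_ hb (.of_forall fun ξ => ?_)
  · filter_upwards [hle] with i hi
    refine .of_forall fun ξ => ?_
    rw [norm_mul, H.norm_eq_one, mul_one]
    exact hi ξ
  · by_cases hξ : ξ = 0
    · simp only [hξ, h0, Set.mem_singleton_iff, Set.indicator_of_mem]
      exact tendsto_const_nhds
    · simpa [hξ] using (hlim ξ hξ).mul_const (h ξ)

theorem tendsto_integral_shift {ι : Type*} {l : Filter ι} [l.IsCountablyGenerated]
    (H : HasFourierMeasure z σ h) (hg : IsTest g) {ν : ι → Measure (Space d)}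
    (hν : ∀ i, IsProbabilityMeasure (ν i))
    (hlim : ∀ ξ, ξ ≠ 0 → Tendsto (fun i => charFun (ν i) ξ) l (𝓝 0)) :
    Tendsto (fun i => ∫ s, (∫ x, z x * g (x + s)) ∂ν i) l (𝓝 (atomAtZero σ h * ∫ x, g x)) := by
  have h1 : Tendsto (fun i => ∫ s, (∫ x, (z x : ℂ) * g (x + s)) ∂ν i) l
      (𝓝 (hg.transform 0 * (σ.real {0} * h 0))) := by
    have e : ∀ i, ∫ s, (∫ x, (z x : ℂ) * g (x + s)) ∂ν i =
        ∫ ξ, charFun (ν i) ((-(2 * Real.pi)) • ξ) * hg.transform ξ * h ξ ∂σ := fun i => by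
      simp_rw [H.integral_integral_mul_shift hg (ν i), mul_assoc]
    simp_rw [e]
    refine H.tendsto_integral_mul_transform (l := l) (fun i => ?_) (H.integrable_transform hg)
      (.of_forall fun i ξ => ?_) (fun i => ?_) fun ξ hξ => ?_
    · exact (measurable_charFun.comp (measurable_const_smul _)).mul
        hg.transform.continuous.measurable
    · rw [norm_mul]
      exact mul_le_of_le_one_left (norm_nonneg _) (norm_charFun_le_one _)
    · simp
    · have : (-(2 * Real.pi)) • ξ ≠ 0 := smul_ne_zero (by simp [Real.pi_ne_zero]) hξ
      simpa using (hlim _ this).mul_const (hg.transform ξ)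
  have h2 := (Complex.continuous_re.tendsto _).comp h1
  rw [hg.transform_zero, Complex.re_ofReal_mul, mul_comm] at h2
  refine h2.congr fun i => ?_
  have e : ∀ s, (∫ x, (z x : ℂ) * g (x + s)) = ((∫ x, z x * g (x + s) : ℝ) : ℂ) := by
    intro s
    rw [← integral_complex_ofReal]
    simp
  simp only [Function.comp, e]
  rw [integral_complex_ofReal, Complex.ofReal_re]

theorem tendsto_scaled_integral (H : HasFourierMeasure z σ h) (hg : IsTest g) :
    Tendsto (fun R : ℝ => (R ^ d)⁻¹ * ∫ x, z x * g (R⁻¹ • x)) atTop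
      (𝓝 (atomAtZero σ h * ∫ x, g x)) := by
  have := H.temperate
  obtain ⟨n, hn⟩ := Measure.HasTemperateGrowth.exists_integrable (μ := σ)
  -- The exponent `n` gives a majorant integrable against `σ` for all `R ≥ 1`; exponent one below
  -- suffices for decay at a fixed `ξ ≠ 0`.
  obtain ⟨C, hC0, hC⟩ := hg.exists_transform_bound n
  obtain ⟨C₁, hC₁0, hC₁⟩ := hg.exists_transform_bound 1
  have h1 : Tendsto (fun R : ℝ => ∫ ξ, hg.transform (R • ξ) * h ξ ∂σ) atTop
      (𝓝 (hg.transform 0 * (σ.real {0} * h 0))) := by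
    refine H.tendsto_integral_mul_transform (fun R => ?_) (hn.const_mul C) ?_
      (fun R => by simp) fun ξ hξ => ?_
    · exact hg.transform.continuous.measurable.comp (measurable_const_smul _)
    · filter_upwards [eventually_ge_atTop 1] with R hR ξ
      refine (hC _).trans (mul_le_mul_of_nonneg_left ?_ hC0)
      rw [Real.rpow_neg (by positivity), Real.rpow_neg (by positivity), norm_smul,
        Real.norm_of_nonneg (by linarith)]
      gcongr
      exact le_mul_of_one_le_left (norm_nonneg _) hR
    · have h2 : Tendsto (fun R : ℝ => C₁ * (1 + R * ‖ξ‖)⁻¹) atTop (𝓝 (C₁ * 0)) := by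
        refine Tendsto.const_mul _ (tendsto_inv_atTop_zero.comp ?_)
        exact tendsto_atTop_add_const_left _ _
          (tendsto_id.atTop_mul_const (norm_pos_iff.mpr hξ))
      rw [mul_zero] at h2
      refine squeeze_zero_norm' ?_ h2
      filter_upwards [eventually_ge_atTop 0] with R hR
      have := hC₁ (R • ξ)
      rw [norm_smul, Real.norm_of_nonneg hR, Nat.cast_one, Real.rpow_neg_one] at this
      exact this
  have h2 := (Complex.continuous_re.tendsto _).comp h1
  rw [hg.transform_zero, Complex.re_ofReal_mul, mul_comm] at h2
  refine h2.congr' ?_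
  filter_upwards [eventually_gt_atTop 0] with R hR
  have e := H.integral_mul_test (hg.comp_smul (inv_ne_zero hR.ne'))
  have e2 : (∫ x, (z x : ℂ) * g (R⁻¹ • x)) = ((∫ x, z x * g (R⁻¹ • x) : ℝ) : ℂ) := by
    rw [← integral_complex_ofReal]
    simp
  simp_rw [hg.transform_comp_smul hR, mul_assoc] at e
  rw [e2, integral_const_mul] at e
  have hR' : ((R ^ d : ℝ) : ℂ) ≠ 0 := by exact_mod_cast (pow_pos hR d).ne'
  have e3 : (∫ ξ, hg.transform (R • ξ) * h ξ ∂σ) =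
      (((R ^ d)⁻¹ * ∫ x, z x * g (R⁻¹ • x) : ℝ) : ℂ) := by
    rw [Complex.ofReal_mul, e, Complex.ofReal_inv, inv_mul_cancel_left₀ hR']
  simp only [Function.comp, e3, Complex.ofReal_re]

end HasFourierMeasure

/-- Averages of a test function with respect to the translates of a family of probability measures
with vanishing characteristic functions tend to zero uniformly. -/
theorem IsTest.exists_tendsto_zero_bound {ι : Type*} {l : Filter ι} [l.IsCountablyGenerated]
    {g : Space d → ℝ} (hg : IsTest g) {ν : ι → Measure (Space d)} [NeZero d]
    (hν : ∀ i, IsProbabilityMeasure (ν i))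
    (hlim : ∀ ξ, ξ ≠ 0 → Tendsto (fun i => charFun (ν i) ξ) l (𝓝 0)) :
    ∃ η : ι → ℝ, Tendsto η l (𝓝 0) ∧ ∀ i x, |∫ s, g (x + s) ∂ν i| ≤ η i := by
  refine ⟨fun i => ∫ ξ, ‖charFun (ν i) ((-(2 * Real.pi)) • ξ)‖ * ‖hg.transform ξ‖, ?_,
    fun i x => ?_⟩
  · have hint : Integrable fun ξ => ‖hg.transform ξ‖ := hg.transform.integrable.norm
    rw [← integral_zero (Space d) ℝ (μ := volume)]
    refine tendsto_integral_filter_of_dominated_convergence (fun ξ => ‖hg.transform ξ‖)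
      (.of_forall fun i => ?_) (.of_forall fun i => .of_forall fun ξ => ?_) hint ?_
    · exact ((measurable_charFun.comp (measurable_const_smul _)).norm.mul
        hg.transform.continuous.measurable.norm).aestronglyMeasurable
    · rw [Real.norm_of_nonneg (by positivity)]
      exact mul_le_of_le_one_left (norm_nonneg _) (norm_charFun_le_one _)
    -- In positive dimension the origin is Lebesgue null, so here no atom survives and the limit is
    -- zero.
    · have hne : ∀ᵐ ξ : Space d, ξ ≠ 0 := by
        rw [ae_iff]
        simp
      filter_upwards [hne] with ξ hξ
      have : (-(2 * Real.pi)) • ξ ≠ 0 := smul_ne_zero (by simp [Real.pi_ne_zero]) hξ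
      simpa using (hlim _ this).norm.mul_const ‖hg.transform ξ‖
  · have e : ∀ y, (g y : ℂ) = ∫ v, Complex.exp (inner ℝ y ((-(2 * Real.pi)) • v) * Complex.I) *
        hg.transform v := by
      intro y
      have h1 : hg.toSchwartz = 𝓕 hg.transform := by
        rw [IsTest.transform, FourierTransform.fourier_fourierInv_eq]
      rw [← hg.toSchwartz_apply, h1, SchwartzMap.fourier_coe, Real.fourier_eq']
      refine integral_congr_ae (.of_forall fun v => ?_)
      simp only [smul_eq_mul]
      congr 4
      rw [real_inner_smul_right, real_inner_comm]
      ring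
    have e2 : ((∫ s, g (x + s) ∂ν i : ℝ) : ℂ) =
        ∫ v, charFun (ν i) ((-(2 * Real.pi)) • v) *
          (Complex.exp (inner ℝ x ((-(2 * Real.pi)) • v) * Complex.I) * hg.transform v) := by
      rw [← integral_complex_ofReal]
      simp_rw [e]
      rw [integral_integral_swap]
      · refine integral_congr_ae (.of_forall fun v => ?_)
        simp only [charFun_apply]
        rw [← integral_mul_const]
        refine integral_congr_ae (.of_forall fun s => ?_)
        simp only
        rw [← mul_assoc, ← Complex.exp_add, inner_add_left]
        push_cast
        ring_nf
      · have h1 : Integrable (fun p : Space d × Space d => ‖hg.transform p.2‖)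
            ((ν i).prod volume) :=
          hg.transform.integrable.norm.comp_snd (ν i)
        refine h1.mono' ?_ (.of_forall fun p => ?_)
        · have hm2 : Measurable fun ξ => hg.transform ξ := hg.transform.continuous.measurable
          refine Measurable.aestronglyMeasurable ?_
          simp only [Function.uncurry_def]
          exact Measurable.mul (by fun_prop) (hm2.comp measurable_snd)
        · simp only [Function.uncurry_def, norm_mul, Complex.norm_exp_ofReal_mul_I, one_mul,
            le_refl]
    rw [← Real.norm_eq_abs, ← Complex.norm_real, e2]
    refine (norm_integral_le_integral_norm _).trans (le_of_eq ?_)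
    refine integral_congr_ae (.of_forall fun v => ?_)
    simp only [norm_mul, Complex.norm_exp_ofReal_mul_I, one_mul]

end Fourier

/-! ### Averages of test functions -/

section Average

variable {d : ℕ}

/-- The average of the translates of `g` with respect to `ν`. -/
def average (ν : Measure (Space d)) (g : Space d → ℝ) (x : Space d) : ℝ≥0∞ :=
  ∫⁻ s, ENNReal.ofReal (g (x + s)) ∂ν

theorem measurable_average (ν : Measure (Space d)) [SFinite ν] {g : Space d → ℝ}
    (hg : Measurable g) : Measurable (average ν g) :=
  Measurable.lintegral_prod_right'
    (f := fun p : Space d × Space d => ENNReal.ofReal (g (p.1 + p.2))) (by fun_prop)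

theorem average_mono (ν : Measure (Space d)) {f g : Space d → ℝ} (h : ∀ x, f x ≤ g x)
    (x : Space d) : average ν f x ≤ average ν g x :=
  lintegral_mono fun _ => ENNReal.ofReal_le_ofReal (h _)

theorem average_add_const_mul (ν : Measure (Space d)) {f g : Space d → ℝ} (hf : Measurable f)
    (hf0 : ∀ x, 0 ≤ f x) (hg0 : ∀ x, 0 ≤ g x) (hg : Measurable g) {c : ℝ} (hc : 0 ≤ c)
    (x : Space d) : average ν (fun x => f x + c * g x) x =
      average ν f x + ENNReal.ofReal c * average ν g x := by
  simp only [average]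
  rw [← lintegral_const_mul _ (by fun_prop), ← lintegral_add_left (by fun_prop)]
  refine lintegral_congr fun s => ?_
  rw [ENNReal.ofReal_add (hf0 _) (mul_nonneg hc (hg0 _)), ENNReal.ofReal_mul hc]

theorem lintegral_average (ν : Measure (Space d)) [IsProbabilityMeasure ν] {g : Space d → ℝ}
    (hg : Measurable g) : ∫⁻ x, average ν g x = ∫⁻ x, ENNReal.ofReal (g x) := by
  simp only [average]
  rw [lintegral_lintegral_swap (by fun_prop)]
  simp_rw [lintegral_add_right_eq_self (fun x => ENNReal.ofReal (g x))]
  simp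

variable {ρ : Space d → ℝ≥0} {σ : Measure (Space d)} {h : Space d → ℂ} {g : Space d → ℝ}

theorem integrable_mul_of_hasCompactSupport (hloc : LocallyIntegrable fun x => (ρ x : ℝ))
    (hc : Continuous g) (hg : HasCompactSupport g) : Integrable fun x => (ρ x : ℝ) * g x := by
  refine (hloc.integrable_smul_left_of_hasCompactSupport hc hg).congr (.of_forall fun x => ?_)
  simp [mul_comm]

theorem lintegral_average_mul (hm : Measurable ρ) (hloc : LocallyIntegrable fun x => (ρ x : ℝ))
    (hc : Continuous g) (hg : HasCompactSupport g) (h0 : ∀ x, 0 ≤ g x) (ν : Measure (Space d))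
    [SFinite ν] :
    ∫⁻ x, average ν g x * ρ x = ∫⁻ s, ENNReal.ofReal (∫ x, (ρ x : ℝ) * g (x + s)) ∂ν := by
  have h1 : ∀ x, average ν g x * ρ x = ∫⁻ s, ENNReal.ofReal (g (x + s)) * ρ x ∂ν := fun x => by
    rw [average, lintegral_mul_const _ (by fun_prop)]
  simp_rw [h1]
  rw [lintegral_lintegral_swap (by fun_prop)]
  refine lintegral_congr fun s => ?_
  rw [ofReal_integral_eq_lintegral_ofReal]
  · refine lintegral_congr fun x => ?_
    rw [mul_comm, ENNReal.ofReal_mul (ρ x).coe_nonneg, ENNReal.ofReal_coe_nnreal]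
  · exact integrable_mul_of_hasCompactSupport hloc (by fun_prop)
      (hg.comp_homeomorph (Homeomorph.addRight s))
  · exact .of_forall fun x => mul_nonneg (ρ x).coe_nonneg (h0 _)

namespace HasFourierMeasure

theorem lintegral_average_mul_lt_top (H : HasFourierMeasure (fun x => (ρ x : ℝ)) σ h)
    (hm : Measurable ρ) (hloc : LocallyIntegrable fun x => (ρ x : ℝ)) (hg : IsTest g)
    (h0 : ∀ x, 0 ≤ g x) (ν : Measure (Space d)) [IsProbabilityMeasure ν] :
    ∫⁻ x, average ν g x * ρ x < ⊤ := by
  rw [lintegral_average_mul hm hloc hg.contDiff.continuous hg.hasCompactSupport h0]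
  calc ∫⁻ s, ENNReal.ofReal (∫ x, (ρ x : ℝ) * g (x + s)) ∂ν
      ≤ ∫⁻ _, ENNReal.ofReal (∫ ξ, ‖hg.transform ξ‖ ∂σ) ∂ν := lintegral_mono fun s =>
        ENNReal.ofReal_le_ofReal ((le_abs_self _).trans (H.abs_integral_mul_shift_le hg s))
    _ < ⊤ := by simp

theorem tendsto_lintegral_average_mul_of_isTest {ι : Type*} {l : Filter ι}
    [l.IsCountablyGenerated] (H : HasFourierMeasure (fun x => (ρ x : ℝ)) σ h)
    (hm : Measurable ρ) (hloc : LocallyIntegrable fun x => (ρ x : ℝ)) (hg : IsTest g)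
    (h0 : ∀ x, 0 ≤ g x) {ν : ι → Measure (Space d)} (hν : ∀ i, IsProbabilityMeasure (ν i))
    (hlim : ∀ ξ, ξ ≠ 0 → Tendsto (fun i => charFun (ν i) ξ) l (𝓝 0)) :
    Tendsto (fun i => ∫⁻ x, average (ν i) g x * ρ x) l
      (𝓝 (ENNReal.ofReal (atomAtZero σ h * ∫ x, g x))) := by
  have h1 := ENNReal.tendsto_ofReal (H.tendsto_integral_shift hg hν hlim)
  refine h1.congr fun i => ?_
  have hc := hg.contDiff.continuous
  rw [lintegral_average_mul hm hloc hc hg.hasCompactSupport h0,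
    ofReal_integral_eq_lintegral_ofReal]
  · refine Integrable.of_bound ?_ (∫ ξ, ‖hg.transform ξ‖ ∂σ)
      (.of_forall fun s => H.abs_integral_mul_shift_le hg s)
    have hs : StronglyMeasurable fun p : Space d × Space d => (ρ p.2 : ℝ) * g (p.2 + p.1) :=
      Measurable.stronglyMeasurable (by fun_prop)
    exact hs.integral_prod_right'.aestronglyMeasurable
  · exact .of_forall fun s => integral_nonneg fun x => mul_nonneg (ρ x).coe_nonneg (h0 _)

/-- Up to the positive integral of a bump, the atom is a limit of non-negative rescaled integrals of
`ρ`. -/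
theorem atomAtZero_nonneg (H : HasFourierMeasure (fun x => (ρ x : ℝ)) σ h) :
    0 ≤ atomAtZero σ h := by
  have hg := IsTest.ballBump d 0
  have h1 := H.tendsto_scaled_integral hg
  have h2 : 0 ≤ atomAtZero σ h * ∫ x, Configuration.ballBump d 0 x := by
    refine ge_of_tendsto h1 ?_
    filter_upwards [eventually_ge_atTop 0] with R hR
    exact mul_nonneg (by positivity) (integral_nonneg fun x =>
      mul_nonneg (ρ x).coe_nonneg (Configuration.ballBump d 0).nonneg)
  exact nonneg_of_mul_nonneg_left h2 (Configuration.ballBump d 0).integral_pos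

/-- Passage from smooth to continuous functions, needed for the non-smooth functions `|e^{if} - 1|`
and positive and negative parts. The functional is squeezed between its value at a smooth majorant
and the same less `ε` times its value at a bump. -/
theorem tendsto_lintegral_average_mul {ι : Type*} {l : Filter ι}
    [l.IsCountablyGenerated] (H : HasFourierMeasure (fun x => (ρ x : ℝ)) σ h)
    (hm : Measurable ρ) (hloc : LocallyIntegrable fun x => (ρ x : ℝ))
    (hc : Continuous g) (hg : HasCompactSupport g)
    (h0 : ∀ x, 0 ≤ g x) {ν : ι → Measure (Space d)} (hν : ∀ i, IsProbabilityMeasure (ν i))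
    (hlim : ∀ ξ, ξ ≠ 0 → Tendsto (fun i => charFun (ν i) ξ) l (𝓝 0)) :
    Tendsto (fun i => ∫⁻ x, average (ν i) g x * ρ x) l
      (𝓝 (ENNReal.ofReal (atomAtZero σ h * ∫ x, g x))) := by
  obtain ⟨n, hn⟩ := exists_isTest_approx hc hg
  have hb := IsTest.ballBump d n
  have hb0 : ∀ x, 0 ≤ Configuration.ballBump d n x := fun x => (Configuration.ballBump d n).nonneg
  have hm0 := H.atomAtZero_nonneg
  have hgi : Integrable g := hc.integrable_of_hasCompactSupport hg
  have hbi : Integrable (Configuration.ballBump d n) :=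
    hb.contDiff.continuous.integrable_of_hasCompactSupport hb.hasCompactSupport
  set m := atomAtZero σ h
  set K := ∫ x, Configuration.ballBump d n x
  have hK0 : 0 ≤ K := integral_nonneg hb0
  let L : ι → (Space d → ℝ) → ℝ≥0∞ := fun i f => ∫⁻ x, average (ν i) f x * ρ x
  have hmono : ∀ i (f₁ f₂ : Space d → ℝ), (∀ x, f₁ x ≤ f₂ x) → L i f₁ ≤ L i f₂ :=
    fun i f₁ f₂ h12 => lintegral_mono fun x => by gcongr; exact average_mono _ h12 x
  have hfin : ∀ i (f : Space d → ℝ), IsTest f → (∀ x, 0 ≤ f x) → L i f ≠ ⊤ := fun i f hf hf0 =>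
    have := hν i
    (H.lintegral_average_mul_lt_top hm hloc hf hf0 (ν i)).ne
  have hlim' : ∀ f : Space d → ℝ, IsTest f → (∀ x, 0 ≤ f x) →
      Tendsto (fun i => (L i f).toReal) l (𝓝 (m * ∫ x, f x)) := fun f hf hf0 => by
    have h1 := (ENNReal.tendsto_toReal ENNReal.ofReal_ne_top).comp
      (H.tendsto_lintegral_average_mul_of_isTest hm hloc hf hf0 hν hlim)
    rwa [ENNReal.toReal_ofReal (mul_nonneg hm0 (integral_nonneg hf0))] at h1
  obtain ⟨q₁, hq₁, hgq₁⟩ := hn 1 one_pos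
  have hgfin : ∀ i, L i g ≠ ⊤ := fun i => ne_top_of_le_ne_top
    (hfin i q₁ hq₁ fun x => (h0 x).trans (hgq₁ x).1) (hmono i _ _ fun x => (hgq₁ x).1)
  refine (ENNReal.tendsto_toReal_iff hgfin ENNReal.ofReal_ne_top).1 ?_
  rw [ENNReal.toReal_ofReal (mul_nonneg hm0 (integral_nonneg h0)), Metric.tendsto_nhds]
  intro δ hδ
  -- One `m * K` bounds the change of the limit from `g` to `q`; `m * K + 1` eventually bounds the
  -- functional at the bump.
  obtain ⟨ε, hε, hεδ⟩ : ∃ ε > 0, ε * (2 * (m * K) + 1) < δ / 2 := by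
    refine ⟨δ / 4 / (2 * (m * K) + 1), by positivity, ?_⟩
    rw [div_mul_cancel₀ _ (by positivity)]
    linarith
  obtain ⟨q, hq, hgq⟩ := hn ε hε
  have hq0 : ∀ x, 0 ≤ q x := fun x => (h0 x).trans (hgq x).1
  have hqi : Integrable q := hq.contDiff.continuous.integrable_of_hasCompactSupport
    hq.hasCompactSupport
  have hI1 : ∫ x, g x ≤ ∫ x, q x := integral_mono hgi hqi fun x => (hgq x).1
  have hI2 : ∫ x, q x ≤ (∫ x, g x) + ε * K := by
    have := integral_mono hqi (hgi.add (hbi.const_mul ε)) fun x => (hgq x).2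
    rwa [integral_add' hgi (hbi.const_mul ε), integral_const_mul] at this
  filter_upwards [(Metric.tendsto_nhds.1 (hlim' q hq hq0)) (δ / 2) (half_pos hδ),
    (hlim' _ hb hb0).eventually_lt_const (show m * K < m * K + 1 by linarith)] with i hi1 hi2
  have h1 : (L i g).toReal ≤ (L i q).toReal :=
    ENNReal.toReal_mono (hfin i q hq hq0) (hmono i _ _ fun x => (hgq x).1)
  have h2 : (L i q).toReal ≤ (L i g).toReal + ε * (L i (Configuration.ballBump d n)).toReal := by
    have := hν i
    have h3 : L i q ≤ L i g + ENNReal.ofReal ε * L i (Configuration.ballBump d n) := by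
      refine (hmono i _ _ fun x => (hgq x).2).trans (le_of_eq ?_)
      simp only [L]
      have hbm : Measurable fun x => average (ν i) (Configuration.ballBump d n) x * (ρ x : ℝ≥0∞) :=
        (measurable_average _ hb.contDiff.continuous.measurable).mul hm.coe_nnreal_ennreal
      have hgm : Measurable fun x => average (ν i) g x * (ρ x : ℝ≥0∞) :=
        (measurable_average _ hc.measurable).mul hm.coe_nnreal_ennreal
      rw [← lintegral_const_mul _ hbm, ← lintegral_add_left hgm]
      refine lintegral_congr fun x => ?_
      rw [average_add_const_mul _ hc.measurable h0 hb0 hb.contDiff.continuous.measurable hε.le,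
        add_mul, mul_assoc]
    have h4 := ENNReal.toReal_mono
      (ENNReal.add_ne_top.2 ⟨hgfin i, ENNReal.mul_ne_top ENNReal.ofReal_ne_top (hfin i _ hb hb0)⟩)
      h3
    rwa [ENNReal.toReal_add (hgfin i) (ENNReal.mul_ne_top ENNReal.ofReal_ne_top (hfin i _ hb hb0)),
      ENNReal.toReal_mul, ENNReal.toReal_ofReal hε.le] at h4
  rw [Real.dist_eq, abs_lt] at hi1 ⊢
  have h5 : m * ∫ x, g x ≤ m * ∫ x, q x := by gcongr
  have h6 : m * ∫ x, q x ≤ m * (∫ x, g x) + ε * (m * K) := by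
    calc m * ∫ x, q x ≤ m * ((∫ x, g x) + ε * K) := by gcongr
      _ = _ := by ring
  have h7 : ε * (L i (Configuration.ballBump d n)).toReal ≤ ε * (m * K + 1) := by gcongr
  have h8 : 0 ≤ ε * (m * K) := by positivity
  change -δ < (L i g).toReal - _ ∧ (L i g).toReal - _ < δ
  constructor <;> nlinarith [hi1.1, hi1.2]

/-! ### The arithmetic mean -/

/-- The indicator of a ball is squeezed between dilated smooth bumps whose two radii have ratio
close to one, and the dilation limit applies to each bump. -/
theorem hasArithmeticMean [NeZero d] (H : HasFourierMeasure (fun x => (ρ x : ℝ)) σ h)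
    (hloc : LocallyIntegrable fun x => (ρ x : ℝ)) :
    HasArithmeticMean (fun x => (ρ x : ℝ)) (atomAtZero σ h) := by
  refine ⟨hloc, ?_⟩
  have hm0 := H.atomAtZero_nonneg
  set m := atomAtZero σ h
  set V := volume.real (Metric.closedBall (0 : Space d) 1)
  have hV : 0 < V := by
    refine ENNReal.toReal_pos (Metric.measure_closedBall_pos _ _ one_pos).ne' ?_
    exact measure_closedBall_lt_top.ne
  have hvol : ∀ R : ℝ, 0 ≤ R → volume.real (Metric.closedBall (0 : Space d) R) = R ^ d * V := by
    intro R hR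
    simp only [V, measureReal_def]
    rw [Measure.addHaar_closedBall' _ _ hR, finrank_euclideanSpace_fin, ENNReal.toReal_mul,
      ENNReal.toReal_ofReal (by positivity)]
  have key : ∀ (b : ContDiffBump (0 : Space d)) (R : ℝ), 0 < R →
      (R ^ d)⁻¹ * (∫ x in Metric.closedBall (0 : Space d) (R * b.rIn), (ρ x : ℝ)) ≤
        (R ^ d)⁻¹ * (∫ x, (ρ x : ℝ) * b (R⁻¹ • x)) ∧
      (R ^ d)⁻¹ * (∫ x, (ρ x : ℝ) * b (R⁻¹ • x)) ≤
        (R ^ d)⁻¹ * (∫ x in Metric.closedBall (0 : Space d) (R * b.rOut), (ρ x : ℝ)) := by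
    intro b R hR
    have hn : ∀ x : Space d, ‖R⁻¹ • x‖ = ‖x‖ / R := fun x => by
      rw [norm_smul, norm_inv, Real.norm_of_nonneg hR.le]
      field_simp
    have hi : Integrable fun x => (ρ x : ℝ) * b (R⁻¹ • x) := by
      refine integrable_mul_of_hasCompactSupport hloc
        (b.continuous.comp (continuous_const_smul R⁻¹)) ?_
      exact b.hasCompactSupport.comp_homeomorph (Homeomorph.smulOfNeZero R⁻¹ (inv_ne_zero hR.ne'))
    have hcb : ∀ r, IntegrableOn (fun x => (ρ x : ℝ)) (Metric.closedBall 0 r) := fun r =>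
      hloc.integrableOn_isCompact (isCompact_closedBall 0 r)
    have hR' : 0 ≤ (R ^ d)⁻¹ := by positivity
    refine ⟨mul_le_mul_of_nonneg_left ?_ hR', mul_le_mul_of_nonneg_left ?_ hR'⟩
    · rw [← integral_indicator measurableSet_closedBall]
      refine integral_mono ((hcb _).integrable_indicator measurableSet_closedBall) hi fun x => ?_
      refine Set.indicator_apply_le' (fun hx => ?_) fun _ => mul_nonneg (ρ x).coe_nonneg b.nonneg
      rw [b.one_of_mem_closedBall, mul_one]
      rw [mem_closedBall_zero_iff] at hx ⊢
      rw [hn, div_le_iff₀ hR]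
      linarith
    · rw [← integral_indicator measurableSet_closedBall]
      refine integral_mono hi ((hcb _).integrable_indicator measurableSet_closedBall) fun x => ?_
      refine Set.le_indicator_apply (fun _ => ?_) fun hx => ?_
      · exact mul_le_of_le_one_right (ρ x).coe_nonneg b.le_one
      · rw [mem_closedBall_zero_iff, not_le] at hx
        rw [b.zero_of_le_dist, mul_zero]
        rw [dist_zero_right, hn, le_div_iff₀ hR]
        linarith
  have hIb : ∀ b : ContDiffBump (0 : Space d), ∫ x, b x ≤ b.rOut ^ d * V ∧
      b.rIn ^ d * V ≤ ∫ x, b x := by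
    intro b
    rw [← hvol _ b.rOut_pos.le, ← hvol _ b.rIn_pos.le]
    exact ⟨b.integral_le_measure_closedBall volume, b.measure_closedBall_le_integral volume⟩
  have hA : ∀ R : ℝ, 0 < R → (volume.real (Metric.closedBall (0 : Space d) R))⁻¹ *
      ∫ x in Metric.closedBall (0 : Space d) R, (ρ x : ℝ) = V⁻¹ * ((R ^ d)⁻¹ *
        ∫ x in Metric.closedBall (0 : Space d) R, (ρ x : ℝ)) := fun R hR => by
    rw [hvol R hR.le, mul_inv, mul_comm (R ^ d)⁻¹, mul_assoc]
  have hT : ∀ b : ContDiffBump (0 : Space d), Tendsto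
      (fun R : ℝ => V⁻¹ * ((R ^ d)⁻¹ * ∫ x, (ρ x : ℝ) * b (R⁻¹ • x))) atTop
        (𝓝 (V⁻¹ * (m * ∫ x, b x))) := fun b =>
    (H.tendsto_scaled_integral ⟨b.contDiff, b.hasCompactSupport⟩).const_mul _
  have hsmall : ∀ c : ℝ, Tendsto (fun ε : ℝ => m * (1 + c * ε) ^ d) (𝓝[>] 0) (𝓝 m) := by
    intro c
    have : Continuous fun ε : ℝ => m * (1 + c * ε) ^ d := by fun_prop
    simpa using (this.tendsto 0).mono_left nhdsWithin_le_nhds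
  rw [tendsto_order]
  constructor
  · intro a ha
    obtain ⟨ε, hε, hε0, hε1⟩ := (((hsmall (-1)).eventually (lt_mem_nhds ha)).and
      (Ioo_mem_nhdsGT one_pos)).exists
    -- Outer radius one places the dilated bump below the indicator of the ball of radius `R`, and
    -- the inner radius bounds its integral from below.
    let b : ContDiffBump (0 : Space d) := ⟨1 + -1 * ε, 1, by linarith, by linarith⟩
    have hb : a < V⁻¹ * (m * ∫ x, b x) := by
      refine hε.trans_le ?_
      have h1 := mul_le_mul_of_nonneg_left (hIb b).2 hm0
      rw [inv_mul_eq_div, le_div_iff₀ hV, mul_assoc]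
      exact h1
    filter_upwards [(hT b).eventually (lt_mem_nhds hb), eventually_gt_atTop 0] with R h1 hR
    rw [hA R hR]
    refine h1.trans_le (mul_le_mul_of_nonneg_left ?_ (inv_nonneg.2 hV.le))
    simpa only [b, mul_one] using (key b R hR).2
  · intro a ha
    obtain ⟨ε, hε, hε0 : 0 < ε⟩ := (((hsmall 1).eventually (gt_mem_nhds ha)).and
      self_mem_nhdsWithin).exists
    -- Inner radius one places the dilated bump above the indicator of the ball.
    let b : ContDiffBump (0 : Space d) := ⟨1, 1 + 1 * ε, by linarith, by linarith⟩
    have hb : V⁻¹ * (m * ∫ x, b x) < a := by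
      refine lt_of_le_of_lt ?_ hε
      have h1 := mul_le_mul_of_nonneg_left (hIb b).1 hm0
      rw [inv_mul_eq_div, div_le_iff₀ hV, mul_assoc]
      exact h1
    filter_upwards [(hT b).eventually (gt_mem_nhds hb), eventually_gt_atTop 0] with R h1 hR
    rw [hA R hR]
    refine (mul_le_mul_of_nonneg_left ?_ (inv_nonneg.2 hV.le)).trans_lt h1
    simpa only [b, mul_one] using (key b R hR).1

end HasFourierMeasure

end Average


/-! ### The transition probabilities -/

section Transition

open FreeKawasaki.Configuration

/-- The function `e^{-u}` of an extended non-negative number. -/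
def expNeg (u : ℝ≥0∞) : ℝ≥0∞ := EReal.exp (-(u : EReal))

theorem continuous_expNeg : Continuous expNeg :=
  ENNReal.continuous_exp.comp (continuous_neg.comp continuous_coe_ennreal_ereal)

theorem expNeg_sum {ι : Type*} (F : Finset ι) (G : ι → ℝ≥0∞) :
    expNeg (∑ i ∈ F, G i) = ∏ i ∈ F, expNeg (G i) := by
  classical
  induction F using Finset.induction_on with
  | empty => simp [expNeg]
  | insert i F hi ih =>
    rw [Finset.sum_insert hi, Finset.prod_insert hi, ← ih, expNeg, expNeg, expNeg,
      ← EReal.exp_add, EReal.coe_ennreal_add, EReal.neg_add, sub_eq_add_neg]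
    · exact .inl (EReal.coe_ennreal_ne_bot _)
    · exact .inr (EReal.coe_ennreal_ne_bot _)

theorem expNeg_toENNReal_neg_log {q : ℝ≥0∞} (hq : q ≤ 1) :
    expNeg (-ENNReal.log q).toENNReal = q := by
  have h : 0 ≤ -ENNReal.log q := by
    rw [EReal.neg_nonneg]
    exact ENNReal.log_le_zero_iff.2 hq
  rw [expNeg, EReal.coe_toENNReal h, neg_neg, ENNReal.exp_log]

/-- Turns a product over the points of a configuration into a function of a sum over them, whose
measurability is known. Extended values accommodate vanishing factors and divergent sums. -/
theorem tprod_eq_expNeg_tsum {ι : Type*} {q : ι → ℝ≥0∞} (hq : ∀ i, q i ≤ 1) :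
    ∏' i, q i = expNeg (∑' i, (-ENNReal.log (q i)).toENNReal) := by
  rw [ENNReal.tprod_eq_iInf_prod hq]
  refine tendsto_nhds_unique (tendsto_atTop_iInf (Finset.prod_anti_set_of_le_one' hq)) ?_
  have h := (continuous_expNeg.tendsto _).comp
    (ENNReal.summable (f := fun i => (-ENNReal.log (q i)).toENNReal)).hasSum
  refine h.congr fun F => ?_
  rw [Function.comp_apply, expNeg_sum]
  exact Finset.prod_congr rfl fun i _ => expNeg_toENNReal_neg_log (hq i)

variable {d : ℕ} {a : Space d → ℝ}

namespace IsJumpRate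

theorem lintegral_jumpLaw (ha : IsJumpRate a) (t : ℝ≥0) (x : Space d) {f : Space d → ℝ≥0∞}
    (hf : Measurable f) : ∫⁻ y, f y ∂jumpLaw a t x = ∫⁻ s, f (x + s) ∂jumpLaw a t 0 := by
  rw [ha.jumpLaw_eq_map t x, lintegral_map hf (by fun_prop)]

theorem measurable_jumpLaw_apply (ha : IsJumpRate a) (t : ℝ≥0) {B : Set (Space d)}
    (hB : MeasurableSet B) : Measurable fun x => jumpLaw a t x B := by
  have := ha.isProbabilityMeasure_jumpLaw t 0
  have hm : MeasurableSet {p : Space d × Space d | p.1 + p.2 ∈ B} :=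
    measurableSet_preimage (by fun_prop) hB
  have e : ∀ x, jumpLaw a t x B = jumpLaw a t 0 (Prod.mk x ⁻¹' {p | p.1 + p.2 ∈ B}) := fun x => by
    rw [ha.jumpLaw_eq_map t x, Measure.map_apply (by fun_prop) hB]
    rfl
  simp_rw [e]
  exact measurable_measure_prodMk_left hm

end IsJumpRate

/-! ### Tame configurations and void probabilities -/

/-- The configurations for which, at time `t`, the expected number of particles in every ball is
finite. -/
def tameSet (a : Space d → ℝ) (t : ℝ≥0) : Set (Configuration d) :=
  {γ | ∀ n : ℕ, ∑' x : γ.carrier, jumpLaw a t x (Metric.closedBall 0 n) ≠ ⊤}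

namespace IsJumpRate

theorem measurableSet_tameSet (ha : IsJumpRate a) (t : ℝ≥0) : MeasurableSet (tameSet a t) := by
  have : tameSet a t = ⋂ n : ℕ, {γ : Configuration d |
      ∑' x : γ.carrier, jumpLaw a t x (Metric.closedBall 0 n) = ⊤}ᶜ := by
    ext γ
    simp [tameSet]
  rw [this]
  exact .iInter fun n => (measurable_tsum
    (ha.measurable_jumpLaw_apply t measurableSet_closedBall) (measurableSet_singleton ⊤)).compl

/-- The `μ`-mean of the expected number in a ball is an integral against `ρ`, bounded by that of a
smeared bump. This is finite because `ρ` has a tempered spectral measure. -/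
theorem ae_mem_tameSet (ha : IsJumpRate a) (t : ℝ≥0) {μ : Measure (Configuration d)}
    {ρ : Space d → ℝ≥0} (hρ : IsFirstCorrelation μ ρ) {σ : Measure (Space d)} {h : Space d → ℂ}
    (H : HasFourierMeasure (fun x => (ρ x : ℝ)) σ h) : ∀ᵐ γ ∂μ, γ ∈ tameSet a t := by
  have := ha.isProbabilityMeasure_jumpLaw t 0
  simp only [tameSet, Set.mem_ofPred_eq]
  rw [ae_all_iff]
  intro n
  have hm := ha.measurable_jumpLaw_apply t (B := Metric.closedBall (0 : Space d) n)
    measurableSet_closedBall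
  have hb0 : ∀ x, 0 ≤ ballBump d n x := fun x => (ballBump d n).nonneg
  have h1 : ∫⁻ γ, ∑' x : γ.carrier, jumpLaw a t x (Metric.closedBall 0 n) ∂μ ≠ ⊤ := by
    rw [hρ.lintegral_sum _ hm]
    refine ne_top_of_le_ne_top (H.lintegral_average_mul_lt_top hρ.measurable
      hρ.locallyIntegrable (IsTest.ballBump d n) hb0 (jumpLaw a t 0)).ne
      (lintegral_mono fun x => ?_)
    gcongr
    rw [average, ← ha.lintegral_jumpLaw t x
      (f := fun y => ENNReal.ofReal (ballBump d n y))
      (IsTest.ballBump d n).contDiff.continuous.measurable.ennreal_ofReal,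
      ← lintegral_indicator_one measurableSet_closedBall]
    refine lintegral_mono fun y => Set.indicator_apply_le' (fun hy => ?_) fun _ => zero_le
    rw [ballBump_eq_one]
    · simp
    · rw [mem_closedBall_zero_iff] at hy
      linarith
  filter_upwards [ae_lt_top (measurable_tsum hm) h1] with γ hγ using hγ.ne

variable [NeZero d] {t : ℝ≥0} {γ : Configuration d}

theorem ae_isGoodFamily (ha : IsJumpRate a) (hγ : γ ∈ tameSet a t) :
    ∀ᵐ y ∂Measure.infinitePi fun x : γ.carrier => jumpLaw a t x, IsGoodFamily y := by
  have := fun x => ha.isProbabilityMeasure_jumpLaw t x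
  filter_upwards [ae_injective_infinitePi (fun x : γ.carrier => jumpLaw a t x) fun i j hij =>
    ha.jumpLaw_prod_diagonal t (Subtype.coe_injective.ne hij),
    ae_finite_infinitePi (fun x : γ.carrier => jumpLaw a t x) hγ] with y h1 h2 using ⟨h1, h2⟩

theorem aemeasurable_ofFamily (ha : IsJumpRate a) (hγ : γ ∈ tameSet a t) :
    AEMeasurable (ofFamily : (γ.carrier → Space d) → Configuration d)
      (Measure.infinitePi fun x : γ.carrier => jumpLaw a t x) := by
  refine aemeasurable_of_hasSum_pairing (y := fun i y => y i) (s := fun _ => Set.univ)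
    (fun i => measurable_pi_apply i) (fun _ => .univ) ?_
  filter_upwards [ha.ae_isGoodFamily hγ] with y hy f
  simpa using hy.hasSum_pairing f.hasCompactSupport

theorem isProbabilityMeasure_transitionLaw (ha : IsJumpRate a) (hγ : γ ∈ tameSet a t) :
    IsProbabilityMeasure (transitionLaw a t γ) := by
  have := fun x => ha.isProbabilityMeasure_jumpLaw t x
  exact Measure.isProbabilityMeasure_map (ha.aemeasurable_ofFamily hγ)

/-- Almost surely the moved configuration misses `B` exactly when every particle does, and the
particles are independent. -/
theorem transitionLaw_voidEvent (ha : IsJumpRate a) (hγ : γ ∈ tameSet a t) {B : Set (Space d)}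
    (hB : MeasurableSet B) :
    transitionLaw a t γ (voidEvent B) =
      expNeg (∑' x : γ.carrier, (-ENNReal.log (jumpLaw a t x Bᶜ)).toENNReal) := by
  have := fun x => ha.isProbabilityMeasure_jumpLaw t x
  rw [transitionLaw, Measure.map_apply_of_aemeasurable (ha.aemeasurable_ofFamily hγ)
    (measurableSet_voidEvent hB), ← tprod_eq_expNeg_tsum fun _ => prob_le_one,
    ← Measure.infinitePi_pi_univ _ fun _ => hB.compl]
  refine measure_congr ?_
  filter_upwards [ha.ae_isGoodFamily hγ] with y hy
  refine propext ?_
  change Disjoint (ofFamily y).carrier B ↔ y ∈ Set.univ.pi fun _ => Bᶜ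
  rw [hy.carrier_ofFamily, Set.disjoint_left]
  exact ⟨fun h i _ => h ⟨i, rfl⟩, by rintro h _ ⟨i, rfl⟩; exact h i trivial⟩

end IsJumpRate

/-! ### Measurability of the transition kernel -/

open scoped Classical in
/-- The transition probability, replaced by a point mass outside the tame configurations. -/
def tameLaw (a : Space d → ℝ) (t : ℝ≥0) (γ : Configuration d) : Measure (Configuration d) :=
  if γ ∈ tameSet a t then transitionLaw a t γ else Measure.dirac (empty d)

/-- Allows the transition law to be replaced, off a null set, by an everywhere measurable
probability kernel. -/
theorem oneDimLaw_eq_bind_tameLaw {μ : Measure (Configuration d)} {t : ℝ≥0}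
    (h : ∀ᵐ γ ∂μ, γ ∈ tameSet a t) :
    oneDimLaw a μ t = μ.bind (tameLaw a t) := by
  refine Measure.bind_congr_right ?_
  filter_upwards [h] with γ hγ
  rw [tameLaw, if_pos hγ]

namespace IsJumpRate

variable [NeZero d]

theorem isProbabilityMeasure_tameLaw (ha : IsJumpRate a) (t : ℝ≥0) (γ : Configuration d) :
    IsProbabilityMeasure (tameLaw a t γ) := by
  rw [tameLaw]
  split_ifs with h
  · exact ha.isProbabilityMeasure_transitionLaw h
  · infer_instance

/-- Void events form a generating π-system, and on tame configurations their probabilities are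
continuous functions of measurable sums over `γ`. -/
theorem measurable_tameLaw (ha : IsJumpRate a) (t : ℝ≥0) : Measurable (tameLaw a t) := by
  classical
  have := ha.isProbabilityMeasure_tameLaw t
  refine Measurable.measure_of_isPiSystem_of_isProbabilityMeasure
    eq_generateFrom_voidEvent isPiSystem_voidEvent ?_
  rintro _ ⟨B, hB, rfl⟩
  have e : (fun γ => tameLaw a t γ (voidEvent B)) = fun γ => if γ ∈ tameSet a t then
      expNeg (∑' x : γ.carrier, (-ENNReal.log (jumpLaw a t x Bᶜ)).toENNReal)
      else Measure.dirac (empty d) (voidEvent B) := by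
    funext γ
    simp only [tameLaw]
    split_ifs with h
    · exact ha.transitionLaw_voidEvent h hB
    · rfl
  rw [e]
  refine Measurable.ite (ha.measurableSet_tameSet t) ?_ measurable_const
  refine continuous_expNeg.measurable.comp
    (measurable_tsum (G := fun x => (-ENNReal.log (jumpLaw a t x Bᶜ)).toENNReal) ?_)
  have h1 : Measurable fun u : ℝ≥0∞ => (-ENNReal.log u).toENNReal := by fun_prop
  exact h1.comp (ha.measurable_jumpLaw_apply t hB.compl)

variable {μ : Measure (Configuration d)} {t : ℝ≥0}

theorem isProbabilityMeasure_oneDimLaw [IsProbabilityMeasure μ] (ha : IsJumpRate a)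
    (h : ∀ᵐ γ ∂μ, γ ∈ tameSet a t) :
    IsProbabilityMeasure (oneDimLaw a μ t) := by
  rw [oneDimLaw_eq_bind_tameLaw h]
  exact isProbabilityMeasure_bind (ha.measurable_tameLaw t).aemeasurable
    (.of_forall (ha.isProbabilityMeasure_tameLaw t))

end IsJumpRate

end Transition


/-! ### Second moments of linear statistics -/

section SecondMoment

open FreeKawasaki.Configuration

theorem tsum_sq_eq {ι : Type*} (G : ι → ℝ≥0∞) :
    (∑' i, G i) ^ 2 = ∑' p : {p : ι × ι // p.1 ≠ p.2}, G p.1.1 * G p.1.2 + ∑' i, G i ^ 2 := by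
  classical
  have h1 : (∑' i, G i) ^ 2 = ∑' p : ι × ι, G p.1 * G p.2 := by
    rw [ENNReal.tsum_prod (f := fun x y => G x * G y), sq, ← ENNReal.tsum_mul_right]
    exact tsum_congr fun x => ENNReal.tsum_mul_left.symm
  have h2 : ∀ p : ι × ι, G p.1 * G p.2 =
      {p : ι × ι | p.1 ≠ p.2}.indicator (fun p => G p.1 * G p.2) p +
        if p.2 = p.1 then G p.1 ^ 2 else 0 := by
    rintro ⟨x, y⟩
    by_cases h : x = y
    · simp [h, sq]
    · simp [h, Ne.symm h]
  rw [h1, tsum_congr h2, ENNReal.tsum_add, ← tsum_subtype,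
    ENNReal.tsum_prod (f := fun x y => if y = x then G x ^ 2 else 0)]
  congr 1
  exact tsum_congr fun x => tsum_ite_eq x fun _ => G x ^ 2

variable {d : ℕ} {μ : Measure (Configuration d)} {ρ : Space d → ℝ≥0}
  {k : Space d × Space d → ℝ≥0}

theorem coe_le_enorm_ursell_add (ρ : Space d → ℝ≥0) (k : Space d × Space d → ℝ≥0)
    (x y : Space d) : (k (x, y) : ℝ≥0∞) ≤ ‖ursell ρ k x y‖ₑ + ρ x * ρ y := by
  have h : (k (x, y) : ℝ) = ursell ρ k x y + (ρ x * ρ y : ℝ≥0) := by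
    simp [ursell]
  have h2 : (k (x, y) : ℝ≥0∞) = ‖(k (x, y) : ℝ)‖ₑ := by simp
  rw [h2, h]
  refine (enorm_add_le _ _).trans (le_of_eq ?_)
  simp

/-- The product part of `k` gives the squared mean. In the Ursell and diagonal terms one factor `G`
is bounded by `M`, so the excess vanishes with `M` while the rest stays bounded. -/
theorem lintegral_tsum_sq_le (hρ : IsFirstCorrelation μ ρ) (hk : IsSecondCorrelation μ k)
    {C : ℝ≥0} (hC : ∀ x, ∫⁻ y, ‖ursell ρ k x y‖ₑ ≤ C) {G : Space d → ℝ≥0∞} (hG : Measurable G)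
    {M : ℝ≥0∞} (hM : ∀ x, G x ≤ M) :
    ∫⁻ γ, (∑' x : γ.carrier, G x) ^ 2 ∂μ ≤
      (∫⁻ x, G x * ρ x) ^ 2 + M * (C * (∫⁻ x, G x) + ∫⁻ x, G x * ρ x) := by
  have hρm := hρ.measurable
  have hkm := hk.measurable
  have hum : Measurable fun p : Space d × Space d => ‖ursell ρ k p.1 p.2‖ₑ := by
    unfold ursell
    fun_prop
  simp_rw [tsum_sq_eq]
  have hG2 : Measurable fun x => G x ^ 2 := by fun_prop
  rw [lintegral_add_right _ (measurable_tsum hG2), hρ.lintegral_sum _ hG2,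
    hk.lintegral_sum (fun p => G p.1 * G p.2) (by fun_prop), mul_add, ← add_assoc]
  refine add_le_add ?_ ?_
  · calc ∫⁻ p, G p.1 * G p.2 * k p
        ≤ ∫⁻ p : Space d × Space d, ((G p.1 * ρ p.1) * (G p.2 * ρ p.2) +
            M * (G p.1 * ‖ursell ρ k p.1 p.2‖ₑ)) := by
          refine lintegral_mono fun p => ?_
          calc G p.1 * G p.2 * (k p : ℝ≥0∞)
              ≤ G p.1 * G p.2 * (‖ursell ρ k p.1 p.2‖ₑ + ρ p.1 * ρ p.2) := by
                gcongr
                exact coe_le_enorm_ursell_add ρ k p.1 p.2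
            _ = (G p.1 * ρ p.1) * (G p.2 * ρ p.2) +
                G p.2 * (G p.1 * ‖ursell ρ k p.1 p.2‖ₑ) := by ring
            _ ≤ _ := by gcongr; exact hM _
      _ = (∫⁻ x, G x * ρ x) ^ 2 + M * ∫⁻ x, G x * ∫⁻ y, ‖ursell ρ k x y‖ₑ := by
          rw [lintegral_add_left (by fun_prop), lintegral_const_mul _ (by fun_prop), sq,
            Measure.volume_eq_prod, lintegral_prod_mul (f := fun x => G x * ρ x)
              (g := fun x => G x * ρ x) (by fun_prop) (by fun_prop),
            lintegral_prod _ (by fun_prop)]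
          congr 2
          refine lintegral_congr fun x => ?_
          have hx : Measurable fun y => ‖ursell ρ k x y‖ₑ := hum.comp measurable_prodMk_left
          exact lintegral_const_mul (G x) hx
      _ ≤ _ := by
          gcongr
          rw [← lintegral_const_mul _ hG]
          refine lintegral_mono fun x => ?_
          rw [mul_comm]
          gcongr
          exact hC x
  · rw [← lintegral_const_mul _ (by fun_prop)]
    refine lintegral_mono fun x => ?_
    rw [sq, mul_assoc]
    gcongr
    exact hM x

theorem tendsto_lintegral_enorm_sub [IsProbabilityMeasure μ] {ι : Type*} {l : Filter ι}
    {S : ι → Configuration d → ℝ≥0∞} (hS : ∀ i, Measurable (S i)) {c : ℝ}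
    {E δ : ι → ℝ≥0∞} (hE : ∀ i, ∫⁻ γ, S i γ ∂μ = E i) (hE' : ∀ i, E i ≠ ⊤)
    (hlim : Tendsto E l (𝓝 (ENNReal.ofReal c))) (hc : 0 ≤ c)
    (hS2 : ∀ i, ∫⁻ γ, S i γ ^ 2 ∂μ ≤ E i ^ 2 + δ i) (hδ' : ∀ i, δ i ≠ ⊤)
    (hδ : Tendsto δ l (𝓝 0)) :
    Tendsto (fun i => ∫⁻ γ, ‖(S i γ).toReal - c‖ₑ ∂μ) l (𝓝 0) := by
  have hSr : ∀ i, Measurable fun γ => (S i γ).toReal := fun i => (hS i).ennreal_toReal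
  have hL : ∀ i, MemLp (fun γ => (S i γ).toReal) 2 μ := by
    intro i
    refine (memLp_two_iff_integrable_sq (hSr i).aestronglyMeasurable).2 ?_
    have : (fun γ => (S i γ).toReal ^ 2) = fun γ => (S i γ ^ 2).toReal := by
      funext γ
      rw [ENNReal.toReal_pow]
    rw [this]
    exact integrable_toReal_of_lintegral_ne_top ((hS i).pow_const 2).aemeasurable
      (ne_top_of_le_ne_top (ENNReal.add_ne_top.2 ⟨ENNReal.pow_ne_top (hE' i), hδ' i⟩) (hS2 i))
  have hfin : ∀ i, ∀ᵐ γ ∂μ, S i γ < ⊤ := fun i => ae_lt_top (hS i) (by rw [hE]; exact hE' i)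
  have hI1 : ∀ i, ∫ γ, (S i γ).toReal ∂μ = (E i).toReal := fun i => by
    rw [integral_toReal (hS i).aemeasurable (hfin i), hE]
  have hI2 : ∀ i, ∫ γ, (S i γ).toReal ^ 2 ∂μ ≤ (E i).toReal ^ 2 + (δ i).toReal := by
    intro i
    simp_rw [← ENNReal.toReal_pow]
    rw [integral_toReal ((hS i).pow_const 2).aemeasurable
      ((hfin i).mono fun γ h => ENNReal.pow_lt_top h),
      ← ENNReal.toReal_add (ENNReal.pow_ne_top (hE' i)) (hδ' i)]
    exact ENNReal.toReal_mono (ENNReal.add_ne_top.2 ⟨ENNReal.pow_ne_top (hE' i), hδ' i⟩) (hS2 i)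
  have hbound : ∀ i, ∫ γ, |(S i γ).toReal - c| ∂μ ≤
      √(((E i).toReal - c) ^ 2 + (δ i).toReal) := by
    intro i
    have hY : MemLp (fun γ => |(S i γ).toReal - c|) 2 μ := ((hL i).sub (memLp_const c)).abs
    refine Real.le_sqrt_of_sq_le ?_
    -- Non-negative variance is the Cauchy–Schwarz step from `L²` to `L¹`.
    have h1 := variance_nonneg (fun γ => |(S i γ).toReal - c|) μ
    rw [variance_eq_sub hY] at h1
    have h2 : ∫ γ, ((fun γ => |(S i γ).toReal - c|) ^ 2) γ ∂μ ≤
        ((E i).toReal - c) ^ 2 + (δ i).toReal := by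
      simp only [Pi.pow_apply, sq_abs, sub_sq]
      have i1 : Integrable (fun γ => (S i γ).toReal) μ := (hL i).integrable one_le_two
      have i2 : Integrable (fun γ => (S i γ).toReal ^ 2) μ := (hL i).integrable_sq
      have i3 : Integrable (fun γ => 2 * (S i γ).toReal * c) μ := (i1.const_mul 2).mul_const c
      have i4 : Integrable (fun γ => (S i γ).toReal ^ 2 - 2 * (S i γ).toReal * c) μ := i2.sub i3
      rw [integral_add i4 (integrable_const _), integral_sub i2 i3,
        integral_mul_const, integral_const_mul, hI1]
      simp only [integral_const, probReal_univ, one_smul]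
      linarith [hI2 i]
    linarith
  have hlim0 : Tendsto (fun i => √(((E i).toReal - c) ^ 2 + (δ i).toReal)) l (𝓝 0) := by
    have h1 : Tendsto (fun i => (E i).toReal) l (𝓝 c) := by
      have := (ENNReal.tendsto_toReal ENNReal.ofReal_ne_top).comp hlim
      rwa [ENNReal.toReal_ofReal hc] at this
    have h2 : Tendsto (fun i => (δ i).toReal) l (𝓝 0) :=
      (ENNReal.tendsto_toReal ENNReal.zero_ne_top).comp hδ
    have h3 := (((h1.sub_const c).pow 2).add h2).sqrt
    simpa using h3
  have h3 : Tendsto (fun i => ENNReal.ofReal (√(((E i).toReal - c) ^ 2 + (δ i).toReal))) l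
      (𝓝 0) := by simpa using ENNReal.tendsto_ofReal hlim0
  refine tendsto_of_tendsto_of_tendsto_of_le_of_le tendsto_const_nhds h3 (fun _ => zero_le)
    fun i => ?_
  have h4 : ∫⁻ γ, ‖(S i γ).toReal - c‖ₑ ∂μ = ENNReal.ofReal (∫ γ, |(S i γ).toReal - c| ∂μ) := by
    rw [ofReal_integral_eq_lintegral_ofReal]
    · simp only [← Real.norm_eq_abs, ofReal_norm]
    · exact (((hL i).integrable one_le_two).sub (integrable_const c)).abs
    · exact .of_forall fun _ => abs_nonneg _
  simp only [h4]
  exact ENNReal.ofReal_le_ofReal (hbound i)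

end SecondMoment


/-! ### Linear statistics of smeared configurations -/

section LinearStatistics

open FreeKawasaki.Configuration

variable {d : ℕ} {g : Space d → ℝ}

theorem exists_average_bound [NeZero d] {ι : Type*} {l : Filter ι} [l.IsCountablyGenerated]
    (hc : Continuous g) (hg : HasCompactSupport g) (h0 : ∀ x, 0 ≤ g x)
    {ν : ι → Measure (Space d)} (hν : ∀ i, IsProbabilityMeasure (ν i))
    (hlim : ∀ ξ, ξ ≠ 0 → Tendsto (fun i => charFun (ν i) ξ) l (𝓝 0)) :
    ∃ M : ι → ℝ≥0∞, Tendsto M l (𝓝 0) ∧ (∀ i, M i ≠ ⊤) ∧ ∀ i x, average (ν i) g x ≤ M i := by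
  obtain ⟨n, hn⟩ := exists_isTest_approx hc hg
  obtain ⟨q, hq, hgq⟩ := hn 1 one_pos
  obtain ⟨η, hη, hle⟩ := hq.exists_tendsto_zero_bound hν hlim
  refine ⟨fun i => ENNReal.ofReal (η i), by simpa using ENNReal.tendsto_ofReal hη,
    fun i => ENNReal.ofReal_ne_top, fun i x => ?_⟩
  have hi : Integrable (fun s => q (x + s)) (ν i) := by
    have hqc : Continuous fun s => q (x + s) := hq.contDiff.continuous.comp (by fun_prop)
    have hqs : HasCompactSupport fun s => q (x + s) :=
      hq.hasCompactSupport.comp_homeomorph (Homeomorph.addLeft x)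
    exact hqc.integrable_of_hasCompactSupport hqs
  refine (average_mono _ (fun y => (hgq y).1) x).trans ?_
  rw [average, ← ofReal_integral_eq_lintegral_ofReal hi
    (.of_forall fun s => (h0 _).trans (hgq _).1)]
  exact ENNReal.ofReal_le_ofReal ((le_abs_self _).trans (hle i x))

namespace HasFourierMeasure

variable {ρ : Space d → ℝ≥0} {σ : Measure (Space d)} {h : Space d → ℂ}

theorem lintegral_average_mul_ne_top (H : HasFourierMeasure (fun x => (ρ x : ℝ)) σ h)
    (hm : Measurable ρ) (hloc : LocallyIntegrable fun x => (ρ x : ℝ)) (hc : Continuous g)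
    (hg : HasCompactSupport g) (h0 : ∀ x, 0 ≤ g x) (ν : Measure (Space d))
    [IsProbabilityMeasure ν] : ∫⁻ x, average ν g x * ρ x ≠ ⊤ := by
  obtain ⟨n, hn⟩ := exists_isTest_approx hc hg
  obtain ⟨q, hq, hgq⟩ := hn 1 one_pos
  refine ne_top_of_le_ne_top (H.lintegral_average_mul_lt_top hm hloc hq
    (fun x => (h0 x).trans (hgq x).1) ν).ne (lintegral_mono fun x => ?_)
  gcongr
  exact average_mono _ (fun y => (hgq y).1) x

end HasFourierMeasure

/-- The linear statistic of the function `x ↦ ∫ g (x + s) ν(ds)`, written as a difference of sums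
of non-negative terms. -/
def linStat (ν : Measure (Space d)) (g : Space d → ℝ) (γ : Configuration d) : ℝ :=
  (∑' x : γ.carrier, average ν g x).toReal - (∑' x : γ.carrier, average ν (fun y => -g y) x).toReal

theorem measurable_linStat (ν : Measure (Space d)) [SFinite ν] (hg : Measurable g) :
    Measurable (linStat ν g) :=
  (measurable_tsum (measurable_average ν hg)).ennreal_toReal.sub
    (measurable_tsum (measurable_average ν hg.neg)).ennreal_toReal

theorem average_max_zero (ν : Measure (Space d)) (g : Space d → ℝ) :
    average ν (fun x => max (g x) 0) = average ν g := by
  funext x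
  refine lintegral_congr fun s => ?_
  rcases le_total (g (x + s)) 0 with h | h <;> simp [h]

section Convergence

variable {μ : Measure (Configuration d)} [IsProbabilityMeasure μ] {ρ : Space d → ℝ≥0}
  {k : Space d × Space d → ℝ≥0} {σ : Measure (Space d)} {h : Space d → ℂ} [NeZero d] {ι : Type*}
  {l : Filter ι} [l.IsCountablyGenerated] {ν : ι → Measure (Space d)}

theorem tendsto_lintegral_tsum_average_sub (hρ : IsFirstCorrelation μ ρ)
    (hk : IsSecondCorrelation μ k) {C : ℝ≥0} (hC : ∀ x, ∫⁻ y, ‖ursell ρ k x y‖ₑ ≤ C)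
    (H : HasFourierMeasure (fun x => (ρ x : ℝ)) σ h) (hν : ∀ i, IsProbabilityMeasure (ν i))
    (hlim : ∀ ξ, ξ ≠ 0 → Tendsto (fun i => charFun (ν i) ξ) l (𝓝 0))
    (hc : Continuous g) (hg : HasCompactSupport g) (h0 : ∀ x, 0 ≤ g x) :
    Tendsto (fun i => ∫⁻ γ, ‖(∑' x : γ.carrier, average (ν i) g x).toReal -
      atomAtZero σ h * ∫ x, g x‖ₑ ∂μ) l (𝓝 0) := by
  obtain ⟨M, hM0, hMt, hM⟩ := exists_average_bound hc hg h0 hν hlim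
  have hm : ∀ i, Measurable (average (ν i) g) := fun i => measurable_average _ hc.measurable
  have hEt : ∀ i, ∫⁻ x, average (ν i) g x * ρ x ≠ ⊤ := fun i =>
    H.lintegral_average_mul_ne_top hρ.measurable hρ.locallyIntegrable hc hg h0 (ν i)
  have hE := H.tendsto_lintegral_average_mul hρ.measurable hρ.locallyIntegrable hc hg h0 hν hlim
  have hgt : ∫⁻ x, ENNReal.ofReal (g x) ≠ ⊤ := by
    rw [← ofReal_integral_eq_lintegral_ofReal (hc.integrable_of_hasCompactSupport hg)
      (.of_forall h0)]
    exact ENNReal.ofReal_ne_top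
  refine tendsto_lintegral_enorm_sub (fun i => measurable_tsum (hm i))
    (fun i => hρ.lintegral_sum _ (hm i)) hEt hE
    (mul_nonneg H.atomAtZero_nonneg (integral_nonneg h0))
    -- Smearing preserves the Lebesgue integral and the integral against `ρ` converges, so the
    -- bracket stays bounded while `M i` tends to zero.
    (δ := fun i => M i * (C * (∫⁻ x, ENNReal.ofReal (g x)) + ∫⁻ x, average (ν i) g x * ρ x))
    (fun i => ?_) (fun i => ?_) ?_
  · rw [← lintegral_average (ν i) hc.measurable]
    exact lintegral_tsum_sq_le hρ hk hC (hm i) (hM i)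
  · exact ENNReal.mul_ne_top (hMt i)
      (ENNReal.add_ne_top.2 ⟨ENNReal.mul_ne_top ENNReal.coe_ne_top hgt, hEt i⟩)
  · have h1 := ENNReal.Tendsto.mul hM0 (.inr (ENNReal.add_ne_top.2
      ⟨ENNReal.mul_ne_top ENNReal.coe_ne_top hgt, ENNReal.ofReal_ne_top⟩))
      (hE.const_add (C * ∫⁻ x, ENNReal.ofReal (g x))) (.inr ENNReal.zero_ne_top)
    simpa using h1

theorem tendsto_lintegral_linStat_sub (hρ : IsFirstCorrelation μ ρ)
    (hk : IsSecondCorrelation μ k) {C : ℝ≥0} (hC : ∀ x, ∫⁻ y, ‖ursell ρ k x y‖ₑ ≤ C)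
    (H : HasFourierMeasure (fun x => (ρ x : ℝ)) σ h) (hν : ∀ i, IsProbabilityMeasure (ν i))
    (hlim : ∀ ξ, ξ ≠ 0 → Tendsto (fun i => charFun (ν i) ξ) l (𝓝 0))
    (hc : Continuous g) (hg : HasCompactSupport g) :
    Tendsto (fun i => ∫⁻ γ, ‖linStat (ν i) g γ - atomAtZero σ h * ∫ x, g x‖ₑ ∂μ) l (𝓝 0) := by
  have hp : HasCompactSupport fun x => max (g x) 0 := hg.comp_left (g := fun y => max y 0) (by simp)
  have hn : HasCompactSupport fun x => max (-g x) 0 :=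
    hg.comp_left (g := fun y => max (-y) 0) (by simp)
  have hpc : Continuous fun x => max (g x) 0 := by fun_prop
  have hnc : Continuous fun x => max (-g x) 0 := by fun_prop
  have h1 := (tendsto_lintegral_tsum_average_sub hρ hk hC H hν hlim hpc hp
    fun x => le_max_right _ _).add (tendsto_lintegral_tsum_average_sub hρ hk hC H hν hlim hnc hn
    fun x => le_max_right _ _)
  rw [add_zero] at h1
  refine tendsto_of_tendsto_of_tendsto_of_le_of_le tendsto_const_nhds h1 (fun _ => zero_le)
    fun i => ?_
  have e : ∫ x, g x = (∫ x, max (g x) 0) - ∫ x, max (-g x) 0 := by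
    rw [← integral_sub (hpc.integrable_of_hasCompactSupport hp)
      (hnc.integrable_of_hasCompactSupport hn)]
    refine integral_congr_ae (.of_forall fun x => ?_)
    rcases le_total (g x) 0 with h | h <;> simp [h]
  have hmeas : Measurable fun γ : Configuration d =>
      ‖(∑' x : γ.carrier, average (ν i) (fun x => max (g x) 0) x).toReal -
        atomAtZero σ h * ∫ x, max (g x) 0‖ₑ :=
    ((measurable_tsum (measurable_average _ hpc.measurable)).ennreal_toReal.sub_const _).enorm
  simp only
  rw [← lintegral_add_left hmeas]
  refine lintegral_mono fun γ => ?_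
  rw [linStat, average_max_zero, average_max_zero (ν i) fun x => -g x, e]
  refine le_trans (le_of_eq ?_) (enorm_sub_le)
  congr 1
  ring

end Convergence

variable {a : Space d → ℝ} {t : ℝ≥0} {γ : Configuration d}

namespace IsJumpRate

theorem average_jumpLaw (ha : IsJumpRate a) (t : ℝ≥0) (hc : Measurable g) (x : Space d) :
    average (jumpLaw a t 0) g x = ∫⁻ y, ENNReal.ofReal (g y) ∂jumpLaw a t x := by
  rw [ha.lintegral_jumpLaw t x (by fun_prop)]
  rfl

theorem tsum_average_ne_top (ha : IsJumpRate a) (hγ : γ ∈ tameSet a t) (hc : Continuous g)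
    (hg : HasCompactSupport g) : ∑' x : γ.carrier, average (jumpLaw a t 0) g x ≠ ⊤ := by
  obtain ⟨C, hC⟩ := hc.bounded_above_of_compact_support hg
  obtain ⟨n, hn⟩ := exists_nat_tsupport_subset hg
  have hle : ∀ x : γ.carrier, average (jumpLaw a t 0) g x ≤
      ENNReal.ofReal C * jumpLaw a t x (Metric.closedBall 0 n) := by
    intro x
    rw [ha.average_jumpLaw t hc.measurable, ← lintegral_indicator_const measurableSet_closedBall]
    refine lintegral_mono fun y => Set.le_indicator_apply (fun _ => ?_) fun hy => ?_
    · exact ENNReal.ofReal_le_ofReal ((le_abs_self _).trans (hC y))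
    · rw [image_eq_zero_of_notMem_tsupport fun hy' => hy (hn hy')]
      simp
  refine ne_top_of_le_ne_top ?_ (ENNReal.tsum_le_tsum hle)
  rw [ENNReal.tsum_mul_left]
  exact ENNReal.mul_ne_top ENNReal.ofReal_ne_top (hγ n)

theorem integrable_jumpLaw (ha : IsJumpRate a) (t : ℝ≥0) (x : Space d) {E : Type*}
    [NormedAddCommGroup E] {f : Space d → E} (hc : Continuous f) (hf : HasCompactSupport f) :
    Integrable f (jumpLaw a t x) := by
  have := ha.isProbabilityMeasure_jumpLaw t x
  exact hc.integrable_of_hasCompactSupport hf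

/-- On a tame configuration both sums in `linStat` are finite, so `toReal` loses nothing. -/
theorem hasSum_integral_jumpLaw (ha : IsJumpRate a) (hγ : γ ∈ tameSet a t) (hc : Continuous g)
    (hg : HasCompactSupport g) :
    HasSum (fun x : γ.carrier => ∫ y, g y ∂jumpLaw a t x) (linStat (jumpLaw a t 0) g γ) := by
  have key : ∀ f : Space d → ℝ, Continuous f → HasCompactSupport f →
      HasSum (fun x : γ.carrier => (average (jumpLaw a t 0) f x).toReal)
        (∑' x : γ.carrier, average (jumpLaw a t 0) f x).toReal := by
    intro f hfc hf
    have h1 := ha.tsum_average_ne_top hγ hfc hf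
    rw [ENNReal.tsum_toReal_eq fun x => ENNReal.ne_top_of_tsum_ne_top h1 x]
    exact (ENNReal.summable_toReal h1).hasSum
  have e : (fun x : γ.carrier => ∫ y, g y ∂jumpLaw a t x) = fun x : γ.carrier =>
      (average (jumpLaw a t 0) g x).toReal - (average (jumpLaw a t 0) (fun y => -g y) x).toReal := by
    funext x
    rw [ha.average_jumpLaw t hc.measurable,
      ha.average_jumpLaw (g := fun y => -g y) t hc.measurable.neg,
      integral_eq_lintegral_pos_part_sub_lintegral_neg_part (ha.integrable_jumpLaw t x hc hg)]
  rw [e]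
  exact (key g hc hg).sub (key (fun y => -g y) hc.neg hg.neg)

end IsJumpRate

end LinearStatistics


/-! ### The characteristic functional -/

section CharFunctional

open FreeKawasaki.Configuration

theorem norm_prod_sub_prod_le_sum {ι : Type*} (F : Finset ι) {u v : ι → ℂ} (hu : ∀ i, ‖u i‖ ≤ 1)
    (hv : ∀ i, ‖v i‖ ≤ 1) : ‖∏ i ∈ F, u i - ∏ i ∈ F, v i‖ ≤ ∑ i ∈ F, ‖u i - v i‖ := by
  classical
  induction F using Finset.induction_on with
  | empty => simp
  | insert i F hi ih =>
    rw [Finset.prod_insert hi, Finset.prod_insert hi, Finset.sum_insert hi]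
    have e : u i * ∏ j ∈ F, u j - v i * ∏ j ∈ F, v j =
        (u i - v i) * ∏ j ∈ F, u j + v i * (∏ j ∈ F, u j - ∏ j ∈ F, v j) := by ring
    rw [e]
    refine (norm_add_le _ _).trans (add_le_add ?_ ?_)
    · rw [norm_mul, norm_prod]
      exact mul_le_of_le_one_right (norm_nonneg _)
        (Finset.prod_le_one (fun _ _ => norm_nonneg _) fun j _ => hu j)
    · rw [norm_mul]
      exact (mul_le_of_le_one_left (norm_nonneg _) (hv i)).trans ih

theorem norm_exp_le_one {z : ℂ} (hz : z.re ≤ 0) : ‖Complex.exp z‖ ≤ 1 := by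
  rw [Complex.norm_exp]
  exact Real.exp_le_one_iff.2 hz

/-- Taylor's formula for `‖z‖ ≤ 1`; otherwise both terms lie in the unit disc and the bound two
suffices. -/
theorem norm_one_add_sub_exp_le {z : ℂ} (h1 : ‖1 + z‖ ≤ 1) (hz : z.re ≤ 0) :
    ‖1 + z - Complex.exp z‖ ≤ 2 * ‖z‖ ^ 2 := by
  rcases le_total ‖z‖ 1 with h | h
  · rw [norm_sub_rev, ← sub_sub]
    refine (Complex.norm_exp_sub_one_sub_id_le h).trans ?_
    linarith [sq_nonneg ‖z‖]
  · refine (norm_sub_le _ _).trans ?_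
    have := norm_exp_le_one hz
    nlinarith

/-- Mean value inequality on the convex half-plane where the derivative of `exp` has modulus at most
one. -/
theorem norm_exp_sub_exp_le {z w : ℂ} (hz : z.re ≤ 0) (hw : w.re ≤ 0) :
    ‖Complex.exp z - Complex.exp w‖ ≤ ‖z - w‖ := by
  have hconv : Convex ℝ {z : ℂ | z.re ≤ 0} := convex_halfSpace_re_le 0
  have h := hconv.norm_image_sub_le_of_norm_deriv_le (f := Complex.exp) (C := 1)
    (fun x _ => Complex.differentiableAt_exp) (fun x hx => ?_) hw hz
  · simpa using h
  · rw [Complex.deriv_exp]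
    exact norm_exp_le_one hx

variable {d : ℕ} {a : Space d → ℝ} {t : ℝ≥0} {γ : Configuration d}

/-- The function `e^{if} - 1`. -/
def expSubOne (f : Space d → ℝ) (x : Space d) : ℂ := Complex.exp (f x * Complex.I) - 1

theorem continuous_expSubOne (f : C_c(Space d, ℝ)) : Continuous (expSubOne f) := by
  have := f.continuous
  unfold expSubOne
  fun_prop

theorem hasCompactSupport_expSubOne (f : C_c(Space d, ℝ)) : HasCompactSupport (expSubOne f) :=
  f.hasCompactSupport.comp_left (g := fun y : ℝ => Complex.exp (y * Complex.I) - 1) (by simp)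

theorem re_expSubOne (f : Space d → ℝ) (x : Space d) : (expSubOne f x).re = Real.cos (f x) - 1 := by
  simp [expSubOne, Complex.exp_ofReal_mul_I_re]

theorem im_expSubOne (f : Space d → ℝ) (x : Space d) : (expSubOne f x).im = Real.sin (f x) := by
  simp [expSubOne, Complex.exp_ofReal_mul_I_im]

theorem continuous_cos_sub_one (f : C_c(Space d, ℝ)) : Continuous fun x => Real.cos (f x) - 1 := by
  have := f.continuous
  fun_prop

theorem hasCompactSupport_cos_sub_one (f : C_c(Space d, ℝ)) :
    HasCompactSupport fun x => Real.cos (f x) - 1 :=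
  f.hasCompactSupport.comp_left (g := fun y : ℝ => Real.cos y - 1) (by simp)

theorem continuous_sin_comp (f : C_c(Space d, ℝ)) : Continuous fun x => Real.sin (f x) := by
  have := f.continuous
  fun_prop

theorem hasCompactSupport_sin_comp (f : C_c(Space d, ℝ)) :
    HasCompactSupport fun x => Real.sin (f x) :=
  f.hasCompactSupport.comp_left (g := fun y : ℝ => Real.sin y) (by simp)

namespace IsJumpRate

theorem re_integral_expSubOne (ha : IsJumpRate a) (f : C_c(Space d, ℝ)) (x : Space d) :
    (∫ y, expSubOne f y ∂jumpLaw a t x).re = ∫ y, (Real.cos (f y) - 1) ∂jumpLaw a t x := by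
  have h := integral_re (ha.integrable_jumpLaw t x (continuous_expSubOne f)
    (hasCompactSupport_expSubOne f))
  simpa [re_expSubOne] using h.symm

theorem im_integral_expSubOne (ha : IsJumpRate a) (f : C_c(Space d, ℝ)) (x : Space d) :
    (∫ y, expSubOne f y ∂jumpLaw a t x).im = ∫ y, Real.sin (f y) ∂jumpLaw a t x := by
  have h := integral_im (ha.integrable_jumpLaw t x (continuous_expSubOne f)
    (hasCompactSupport_expSubOne f))
  simpa [im_expSubOne] using h.symm

theorem re_integral_expSubOne_nonpos (ha : IsJumpRate a) (f : C_c(Space d, ℝ)) (x : Space d) :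
    (∫ y, expSubOne f y ∂jumpLaw a t x).re ≤ 0 := by
  rw [ha.re_integral_expSubOne]
  exact integral_nonpos fun y => by simpa using Real.cos_le_one (f y)

theorem one_add_integral_expSubOne (ha : IsJumpRate a) (f : C_c(Space d, ℝ)) (x : Space d) :
    1 + ∫ y, expSubOne f y ∂jumpLaw a t x = ∫ y, Complex.exp (f y * Complex.I) ∂jumpLaw a t x := by
  have := ha.isProbabilityMeasure_jumpLaw t x
  have h := integral_add (integrable_const (1 : ℂ))
    (ha.integrable_jumpLaw t x (continuous_expSubOne f) (hasCompactSupport_expSubOne f))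
  simp only [integral_const, probReal_univ, one_smul] at h
  rw [← h]
  simp [expSubOne]

theorem norm_one_add_integral_expSubOne_le (ha : IsJumpRate a) (f : C_c(Space d, ℝ))
    (x : Space d) : ‖1 + ∫ y, expSubOne f y ∂jumpLaw a t x‖ ≤ 1 := by
  have := ha.isProbabilityMeasure_jumpLaw t x
  rw [ha.one_add_integral_expSubOne]
  refine (norm_integral_le_of_norm_le_const (C := 1) (.of_forall fun y => ?_)).trans (by simp)
  rw [Complex.norm_exp_ofReal_mul_I]

theorem enorm_integral_expSubOne_le (ha : IsJumpRate a) (f : C_c(Space d, ℝ)) (x : Space d) :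
    ‖∫ y, expSubOne f y ∂jumpLaw a t x‖ₑ ≤
      average (jumpLaw a t 0) (fun y => ‖expSubOne f y‖) x := by
  rw [ha.average_jumpLaw t (continuous_expSubOne f).norm.measurable]
  simp only [ofReal_norm]
  exact enorm_integral_le_lintegral_enorm _

theorem hasSum_integral_expSubOne (ha : IsJumpRate a) (hγ : γ ∈ tameSet a t)
    (f : C_c(Space d, ℝ)) :
    HasSum (fun x : γ.carrier => ∫ y, expSubOne f y ∂jumpLaw a t x)
      ⟨linStat (jumpLaw a t 0) (fun x => Real.cos (f x) - 1) γ,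
        linStat (jumpLaw a t 0) (fun x => Real.sin (f x)) γ⟩ := by
  rw [Complex.hasSum_iff]
  simp only [ha.re_integral_expSubOne, ha.im_integral_expSubOne]
  exact ⟨ha.hasSum_integral_jumpLaw hγ (continuous_cos_sub_one f)
    (hasCompactSupport_cos_sub_one f), ha.hasSum_integral_jumpLaw hγ (continuous_sin_comp f)
    (hasCompactSupport_sin_comp f)⟩

/-- The Poisson approximation: independence gives a product of factors `1 + w x`, each replaced by
`exp (w x)` at quadratic cost. Finite products are compared by telescoping and the bound passes to
the limit. -/
theorem enorm_integral_transitionLaw_sub_le [NeZero d] (ha : IsJumpRate a) (hγ : γ ∈ tameSet a t)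
    (f : C_c(Space d, ℝ)) {S : ℂ}
    (hS : HasSum (fun x : γ.carrier => ∫ y, expSubOne f y ∂jumpLaw a t x) S) :
    ‖∫ η, Complex.exp (pairing f η * Complex.I) ∂transitionLaw a t γ - Complex.exp S‖ₑ ≤
      2 * ∑' x : γ.carrier, ‖∫ y, expSubOne f y ∂jumpLaw a t x‖ₑ ^ 2 := by
  have := fun x => ha.isProbabilityMeasure_jumpLaw t x
  let w : γ.carrier → ℂ := fun x => ∫ y, expSubOne f y ∂jumpLaw a t x
  have hfm := f.continuous.measurable
  have hlim1 : Tendsto (fun F : Finset γ.carrier => ∏ x ∈ F, (1 + w x)) atTop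
      (𝓝 (∫ η, Complex.exp (pairing f η * Complex.I) ∂transitionLaw a t γ)) := by
    have hm : Measurable fun η : Configuration d => Complex.exp (pairing f η * Complex.I) := by
      have := (continuous_pairing f).measurable
      fun_prop
    rw [transitionLaw, integral_map (ha.aemeasurable_ofFamily hγ) hm.aestronglyMeasurable]
    have e : ∀ F : Finset γ.carrier, ∏ x ∈ F, (1 + w x) =
        ∫ y : γ.carrier → Space d, ∏ x ∈ F, Complex.exp (f (y x) * Complex.I)
          ∂Measure.infinitePi fun x : γ.carrier => jumpLaw a t x := by
      intro F
      rw [integral_infinitePi_prod (fun x : γ.carrier => jumpLaw a t x) F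
        (f := fun _ y => Complex.exp (f y * Complex.I)) fun _ => by fun_prop]
      exact Finset.prod_congr rfl fun x _ => ha.one_add_integral_expSubOne f x
    simp_rw [e]
    refine tendsto_integral_filter_of_dominated_convergence (fun _ => 1)
      (.of_forall fun F => ?_) (.of_forall fun F => .of_forall fun y => ?_) (integrable_const 1) ?_
    · exact (Finset.measurable_fun_prod _ fun x _ => by fun_prop).aestronglyMeasurable
    · rw [norm_prod]
      exact Finset.prod_le_one (fun _ _ => norm_nonneg _) fun x _ => by
        rw [Complex.norm_exp_ofReal_mul_I]
    · filter_upwards [ha.ae_isGoodFamily hγ] with y hy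
      have h1 : Tendsto (fun F : Finset γ.carrier => ∑ x ∈ F, f (y x)) atTop
          (𝓝 (pairing f (ofFamily y))) := hy.hasSum_pairing f.hasCompactSupport
      have h2 : Continuous fun u : ℝ => Complex.exp (u * Complex.I) := by fun_prop
      refine ((h2.tendsto _).comp h1).congr fun F => ?_
      rw [Function.comp_apply, Complex.ofReal_sum, Finset.sum_mul, Complex.exp_sum]
  have hlim2 : Tendsto (fun F : Finset γ.carrier => ∏ x ∈ F, Complex.exp (w x)) atTop
      (𝓝 (Complex.exp S)) := by
    refine ((Complex.continuous_exp.tendsto S).comp hS).congr fun F => ?_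
    rw [Function.comp_apply, Complex.exp_sum]
  refine le_of_tendsto (hlim1.sub hlim2).enorm (.of_forall fun F => ?_)
  have h1 : ‖∏ x ∈ F, (1 + w x) - ∏ x ∈ F, Complex.exp (w x)‖ ≤ ∑ x ∈ F, 2 * ‖w x‖ ^ 2 :=
    (norm_prod_sub_prod_le_sum F (fun x => ha.norm_one_add_integral_expSubOne_le f x)
      fun x => norm_exp_le_one (ha.re_integral_expSubOne_nonpos f x)).trans
      (Finset.sum_le_sum fun x _ => norm_one_add_sub_exp_le
        (ha.norm_one_add_integral_expSubOne_le f x) (ha.re_integral_expSubOne_nonpos f x))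
  calc ‖∏ x ∈ F, (1 + w x) - ∏ x ∈ F, Complex.exp (w x)‖ₑ
      ≤ ENNReal.ofReal (∑ x ∈ F, 2 * ‖w x‖ ^ 2) := by
        rw [← ofReal_norm]
        exact ENNReal.ofReal_le_ofReal h1
    _ = 2 * ∑ x ∈ F, ‖w x‖ₑ ^ 2 := by
        rw [ENNReal.ofReal_sum_of_nonneg fun _ _ => by positivity, Finset.mul_sum]
        refine Finset.sum_congr rfl fun x _ => ?_
        rw [ENNReal.ofReal_mul zero_le_two, ENNReal.ofReal_pow (norm_nonneg _), ofReal_norm]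
        simp
    _ ≤ _ := by
        gcongr
        exact ENNReal.sum_le_tsum F

end IsJumpRate

end CharFunctional


/-! ### Convergence of the one-dimensional distributions -/

section Convergence

open FreeKawasaki.Configuration

variable {d : ℕ} [NeZero d] {a : Space d → ℝ} {μ : Measure (Configuration d)}
  [IsProbabilityMeasure μ] {ρ : Space d → ℝ≥0} {k : Space d × Space d → ℝ≥0}
  {σ : Measure (Space d)} {h : Space d → ℂ}

theorem enorm_exp_sub_exp_le {z w : ℂ} (hz : z.re ≤ 0) (hw : w.re ≤ 0) :
    ‖Complex.exp z - Complex.exp w‖ₑ ≤ ‖z.re - w.re‖ₑ + ‖z.im - w.im‖ₑ := by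
  rw [← ofReal_norm, ← ofReal_norm, ← ofReal_norm, ← ENNReal.ofReal_add (norm_nonneg _)
    (norm_nonneg _)]
  refine ENNReal.ofReal_le_ofReal ((norm_exp_sub_exp_le hz hw).trans ?_)
  simpa using Complex.norm_le_abs_re_add_abs_im (z - w)

/-- The error has three parts: the Poisson approximation for fixed `γ`, and the `L¹(μ)` fluctuations
of the real and imaginary parts of the exponent. -/
theorem IsJumpRate.tendsto_integral_oneDimLaw (ha : IsJumpRate a) (hρ : IsFirstCorrelation μ ρ)
    (hk : IsSecondCorrelation μ k) {C : ℝ≥0} (hC : ∀ x, ∫⁻ y, ‖ursell ρ k x y‖ₑ ≤ C)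
    (H : HasFourierMeasure (fun x => (ρ x : ℝ)) σ h) (f : C_c(Space d, ℝ)) :
    Tendsto (fun t : ℝ≥0 => ∫ η, Complex.exp (pairing f η * Complex.I) ∂oneDimLaw a μ t) atTop
      (𝓝 (Complex.exp (atomAtZero σ h * ∫ x, (Complex.exp (f x * Complex.I) - 1)))) := by
  have hν : ∀ t : ℝ≥0, IsProbabilityMeasure (jumpLaw a t 0) :=
    fun t => ha.isProbabilityMeasure_jumpLaw t 0
  have hlim : ∀ ξ : Space d, ξ ≠ 0 →
      Tendsto (fun t : ℝ≥0 => charFun (jumpLaw a t 0) ξ) atTop (𝓝 0) :=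
    fun ξ hξ => ha.tendsto_charFun_jumpLaw hξ
  have htame : ∀ t, ∀ᵐ γ ∂μ, γ ∈ tameSet a t := fun t => ha.ae_mem_tameSet t hρ H
  have hm0 := H.atomAtZero_nonneg
  set m := atomAtZero σ h
  set z : ℂ := m * ∫ x, (Complex.exp (f x * Complex.I) - 1)
  have hint : Integrable (expSubOne f) := (continuous_expSubOne f).integrable_of_hasCompactSupport
    (hasCompactSupport_expSubOne f)
  have hzre : z.re = m * ∫ x, (Real.cos (f x) - 1) := by
    have h1 := integral_re hint
    simp only [RCLike.re_to_complex, re_expSubOne] at h1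
    rw [h1, Complex.re_ofReal_mul]
    rfl
  have hzim : z.im = m * ∫ x, Real.sin (f x) := by
    have h1 := integral_im hint
    simp only [RCLike.im_to_complex, im_expSubOne] at h1
    rw [h1, Complex.im_ofReal_mul]
    rfl
  have hz0 : z.re ≤ 0 := by
    rw [hzre]
    exact mul_nonpos_of_nonneg_of_nonpos hm0
      (integral_nonpos fun x => by simpa using Real.cos_le_one (f x))
  let g : Space d → ℝ := fun x => ‖expSubOne f x‖
  have hgc : Continuous g := (continuous_expSubOne f).norm
  have hgs : HasCompactSupport g := (hasCompactSupport_expSubOne f).norm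
  obtain ⟨M, hM0, hMt, hM⟩ := exists_average_bound hgc hgs (fun x => norm_nonneg _) hν hlim
  have hT1 := tendsto_lintegral_linStat_sub hρ hk hC H hν hlim (continuous_cos_sub_one f)
    (hasCompactSupport_cos_sub_one f)
  have hT2 := tendsto_lintegral_linStat_sub hρ hk hC H hν hlim (continuous_sin_comp f)
    (hasCompactSupport_sin_comp f)
  have hE := H.tendsto_lintegral_average_mul hρ.measurable hρ.locallyIntegrable hgc hgs
    (fun x => norm_nonneg _) hν hlim
  have hT3 : Tendsto (fun t => 2 * (M t * ∫⁻ x, average (jumpLaw a t 0) g x * ρ x)) atTop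
      (𝓝 0) := by
    have h1 := ENNReal.Tendsto.mul hM0 (.inr ENNReal.ofReal_ne_top) hE (.inr ENNReal.zero_ne_top)
    have h2 := ENNReal.Tendsto.const_mul (a := 2) h1 (.inr (by simp))
    simpa using h2
  have hT := (hT3.add hT1).add hT2
  simp only [add_zero] at hT
  rw [tendsto_iff_edist_tendsto_0]
  refine tendsto_of_tendsto_of_tendsto_of_le_of_le tendsto_const_nhds hT (fun _ => zero_le)
    fun t => ?_
  have hp := ha.isProbabilityMeasure_tameLaw t
  have hκ := ha.measurable_tameLaw t
  have hfm : StronglyMeasurable fun η : Configuration d =>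
      Complex.exp (pairing f η * Complex.I) := by
    have := (continuous_pairing f).measurable
    exact Measurable.stronglyMeasurable (by fun_prop)
  have hf1 : ∀ η : Configuration d, ‖Complex.exp (pairing f η * Complex.I)‖ ≤ 1 := fun η => by
    rw [Complex.norm_exp_ofReal_mul_I]
  have hint' : Integrable (fun γ => ∫ η, Complex.exp (pairing f η * Complex.I) ∂tameLaw a t γ)
      μ := by
    let K : Kernel (Configuration d) (Configuration d) := ⟨tameLaw a t, hκ⟩
    have hK : IsMarkovKernel K := ⟨hp⟩
    refine Integrable.of_bound (C := 1) ?_ (.of_forall fun γ => ?_)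
    · exact (hfm.integral_kernel (κ := K)).aestronglyMeasurable
    · exact (norm_integral_le_of_norm_le_const (.of_forall hf1)).trans (by simp)
  simp only
  rw [oneDimLaw_eq_bind_tameLaw (htame t), integral_bind_of_norm_le hκ hp hfm hf1,
    edist_eq_enorm_sub]
  have e : ∫ γ, ∫ η, Complex.exp (pairing f η * Complex.I) ∂tameLaw a t γ ∂μ - Complex.exp z =
      ∫ γ, (∫ η, Complex.exp (pairing f η * Complex.I) ∂tameLaw a t γ - Complex.exp z) ∂μ := by
    rw [integral_sub hint' (integrable_const _)]
    simp
  rw [e]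
  refine (enorm_integral_le_lintegral_enorm _).trans ?_
  have hgm := measurable_average (jumpLaw a t 0) hgc.measurable
  have hmeas1 : Measurable fun γ : Configuration d =>
      2 * (M t * ∑' x : γ.carrier, average (jumpLaw a t 0) g x) :=
    ((measurable_tsum hgm).const_mul _).const_mul _
  have hmeas2 : Measurable fun γ : Configuration d =>
      ‖linStat (jumpLaw a t 0) (fun x => Real.cos (f x) - 1) γ -
        m * ∫ x, (Real.cos (f x) - 1)‖ₑ :=
    ((measurable_linStat _ (continuous_cos_sub_one f).measurable).sub_const _).enorm
  have hmeas12 : Measurable fun γ : Configuration d =>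
      2 * (M t * ∑' x : γ.carrier, average (jumpLaw a t 0) g x) +
        ‖linStat (jumpLaw a t 0) (fun x => Real.cos (f x) - 1) γ -
          m * ∫ x, (Real.cos (f x) - 1)‖ₑ := hmeas1.add hmeas2
  rw [← hρ.lintegral_sum _ hgm, ← lintegral_const_mul _ (measurable_tsum hgm),
    ← lintegral_const_mul _ ((measurable_tsum hgm).const_mul _), ← lintegral_add_left hmeas1,
    ← lintegral_add_left hmeas12]
  refine lintegral_mono_ae ?_
  filter_upwards [htame t] with γ hγ
  rw [tameLaw, if_pos hγ]
  have hS := ha.hasSum_integral_expSubOne hγ f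
  have hSre : linStat (jumpLaw a t 0) (fun x => Real.cos (f x) - 1) γ ≤ 0 := by
    refine hasSum_le (fun x => ?_) (Complex.hasSum_re hS) hasSum_zero
    exact ha.re_integral_expSubOne_nonpos f x
  have h1 := ha.enorm_integral_transitionLaw_sub_le hγ f hS
  have h2 := enorm_exp_sub_exp_le (z := ⟨linStat (jumpLaw a t 0) (fun x => Real.cos (f x) - 1) γ,
    linStat (jumpLaw a t 0) (fun x => Real.sin (f x)) γ⟩) hSre hz0
  rw [hzre, hzim] at h2
  -- The intermediate term is the exponential of the random exponent, the linear statistic of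
  -- `e^{if} - 1`.
  rw [← sub_add_sub_cancel _ (Complex.exp _) (Complex.exp z), add_assoc]
  refine (enorm_add_le _ _).trans (add_le_add (h1.trans ?_) h2)
  gcongr
  rw [← ENNReal.tsum_mul_left]
  refine ENNReal.tsum_le_tsum fun x => ?_
  rw [sq]
  have h3 := ha.enorm_integral_expSubOne_le (t := t) f x
  -- One factor of the square is bounded uniformly by `M t`; the other is kept and summed over `γ`.
  exact mul_le_mul' (h3.trans (hM t x)) h3

end Convergence


/-! ### Weak convergence from convergence of the characteristic functional -/

section WeakConvergence

namespace Configuration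

variable {d : ℕ}

theorem pairing_sum_smul {ι : Type*} [Fintype ι] (f : ι → C_c(Space d, ℝ)) (s : ι → ℝ)
    (γ : Configuration d) :
    pairing (∑ i, s i • f i : C_c(Space d, ℝ)) γ = ∑ i, s i * pairing (f i) γ := by
  simp only [pairing, CompactlySupportedContinuousMap.coe_sum, Finset.sum_apply,
    CompactlySupportedContinuousMap.coe_smul, Pi.smul_apply, smul_eq_mul]
  rw [Summable.tsum_finsetSum fun i _ =>
    (γ.summable_pairing (f i).hasCompactSupport).mul_left (s i)]
  exact Finset.sum_congr rfl fun i _ => tsum_mul_left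

/-- The values of finitely many linear statistics, as a vector. -/
def evaluation {ι : Type*} (f : ι → C_c(Space d, ℝ)) (γ : Configuration d) :
    EuclideanSpace ℝ ι := WithLp.toLp 2 fun i => pairing (f i) γ

theorem continuous_evaluation {ι : Type*} (f : ι → C_c(Space d, ℝ)) :
    Continuous (evaluation f) :=
  (PiLp.continuous_toLp 2 _).comp (continuous_pi fun i => continuous_pairing (f i))

/-- Linear combinations of test functions are again test functions, so the characteristic functional
contains all finite-dimensional characteristic functions. -/
theorem charFun_map_evaluation {ι : Type*} [Fintype ι] (f : ι → C_c(Space d, ℝ))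
    (P : Measure (Configuration d)) (s : EuclideanSpace ℝ ι) :
    charFun (P.map (evaluation f)) s =
      ∫ γ, Complex.exp (pairing (∑ i, s i • f i : C_c(Space d, ℝ)) γ * Complex.I) ∂P := by
  rw [charFun_apply, integral_map (continuous_evaluation f).aemeasurable
    (Measurable.aestronglyMeasurable (by fun_prop))]
  refine integral_congr_ae (.of_forall fun γ => ?_)
  simp only [pairing_sum_smul]
  rw [PiLp.inner_apply]
  simp [evaluation]

/-- The largest subset of `U` that is the preimage of an open set under the linear statistics in
`F`. -/
def cylinderInterior {D : Set C_c(Space d, ℝ)} (U : Set (Configuration d)) (F : Finset D) :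
    Set (Configuration d) :=
  {γ | ∃ W : Set (EuclideanSpace ℝ F), IsOpen W ∧
    evaluation (fun i : F => (i : D).1) γ ∈ W ∧ evaluation (fun i : F => (i : D).1) ⁻¹' W ⊆ U}

theorem exists_isOpen_cylinderInterior {D : Set C_c(Space d, ℝ)} (U : Set (Configuration d))
    (F : Finset D) : ∃ W : Set (EuclideanSpace ℝ F), IsOpen W ∧
      cylinderInterior U F = evaluation (fun i : F => (i : D).1) ⁻¹' W := by
  refine ⟨⋃₀ {W | IsOpen W ∧ evaluation (fun i : F => (i : D).1) ⁻¹' W ⊆ U},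
    isOpen_sUnion fun W hW => hW.1, ?_⟩
  ext γ
  constructor
  · rintro ⟨W, h1, h2, h3⟩
    exact ⟨W, ⟨h1, h3⟩, h2⟩
  · rintro ⟨W, ⟨h1, h3⟩, h2⟩
    exact ⟨W, h1, h2, h3⟩

theorem monotone_cylinderInterior {D : Set C_c(Space d, ℝ)} (U : Set (Configuration d)) :
    Monotone (cylinderInterior (D := D) U) := by
  rintro F F' hF γ ⟨W, h1, h2, h3⟩
  let r : EuclideanSpace ℝ F' → EuclideanSpace ℝ F := fun w => WithLp.toLp 2 fun i => w ⟨i, hF i.2⟩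
  have hr : Continuous r := by fun_prop
  exact ⟨r ⁻¹' W, h1.preimage hr, h2, h3⟩

theorem iUnion_cylinderInterior {D : Set C_c(Space d, ℝ)}
    (hD : IsInducing fun (γ : Configuration d) (f : D) => pairing f.1 γ)
    {U : Set (Configuration d)} (hU : IsOpen U) :
    ⋃ F : Finset D, cylinderInterior U F = U := by
  refine Set.Subset.antisymm (Set.iUnion_subset fun F => ?_) fun γ hγ => ?_
  · rintro γ ⟨W, -, h2, h3⟩
    exact h3 h2
  · obtain ⟨V, hV, rfl⟩ := hD.isOpen_iff.1 hU
    obtain ⟨F, u, hu, huV⟩ := isOpen_pi_iff.1 hV _ hγ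
    refine Set.mem_iUnion.2 ⟨F, {w | ∀ i : F, w i ∈ u i}, ?_, fun i => (hu i i.2).2, ?_⟩
    · simp only [Set.ofPred_forall]
      refine isOpen_iInter_of_finite fun i => ?_
      have hi : Continuous fun w : EuclideanSpace ℝ F => w i := by fun_prop
      exact (hu i i.2).1.preimage hi
    · intro η hη
      exact huV fun i hi => hη ⟨i, hi⟩

/-- Lévy's continuity theorem gives finite-dimensional convergence, hence the portmanteau inequality
for open cylinder sets. Every open set is an increasing union of these. Since the limit measure is
given, no tightness argument is needed. -/
theorem tendsto_of_tendsto_charFunctional {ι : Type*} {l : Filter ι} [l.IsCountablyGenerated]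
    {P : ι → ProbabilityMeasure (Configuration d)} {π : ProbabilityMeasure (Configuration d)}
    (h : ∀ f : C_c(Space d, ℝ), Tendsto
      (fun i => ∫ γ, Complex.exp (pairing f γ * Complex.I) ∂(P i : Measure (Configuration d))) l
      (𝓝 (∫ γ, Complex.exp (pairing f γ * Complex.I) ∂(π : Measure (Configuration d))))) :
    Tendsto P l (𝓝 π) := by
  obtain ⟨D, hDc, hD⟩ := exists_countable_induced d
  have := hDc.to_subtype
  refine tendsto_of_seq_tendsto fun u hu => tendsto_of_forall_isOpen_le_liminf_nat' fun U hU => ?_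
  have key : ∀ F : Finset D, (π : Measure (Configuration d)) (cylinderInterior U F) ≤
      liminf (fun n => (P (u n) : Measure (Configuration d)) (cylinderInterior U F)) atTop := by
    intro F
    obtain ⟨W, hW, e⟩ := exists_isOpen_cylinderInterior U F
    let T := evaluation fun i : F => (i : D).1
    have hT : Measurable T := (continuous_evaluation _).measurable
    have hlim : Tendsto (fun n => (P (u n)).map hT.aemeasurable) atTop
        (𝓝 (π.map hT.aemeasurable)) := by
      refine ProbabilityMeasure.tendsto_of_tendsto_charFun fun s => ?_
      simp only [ProbabilityMeasure.toMeasure_map, T, charFun_map_evaluation]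
      exact (h _).comp hu
    have h1 := ProbabilityMeasure.le_liminf_measure_open_of_tendsto hlim hW
    simp only [ProbabilityMeasure.toMeasure_map, Measure.map_apply hT hW.measurableSet] at h1
    rw [e]
    exact h1
  conv_lhs => rw [← iUnion_cylinderInterior hD hU]
  -- The finite subsets of the countable `D` form a countable directed index set, so the measure is
  -- continuous along the union.
  rw [(monotone_cylinderInterior U).measure_iUnion]
  refine iSup_le fun F => (key F).trans (liminf_le_liminf (.of_forall fun n => ?_))
  refine measure_mono ?_
  conv_rhs => rw [← iUnion_cylinderInterior hD hU]
  exact Set.subset_iUnion _ F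

end Configuration

end WeakConvergence

end FreeKawasaki

end

/-! ### The main theorem -/

theorem mainTheorem2 {d : ℕ} (hd : 1 ≤ d)
    (a : FreeKawasaki.Space d → ℝ) (ha : FreeKawasaki.IsJumpRate a)
    (μ : Measure (FreeKawasaki.Configuration d)) [IsProbabilityMeasure μ]
    (hμ : ∀ᵐ γ ∂μ, γ ∈ FreeKawasaki.Theta d)
    (ρ : FreeKawasaki.Space d → ℝ≥0) (hρ : FreeKawasaki.IsFirstCorrelation μ ρ)
    (k : FreeKawasaki.Space d × FreeKawasaki.Space d → ℝ≥0)
    (hk : FreeKawasaki.IsSecondCorrelation μ k)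
    (hmix : ∃ C : ℝ≥0, ∀ x, ∫⁻ y, ‖FreeKawasaki.ursell ρ k x y‖ₑ ≤ C)
    (hF : FreeKawasaki.FourierIsSignedMeasure fun x => (ρ x : ℝ)) :
    ∃ m : ℝ, FreeKawasaki.HasArithmeticMean (fun x => (ρ x : ℝ)) m ∧
      ∃ π : ProbabilityMeasure (FreeKawasaki.Configuration d),
        FreeKawasaki.IsPoisson (fun _ => m) π ∧
        ∃ hP : ∀ t : ℝ≥0, IsProbabilityMeasure (FreeKawasaki.oneDimLaw a μ t),
          Tendsto (β := ProbabilityMeasure (FreeKawasaki.Configuration d))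
            (fun t : ℝ≥0 => ⟨FreeKawasaki.oneDimLaw a μ t, hP t⟩) atTop (𝓝 π) := by
  have : NeZero d := ⟨by omega⟩
  obtain ⟨C, hC⟩ := hmix
  obtain ⟨-, σ, h, hσ, hh, hh1, hF⟩ := hF
  have H : FreeKawasaki.HasFourierMeasure (fun x => (ρ x : ℝ)) σ h := ⟨hσ, hh, hh1, hF⟩
  have hP : ∀ t : ℝ≥0, IsProbabilityMeasure (FreeKawasaki.oneDimLaw a μ t) := fun t =>
    ha.isProbabilityMeasure_oneDimLaw (ha.ae_mem_tameSet t hρ H)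
  -- The spectral atom at the origin serves both as the arithmetic mean and as the Poisson
  -- intensity.
  obtain ⟨π, hπ, hchar⟩ := FreeKawasaki.exists_isPoisson (d := d)
    ⟨FreeKawasaki.atomAtZero σ h, H.atomAtZero_nonneg⟩
  refine ⟨FreeKawasaki.atomAtZero σ h, H.hasArithmeticMean hρ.locallyIntegrable, π, hπ, hP,
    FreeKawasaki.Configuration.tendsto_of_tendsto_charFunctional fun f => ?_⟩
  rw [hchar f]
  exact ha.tendsto_integral_oneDimLaw hρ hk hC H f
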